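/- Let $\mathfrak g$ be a finite-dimensional simple complex Lie algebra with simple roots $\alpha_i$, coroots $\check\alpha_i$ and fundamental weights $\omega_i$ ($i\in I$), weight lattice $P$, root lattice $Q$, highest root $\theta$, and dual Coxeter number $\check h$. Let $\sigma$ be a nontrivial diagram automorphism, that is, a nontrivial permutation of $I$ preserving the Cartan matrix $a_{ij}=\langle\alpha_i,\check\alpha_j\rangle$; it acts on $P$ by $\omega_i\mapsto\omega_{\sigma(i)}$. Let $\mathfrak g_\sigma$ be the orbit Lie algebra: the simple complex Lie algebra whose simple roots $\alpha_{\imath}$ are indexed by the $\sigma$-orbits $\imath$ in $I$ and whose Cartan matrix is $$\langle\alpha_{\imath},\check\alpha_{\jmath}\rangle = s_{\imath}\sum_{i\in\imath}a_{ij}\quad(j\in\jmath),$$ where $s_{\imath}=2$ if $\imath$ contains two adjacent vertices and $s_{\imath}=1$ otherwise. Let $P_\sigma$, $\Phi_\sigma$, $W_\sigma$ be its weight lattice, set of roots and Weyl group, and let $\iota:P^\sigma\to P_\sigma$ be the isomorphism from the lattice of $\sigma$-invariant weights that sends $\sum_{i\in\imath}\omega_i$ to the fundamental weight $\omega_{\imath}$.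 Let $T_\sigma=\operatorname{Hom}(P_\sigma,\mathbb C^\times)$ be the maximal torus of the simply connected group with Lie algebra $\mathfrak g_\sigma$, and write $e^\mu(t)=t(\mu)$. Let $\ell$ be a positive integer and put $$P_\ell^\sigma=\{\lambda\in P^\sigma : \lambda \text{ dominant},\ \langle\lambda,\check\theta\rangle\le\ell\},$$ $$T_{\sigma,\ell}=\{t\in T_\sigma : e^{\alpha}(t)=1 \text{ for all } \alpha\in(\ell+\check h)\,\iota(Q^\sigma)\},\qquad \Delta_\sigma(t)=\prod_{\alpha\in\Phi_\sigma}(e^\alpha(t)-1).$$ For $\lambda\in P^\sigma_\ell$ let $W_\lambda$ be the finite-dimensional irreducible representation of $\mathfrak g_\sigma$ of highest weight $\iota(\lambda)$, on which $t\in T_\sigma$ acts by $e^\mu(t)$ on the weight space of weight $\mu$. Call $t\in T_\sigma$ regular if its stabilizer in $W_\sigma$ is trivial. Then $P^\sigma_\ell$ and $T_{\sigma,\ell}$ are finite, and for every regular $t\in T_{\sigma,\ell}$ one has $\Delta_\sigma(t)\neq 0$ and $$\sum_{\lambda\in P_\ell^\sigma}\bigl|\operatorname{tr}(t\mid W_\lambda)\bigr|^2=\frac{|T_{\sigma,\ell}|}{\Delta_\sigma(t)}.$$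 -/

import Mathlib

open LieAlgebra LieAlgebra.IsKilling LieModule Module

noncomputable section

namespace OrbitVerlinde

section RootSystem

variable {ι M N : Type*} [AddCommGroup M] [Module ℂ M] [AddCommGroup N] [Module ℂ N]

/-- The weight lattice of a root system: the vectors on which all coroots take integer values. -/
def weightLattice (P : RootPairing ι ℂ M N) : AddSubgroup M where
  carrier := {μ | ∀ i, ∃ n : ℤ, P.toLinearMap μ (P.coroot i) = n}
  zero_mem' i := ⟨0, by simp⟩
  add_mem' {x y} hx hy i := by
    obtain ⟨m, hm⟩ := hx i
    obtain ⟨n, hn⟩ := hy i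
    exact ⟨m + n, by simp [hm, hn]⟩
  neg_mem' {x} hx i := by
    obtain ⟨m, hm⟩ := hx i
    exact ⟨-m, by simp [hm]⟩

/-- The integer `⟨μ, α̌⟩` for a weight `μ` and the coroot `α̌` with index `i`. -/
def weightPairing {P : RootPairing ι ℂ M N} (i : ι) : weightLattice P →+ ℤ where
  toFun μ := (μ.2 i).choose
  map_zero' := by
    have h := ((0 : weightLattice P).2 i).choose_spec
    have h' : (0 : ℂ) = ((0 : weightLattice P).2 i).choose := by simpa using h
    exact_mod_cast h'.symm
  map_add' x y := by
    have h := ((x + y).2 i).choose_spec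
    have hx := (x.2 i).choose_spec
    have hy := (y.2 i).choose_spec
    have h' : (((x + y).2 i).choose : ℂ) = (x.2 i).choose + (y.2 i).choose := by
      rw [← h, ← hx, ← hy]; simp
    exact_mod_cast h'

theorem weightPairing_spec {P : RootPairing ι ℂ M N} (i : ι) (μ : weightLattice P) :
    P.toLinearMap (μ : M) (P.coroot i) = (weightPairing i μ : ℂ) :=
  (μ.2 i).choose_spec

/-- A root, as an element of the weight lattice. -/
def rootWeight (P : RootPairing ι ℂ M N) [P.IsCrystallographic] (i : ι) : weightLattice P :=
  ⟨P.root i, fun j ↦ ⟨P.pairingIn ℤ i j, by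
    have := P.algebraMap_pairingIn ℤ i j
    simpa using this.symm⟩⟩

/-- The root lattice, as a subgroup of the weight lattice. -/
def rootLattice (P : RootPairing ι ℂ M N) [P.IsCrystallographic] :
    AddSubgroup (weightLattice P) :=
  AddSubgroup.closure (Set.range (rootWeight P))

theorem weyl_smul_mem (P : RootPairing ι ℂ M N) [P.IsCrystallographic] (w : P.weylGroup) {x : M}
    (hx : x ∈ weightLattice P) : w • x ∈ weightLattice P := by
  revert x
  obtain ⟨w, hw⟩ := w
  induction hw using RootPairing.weylGroup.induction with
  | mem i =>
    intro x hx
    have h : (⟨RootPairing.Equiv.reflection P i, P.reflection_mem_weylGroup i⟩ : P.weylGroup) • x =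
        x - weightPairing i ⟨x, hx⟩ • P.root i := by
      change P.reflection i x = _
      rw [P.reflection_apply, ← Int.cast_smul_eq_zsmul ℂ, ← weightPairing_spec i ⟨x, hx⟩]
      rfl
    rw [h]
    exact sub_mem hx (zsmul_mem (rootWeight P i).2 _)
  | one => intro x hx; simpa using hx
  | mul g₁ g₂ hg₁ hg₂ h₁ h₂ =>
    intro x hx
    rw [← Submonoid.mk_mul_mk _ _ _ hg₁ hg₂, mul_smul]
    exact h₁ (h₂ hx)

/-- The action of an element of the Weyl group on the weight lattice. -/
def weylWeight (P : RootPairing ι ℂ M N) [P.IsCrystallographic] (w : P.weylGroup) :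
    weightLattice P →+ weightLattice P where
  toFun μ := ⟨w • (μ : M), weyl_smul_mem P w μ.2⟩
  map_zero' := by ext; simp
  map_add' x y := by ext; simp

/-- The complex points of the maximal torus of the simply connected group with root system `P`:
its character lattice is the weight lattice, so a point `t` is a homomorphism from the weight
lattice to `ℂˣ`, and `t μ` is the value `e^μ(t)`. -/
abbrev Torus (P : RootPairing ι ℂ M N) : Type _ := AddChar (weightLattice P) ℂ

/-- The action of the Weyl group on the torus: `e^μ(w t) = e^(w⁻¹ μ)(t)`. -/
def weylTorus (P : RootPairing ι ℂ M N) [P.IsCrystallographic] (w : P.weylGroup) (t : Torus P) :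
    Torus P :=
  t.compAddMonoidHom (weylWeight P w⁻¹)

/-- A point of the torus is regular if its stabilizer in the Weyl group is trivial. -/
def IsRegular {P : RootPairing ι ℂ M N} [P.IsCrystallographic] (t : Torus P) : Prop :=
  ∀ w : P.weylGroup, weylTorus P w t = t → w = 1

/-- `∏ (e^α - 1)` over all roots `α`, as a function on the torus. -/
def discriminant (P : RootPairing ι ℂ M N) [P.IsCrystallographic] [Fintype ι] (t : Torus P) : ℂ :=
  ∏ i, (t (rootWeight P i) - 1)

section Base

variable {P : RootPairing ι ℂ M N} (b : P.Base)

/-- `θ` indexes the highest root: its difference with any root is a sum of simple roots. -/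
def IsHighestRoot (θ : ι) : Prop :=
  ∀ i, P.root θ - P.root i ∈ AddSubmonoid.closure (P.root '' b.support)

/-- The dual Coxeter number: `1` plus the sum of the coefficients of the coroot `θ̌` of the
highest root `θ` in terms of the simple coroots. -/
def dualCoxeterNumber (θ : ι) : ℤ :=
  1 + b.flip.height θ

/-- A weight is dominant if all its simple coordinates are non-negative. -/
def IsDominant (μ : weightLattice P) : Prop :=
  ∀ i : b.support, 0 ≤ weightPairing (i : ι) μ

variable [P.IsRootSystem]

/-- The fundamental weights: the dual basis of the simple coroots. -/
def fundamentalWeight (i : b.support) : M :=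
  P.toLinearMap.toPerfPair.symm (b.toCoweightBasis.coord i)

theorem fundamentalWeight_apply (i : b.support) (x : N) :
    P.toLinearMap (fundamentalWeight b i) x = b.toCoweightBasis.coord i x := by
  have h := P.toLinearMap.toPerfPair.apply_symm_apply (b.toCoweightBasis.coord i)
  exact DFunLike.congr_fun h x

theorem fundamentalWeight_coroot [DecidableEq b.support] (i j : b.support) :
    P.toLinearMap (fundamentalWeight b i) (P.coroot j) = if j = i then 1 else 0 := by
  rw [fundamentalWeight_apply, ← b.toCoweightBasis_apply]
  simp [Finsupp.single_apply]

theorem fundamentalWeight_mem (i : b.support) : fundamentalWeight b i ∈ weightLattice P := by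
  classical
  intro k
  have hk := b.coroot_mem_span_int k
  generalize P.coroot k = y at hk
  induction hk using Submodule.span_induction with
  | mem x hx =>
    obtain ⟨j, hj, rfl⟩ := hx
    refine ⟨if (⟨j, hj⟩ : b.support) = i then 1 else 0, ?_⟩
    have := fundamentalWeight_coroot b i ⟨j, hj⟩
    simpa using this
  | zero => exact ⟨0, by simp⟩
  | add x y _ _ hx hy =>
    obtain ⟨m, hm⟩ := hx
    obtain ⟨n, hn⟩ := hy
    exact ⟨m + n, by simp [hm, hn]⟩
  | smul a x _ hx =>
    obtain ⟨m, hm⟩ := hx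
    exact ⟨a * m, by rw [map_zsmul, hm]; simp⟩

/-- The coordinates of weights with respect to the fundamental weights: `μ = ∑ ⟨μ, α̌ᵢ⟩ ωᵢ`. -/
def weightCoords : weightLattice P ≃+ (b.support → ℤ) where
  toFun μ i := weightPairing (i : ι) μ
  invFun n := ∑ i, n i • (⟨fundamentalWeight b i, fundamentalWeight_mem b i⟩ : weightLattice P)
  map_add' x y := by ext; simp
  left_inv μ := by
    classical
    apply Subtype.ext
    apply P.toLinearMap.toPerfPair.injective
    apply b.toCoweightBasis.ext
    intro j
    simp [fundamentalWeight_coroot, weightPairing_spec]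
  right_inv n := by
    classical
    ext j
    have h := weightPairing_spec (j : ι)
      (∑ i, n i • (⟨fundamentalWeight b i, fundamentalWeight_mem b i⟩ : weightLattice P))
    simp [fundamentalWeight_coroot] at h
    have h' : (n j : ℂ) = (weightPairing (j : ι)
      (∑ i, n i • (⟨fundamentalWeight b i, fundamentalWeight_mem b i⟩ : weightLattice P)) : ℤ) := by
      simpa using h
    exact_mod_cast h'.symm

/-- The action on the weight lattice of a permutation `σ` of the simple roots, determined by
`ωᵢ ↦ ω_(σ i)`. -/
def diagramAction (σ : Equiv.Perm b.support) : weightLattice P →+ weightLattice P where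
  toFun μ := (weightCoords b).symm fun i ↦ weightCoords b μ (σ.symm i)
  map_zero' := by
    rw [map_zero]; exact map_zero (weightCoords b).symm
  map_add' x y := by
    rw [← map_add, map_add (weightCoords b)]; rfl

/-- The lattice of `σ`-invariant weights. -/
def invariantWeights (σ : Equiv.Perm b.support) : AddSubgroup (weightLattice P) where
  carrier := {μ | diagramAction b σ μ = μ}
  zero_mem' := map_zero _
  add_mem' {x y} hx hy := by
    change diagramAction b σ (x + y) = x + y
    rw [map_add, show diagramAction b σ x = x from hx, show diagramAction b σ y = y from hy]
  neg_mem' {x} hx := by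
    change diagramAction b σ (-x) = -x
    rw [map_neg, show diagramAction b σ x = x from hx]

/-- The orbits of `σ` on the simple roots. -/
abbrev Orbits {b : P.Base} (σ : Equiv.Perm b.support) : Type _ :=
  Quotient (Equiv.Perm.SameCycle.setoid σ)

/-- The orbit of a simple root. -/
def toOrbit {b : P.Base} (σ : Equiv.Perm b.support) (i : b.support) : Orbits σ :=
  Quotient.mk (Equiv.Perm.SameCycle.setoid σ) i

theorem invariant_coords (σ : Equiv.Perm b.support) (μ : invariantWeights b σ)
    (i j : b.support) (h : σ.SameCycle i j) :
    weightCoords b μ.1 i = weightCoords b μ.1 j := by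
  have h1 : ∀ k, weightCoords b μ.1 (σ k) = weightCoords b μ.1 k := by
    intro k
    have h2 : diagramAction b σ μ.1 = μ.1 := μ.2
    have h3 := congrFun (congrArg (weightCoords b) h2) (σ k)
    simpa [diagramAction] using h3.symm
  obtain ⟨z, rfl⟩ := h
  induction z using Int.induction_on with
  | zero => simp
  | succ n ih => rw [add_comm, zpow_add, zpow_one, Equiv.Perm.mul_apply, h1]; exact ih
  | pred n ih =>
    rw [ih, ← h1 ((σ ^ (-(n : ℤ) - 1)) i), ← Equiv.Perm.mul_apply, ← zpow_one_add,
      add_sub_cancel]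

/-- The common value of the coordinates of an invariant weight on an orbit. -/
def orbitCoord (σ : Equiv.Perm b.support) (μ : invariantWeights b σ) : Orbits σ → ℤ :=
  Quotient.lift (weightCoords b μ.1) (invariant_coords b σ μ)

end Base

section Folding

variable {P : RootPairing ι ℂ M N} [P.IsRootSystem] (b : P.Base)
variable {ι' M' N' : Type*} [AddCommGroup M'] [Module ℂ M'] [AddCommGroup N'] [Module ℂ N']
variable {P' : RootPairing ι' ℂ M' N'} [P'.IsRootSystem] (b' : P'.Base)

/-- The identification of `σ`-invariant weights with the weights of a root system whose simple
roots are indexed by the orbits of `σ`: it sends the sum of the fundamental weights in an orbit to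
the fundamental weight of that orbit. -/
def orbitMap (σ : Equiv.Perm b.support) (e : Orbits σ ≃ b'.support) :
    invariantWeights b σ →+ weightLattice P' where
  toFun μ := (weightCoords b').symm fun k ↦ orbitCoord b σ μ (e.symm k)
  map_zero' := by
    rw [← map_zero (weightCoords b').symm]
    congr 1
    ext k
    obtain ⟨i, hi⟩ := Quotient.exists_rep (e.symm k)
    rw [← hi]
    exact congrFun (map_zero (weightCoords b)) i
  map_add' x y := by
    rw [← map_add]
    congr 1
    ext k
    obtain ⟨i, hi⟩ := Quotient.exists_rep (e.symm k)
    simp only [Pi.add_apply]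
    rw [← hi]
    exact congrFun (map_add (weightCoords b) x.1 y.1) i

variable [Finite ι] [P.IsCrystallographic] [Finite ι'] [P'.IsCrystallographic]

/-- A diagram automorphism: a permutation of the simple roots preserving the Cartan matrix. -/
def IsDiagramAutomorphism (σ : Equiv.Perm b.support) : Prop :=
  ∀ i j, b.cartanMatrix (σ i) (σ j) = b.cartanMatrix i j

/-- An orbit is connected if it contains two distinct simple roots joined by an edge. -/
def IsConnectedOrbit (σ : Equiv.Perm b.support) (o : Orbits σ) : Prop :=
  ∃ i j, toOrbit σ i = o ∧ toOrbit σ j = o ∧ i ≠ j ∧ b.cartanMatrix i j ≠ 0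

open Classical in
/-- The base `b'`, indexed by the orbits of `σ`, has the Cartan matrix of the orbit Lie algebra:
`⟨α_o, α̌_o'⟩ = s_o ∑_{i ∈ o} ⟨αᵢ, α̌ⱼ⟩` for `j ∈ o'`, with `s_o = 2` if the orbit `o` is connected
and `s_o = 1` otherwise. -/
def IsOrbitBase (σ : Equiv.Perm b.support) (e : Orbits σ ≃ b'.support) : Prop :=
  ∀ (o : Orbits σ) (j : b.support),
    b'.cartanMatrix (e o) (e (toOrbit σ j)) =
      (if IsConnectedOrbit b σ o then 2 else 1) *
        ∑ i with toOrbit σ i = o, b.cartanMatrix i j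

/-- The set of `σ`-invariant dominant weights `μ` with `⟨μ, θ̌⟩ ≤ ℓ`. -/
def levelWeights (σ : Equiv.Perm b.support) (θ : ι) (ℓ : ℕ) : Set (invariantWeights b σ) :=
  {μ | IsDominant b μ.1 ∧ weightPairing θ μ.1 ≤ ℓ}

/-- The points `t` of the torus of the orbit root system such that `e^α(t) = 1` for all `α` in
`(ℓ + ȟ)` times the image of the lattice of `σ`-invariant elements of the root lattice. -/
def levelTorus (σ : Equiv.Perm b.support) (e : Orbits σ ≃ b'.support) (θ : ι) (ℓ : ℕ) :
    Subgroup (Torus P') where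
  carrier := {t | ∀ β : invariantWeights b σ, β.1 ∈ rootLattice P →
    t ((ℓ + dualCoxeterNumber b θ : ℤ) • orbitMap b b' σ e β) = 1}
  one_mem' β _ := by simp
  mul_mem' {x y} hx hy β hβ := by
    rw [AddChar.mul_apply, hx β hβ, hy β hβ, one_mul]
  inv_mem' {x} hx β hβ := by
    rw [AddChar.inv_apply, ← zsmul_neg, ← map_neg]
    exact hx (-β) (neg_mem hβ)

end Folding

end RootSystem

section Representation

/-- The subspace of `W` attached to a weight `χ`, that is, the generalized weight space; for a
finite-dimensional representation of a semisimple Lie algebra it is the weight space. -/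
def weightSub {L : Type*} [LieRing L] [LieAlgebra ℂ L] (H : LieSubalgebra ℂ L)
    [H.IsCartanSubalgebra] (W : Type*) [AddCommGroup W] [Module ℂ W] [LieRingModule L W]
    [LieModule ℂ L W] (χ : Weight ℂ H W) : Submodule ℂ W :=
  (genWeightSpace W χ).toSubmodule

open Classical in
theorem isInternal_weights {L : Type*} [LieRing L] [LieAlgebra ℂ L] (H : LieSubalgebra ℂ L)
    [H.IsCartanSubalgebra] (W : Type*) [AddCommGroup W] [Module ℂ W] [LieRingModule L W]
    [LieModule ℂ L W] [FiniteDimensional ℂ W] :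
    DirectSum.IsInternal (weightSub H W) := by
  rw [DirectSum.isInternal_submodule_iff_iSupIndep_and_iSup_eq_top]
  refine ⟨?_, ?_⟩
  · refine LieSubmodule.iSupIndep_toSubmodule.2 ?_
    exact iSupIndep_genWeightSpace' ℂ H W
  · change ⨆ χ : Weight ℂ H W, (genWeightSpace W χ).toSubmodule = ⊤
    rw [← LieSubmodule.iSup_toSubmodule, iSup_genWeightSpace_eq_top' ℂ H W]
    rfl

variable {L : Type*} [LieRing L] [LieAlgebra ℂ L] [FiniteDimensional ℂ L] [IsKilling ℂ L]
variable {H : LieSubalgebra ℂ L} [H.IsCartanSubalgebra]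
variable (W : Type*) [AddCommGroup W] [Module ℂ W] [LieRingModule L W] [LieModule ℂ L W]

/-- `W` contains a highest weight vector of weight `μ`: a nonzero vector of weight `μ` killed by
all positive root spaces. -/
def HasHighestWeight (b : (rootSystem H).Base) (μ : Dual ℂ H) : Prop :=
  ∃ v : W, v ≠ 0 ∧ (∀ h : H, ⁅h, v⁆ = μ h • v) ∧
    ∀ α : H.root, b.IsPos α → ∀ x ∈ rootSpace H α.1, ⁅x, v⁆ = 0

open Classical in
/-- The value `e^χ(t)` for a functional `χ` on `H` in the weight lattice (and `0` outside it). -/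
def torusValue (t : Torus (rootSystem H)) (χ : H → ℂ) : ℂ :=
  if h : ∃ μ : weightLattice (rootSystem H), ⇑(μ : Dual ℂ H) = χ then t h.choose else 0

variable [FiniteDimensional ℂ W]

variable (H) in
open Classical in
/-- The weight space decomposition of a finite-dimensional representation. -/
def weightDecomp : W ≃ₗ[ℂ] DirectSum (Weight ℂ H W) fun χ ↦ weightSub H W χ :=
  (LinearEquiv.ofBijective (DirectSum.coeLinearMap (weightSub H W)) (isInternal_weights H W)).symm

open Classical in
/-- The operator by which a point `t` of the torus acts on a finite-dimensional representation:
multiplication by `e^χ(t)` on the weight space of each weight `χ`. -/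
def torusOperator (t : Torus (rootSystem H)) : End ℂ W :=
  (weightDecomp H W).symm.toLinearMap ∘ₗ
    (DirectSum.lmap fun χ : Weight ℂ H W ↦
      (torusValue t χ • LinearMap.id : weightSub H W χ →ₗ[ℂ] weightSub H W χ)) ∘ₗ
    (weightDecomp H W).toLinearMap

theorem torusOperator_apply (t : Torus (rootSystem H)) (μ : weightLattice (rootSystem H)) (v : W)
    (hv : ∀ h : H, ⁅h, v⁆ = (μ : Dual ℂ H) h • v) : torusOperator W t v = t μ • v := by
  classical
  by_cases hv0 : v = 0
  · simp [hv0]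
  have hmem : v ∈ genWeightSpace W (μ : Dual ℂ H) :=
    weightSpace_le_genWeightSpace W _ ((mem_weightSpace _ v).2 hv)
  let χ : Weight ℂ H W := ⟨⇑(μ : Dual ℂ H), fun h ↦ hv0 (by
    rw [h] at hmem; simpa using hmem)⟩
  have hχ : torusValue t χ = t μ := by
    have h : ∃ ν : weightLattice (rootSystem H), ⇑(ν : Dual ℂ H) = χ := ⟨μ, rfl⟩
    rw [torusValue, dif_pos h]
    congr 1
    exact Subtype.ext (DFunLike.coe_injective h.choose_spec)
  have hdec : weightDecomp H W v =
      DirectSum.lof ℂ (Weight ℂ H W) (fun χ ↦ weightSub H W χ) χ ⟨v, hmem⟩ := by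
    rw [weightDecomp, LinearEquiv.symm_apply_eq]
    exact (DirectSum.coeLinearMap_lof (weightSub H W) χ ⟨v, hmem⟩).symm
  have hsymm (x : weightSub H W χ) : (weightDecomp H W).symm
      (DirectSum.lof ℂ (Weight ℂ H W) (fun χ ↦ weightSub H W χ) χ x) = (x : W) :=
    DirectSum.coeLinearMap_lof (weightSub H W) χ x
  simp only [torusOperator, LinearMap.comp_apply, LinearEquiv.coe_coe]
  rw [hdec, DirectSum.lmap_lof, hsymm]
  simp [hχ]

end Representation

end OrbitVerlinde

end

noncomputable section

set_option linter.unusedSectionVars false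

namespace OrbitVerlinde

/-! ### Weight lattice, Weyl group, invariant form and positive roots -/

section WeightLattice

variable {ι M N : Type*} [AddCommGroup M] [Module ℂ M] [AddCommGroup N] [Module ℂ N]
variable {P : RootPairing ι ℂ M N}

/-! Put k = ℓ + ȟ. The points of T_{σ,ℓ} are the characters of P_σ / kι(Q^σ), a finite group, so
|T_{σ,ℓ}| is its order. For t in T_{σ,ℓ} the alternating sum J(x) = ∑_w sgn(w) t(wx) over W_σ is a
function on this quotient. If t is regular, the characters x ↦ t(wx) are pairwise distinct, and
orthogonality gives ∑_q |J(q)|² = |W_σ| · |P_σ / kι(Q^σ)| (`sum_normSq_quotient`).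

The function J changes by the sign under W_σ and vanishes on the walls of the alcove {x strictly
dominant, ⟨x, θ̌⟩ < k}, where x is lifted to P^σ to be paired with θ̌. The affine group W_σ ⋉
kι(Q^σ) moves every weight into the closed alcove (`exists_affine_mem_closed_alcove`) and acts
freely on the interior (`eq_of_mem_alcove`), so the sum over the quotient is |W_σ| times the sum
over the interior (`sum_normSq_alcove`). Since ⟨ρ, θ̌⟩ = ȟ - 1, translation by ρ identifies P_ℓ^σ
with the interior weights (`levelWeightsEquiv`). By the Weyl character formula J(ρ + ι(λ)) is the
Weyl denominator at t times tr(t | W_λ), and because t is unitary the denominator has squared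
absolute value Δ_σ(t). Division by Δ_σ(t) gives the theorem.

Two inputs need work. The first is the affine reflection group. A nontrivial σ forces all roots of 𝔤
to have the same length (`rootNorm_eq_of_isDiagramAutomorphism`), so roots and coroots satisfy the
same linear relations. Each simple reflection of W_σ is the restriction of an element of the Weyl
group of 𝔤. The root θ is σ-invariant, the reflection in ι(θ) lies in W_σ, and the W_σ-orbit of ι(θ)
generates ι(Q^σ) (`reflection_and_span_of_invariant_root`). Hence the affine group is generated by
the reflections in the walls of the alcove. Freeness is then the deletion argument for words in
reflections (`eq_one_of_mem_chamber`).

The second is the Weyl character formula, proved with the Casimir operator. It acts by a scalar on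
an irreducible module, and taking formal traces shows that denominator times character is an
eigenvector of the Laplace operator with eigenvalue |ρ + Λ|². The product is alternating with
leading term e^(ρ+Λ), and ρ + Λ is the only strictly dominant weight below it of the same norm, so
the product is the alternating sum over the orbit of ρ + Λ. -/

theorem weightPairing_eq_iff (i : ι) (μ : weightLattice P) (n : ℤ) :
    weightPairing i μ = n ↔ P.toLinearMap (μ : M) (P.coroot i) = n := by
  rw [weightPairing_spec]
  exact_mod_cast Iff.rfl

variable [P.IsCrystallographic]

@[simp]
theorem weightPairing_rootWeight (i j : ι) :
    weightPairing j (rootWeight P i) = P.pairingIn ℤ i j := by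
  rw [weightPairing_eq_iff]
  have := P.algebraMap_pairingIn ℤ i j
  simpa [rootWeight] using this.symm

theorem weightPairing_rootWeight_self (i : ι) : weightPairing i (rootWeight P i) = 2 := by
  simp

@[simp]
theorem coe_weylWeight (w : P.weylGroup) (μ : weightLattice P) :
    (weylWeight P w μ : M) = w • (μ : M) := rfl

@[simp]
theorem weylWeight_one (μ : weightLattice P) : weylWeight P 1 μ = μ := by
  ext; simp

theorem weylWeight_mul (v w : P.weylGroup) (μ : weightLattice P) :
    weylWeight P (v * w) μ = weylWeight P v (weylWeight P w μ) := by
  ext; simp [mul_smul]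

@[simp]
theorem weylWeight_inv_apply (w : P.weylGroup) (μ : weightLattice P) :
    weylWeight P w⁻¹ (weylWeight P w μ) = μ := by
  rw [← weylWeight_mul]; simp

@[simp]
theorem weylWeight_apply_inv (w : P.weylGroup) (μ : weightLattice P) :
    weylWeight P w (weylWeight P w⁻¹ μ) = μ := by
  rw [← weylWeight_mul]; simp

theorem weylWeight_ofIdx (i : ι) (μ : weightLattice P) :
    weylWeight P (RootPairing.weylGroup.ofIdx P i) μ = μ - weightPairing i μ • rootWeight P i := by
  ext
  change P.reflection i (μ : M) = _
  rw [P.reflection_apply]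
  simp only [AddSubgroup.coe_sub, AddSubgroup.coe_zsmul]
  rw [← Int.cast_smul_eq_zsmul ℂ, ← weightPairing_spec]
  rfl

/-- The action of the Weyl group on the indices of the roots. -/
def weylIndex (w : P.weylGroup) : ι ≃ ι := P.weylGroupToPerm w

theorem weylWeight_rootWeight (w : P.weylGroup) (i : ι) :
    weylWeight P w (rootWeight P i) = rootWeight P (weylIndex w i) := by
  ext
  exact P.weylGroup_apply_root w i

theorem weylIndex_mul (v w : P.weylGroup) (i : ι) :
    weylIndex (v * w) i = weylIndex v (weylIndex w i) := by
  simp [weylIndex]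

theorem weylIndex_ofIdx (i j : ι) :
    weylIndex (RootPairing.weylGroup.ofIdx P i) j = P.reflectionPerm i j := rfl

theorem weightPairing_reflectionPerm (i j : ι) (μ : weightLattice P) :
    weightPairing (P.reflectionPerm i j) (weylWeight P (RootPairing.weylGroup.ofIdx P i) μ) =
      weightPairing j μ := by
  rw [weightPairing_eq_iff, ← weightPairing_spec, P.coroot_reflectionPerm]
  change P.toLinearMap (P.reflection i μ) (P.coreflection i (P.coroot j)) = _
  simp only [RootPairing.reflection_apply, RootPairing.coreflection_apply, map_sub, map_smul,
    LinearMap.sub_apply, LinearMap.smul_apply, smul_eq_mul, RootPairing.root_coroot_two,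
    RootPairing.root', RootPairing.coroot', LinearMap.flip_apply]
  ring_nf

theorem weightPairing_weylIndex (w : P.weylGroup) (i : ι) (μ : weightLattice P) :
    weightPairing (weylIndex w i) (weylWeight P w μ) = weightPairing i μ := by
  obtain ⟨w, hw⟩ := w
  induction hw using RootPairing.weylGroup.induction generalizing i μ with
  | mem j => exact weightPairing_reflectionPerm j i μ
  | one => exact congrArg₂ _ rfl (weylWeight_one μ)
  | mul x y hx hy h₁ h₂ =>
    rw [← Submonoid.mk_mul_mk _ _ _ hx hy, weylIndex_mul, weylWeight_mul]
    exact (h₁ _ _).trans (h₂ _ _)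

theorem weightPairing_weylWeight (w : P.weylGroup) (i : ι) (μ : weightLattice P) :
    weightPairing i (weylWeight P w μ) = weightPairing (weylIndex w⁻¹ i) μ := by
  rw [← weightPairing_weylIndex w (weylIndex w⁻¹ i) μ, ← weylIndex_mul]
  simp [weylIndex]

theorem finite_weylGroup [Finite ι] [P.IsRootSystem] : Finite P.weylGroup := by
  refine Finite.of_injective (fun w : P.weylGroup ↦ P.weylGroupToPerm w) fun v w h ↦ ?_
  apply Subtype.ext
  apply RootPairing.Equiv.weightHom_injective P
  apply LinearEquiv.toLinearMap_injective
  apply LinearMap.ext_on_range (v := P.root) RootPairing.IsRootSystem.span_root_eq_top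
  intro i
  have := DFunLike.congr_fun h i
  change v • P.root i = w • P.root i
  rw [P.weylGroup_apply_root, P.weylGroup_apply_root, this]

theorem weylGroup_eq_one [P.IsRootSystem] (w : P.weylGroup) (h : ∀ μ, weylWeight P w μ = μ) :
    w = 1 := by
  apply Subtype.ext
  apply RootPairing.Equiv.weightHom_injective P
  apply LinearEquiv.toLinearMap_injective
  apply LinearMap.ext_on_range (v := P.root) RootPairing.IsRootSystem.span_root_eq_top
  intro i
  have := congrArg Subtype.val (h (rootWeight P i))
  simpa [rootWeight] using! this

/-- A property of Weyl group elements can be checked on simple reflections. -/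
theorem weylGroup_induction_simple [P.IsReduced] [Finite ι] (b : P.Base) {p : P.weylGroup → Prop}
    (simple : ∀ i ∈ b.support, p (RootPairing.weylGroup.ofIdx P i)) (one : p 1)
    (mul : ∀ v w, p v → p w → p (v * w)) (w : P.weylGroup) : p w := by
  -- Every root arises from simple roots by simple reflections and negation. Negation does not
  -- change the reflection, and a simple reflection conjugates it.
  have hofIdx (i : ι) : p (RootPairing.weylGroup.ofIdx P i) := by
    have hneg (i : ι) : RootPairing.weylGroup.ofIdx P (P.reflectionPerm i i) =
        RootPairing.weylGroup.ofIdx P i := by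
      apply Subtype.ext
      apply RootPairing.Equiv.weightHom_injective P
      ext x
      change P.reflection _ x = P.reflection _ x
      rw [P.reflection_reflectionPerm]
      simp
    have hconj (i j : ι) : RootPairing.weylGroup.ofIdx P (P.reflectionPerm j i) =
        RootPairing.weylGroup.ofIdx P j * RootPairing.weylGroup.ofIdx P i *
          RootPairing.weylGroup.ofIdx P j := by
      apply Subtype.ext
      apply RootPairing.Equiv.weightHom_injective P
      ext x
      change P.reflection _ x = P.reflection _ (P.reflection _ (P.reflection _ x))
      rw [P.reflection_reflectionPerm]
      rfl
    refine b.induction_reflect i (fun i hi ↦ by rwa [hneg]) simple fun i j hi hj ↦ ?_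
    rw [hconj]
    exact mul _ _ (mul _ _ (simple j hj) hi) (simple j hj)
  obtain ⟨w, hw⟩ := w
  induction hw using RootPairing.weylGroup.induction with
  | mem i => exact hofIdx i
  | one => exact one
  | mul x y hx hy h₁ h₂ => exact mul ⟨x, hx⟩ ⟨y, hy⟩ h₁ h₂

section Form

variable [Fintype ι]

/-- The Weyl group invariant form `∑ ⟨μ, α̌⟩ ⟨ν, α̌⟩` on the weight lattice. -/
def weightForm : weightLattice P →+ weightLattice P →+ ℤ where
  toFun μ :=
    { toFun := fun ν ↦ ∑ i : ι, weightPairing i μ * weightPairing i ν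
      map_zero' := by simp
      map_add' := by intros; simp [mul_add, Finset.sum_add_distrib] }
  map_zero' := by ext; simp
  map_add' x y := by ext; simp [add_mul, Finset.sum_add_distrib]

theorem weightForm_apply (μ ν : weightLattice P) :
    weightForm μ ν = ∑ i : ι, weightPairing i μ * weightPairing i ν := rfl

theorem weightForm_comm (μ ν : weightLattice P) : weightForm μ ν = weightForm ν μ := by
  simp [weightForm_apply, mul_comm]

theorem weightForm_weylWeight (w : P.weylGroup) (μ ν : weightLattice P) :
    weightForm (weylWeight P w μ) (weylWeight P w ν) = weightForm μ ν := by
  rw [weightForm_apply, weightForm_apply]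
  refine (Equiv.sum_comp (weylIndex w) _).symm.trans ?_
  simp [weightPairing_weylIndex]

theorem weightForm_self_nonneg (μ : weightLattice P) : 0 ≤ weightForm μ μ :=
  Finset.sum_nonneg fun _ _ ↦ mul_self_nonneg _

theorem eq_zero_of_weightForm_self [P.IsRootSystem] {μ : weightLattice P}
    (h : weightForm μ μ = 0) : μ = 0 := by
  have h1 : ∀ i, weightPairing i μ = 0 := by
    intro i
    have := (Finset.sum_eq_zero_iff_of_nonneg (fun i _ ↦ mul_self_nonneg _)).1 h i
      (Finset.mem_univ i)
    simpa using this
  apply Subtype.ext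
  apply P.toLinearMap.toPerfPair.injective
  apply LinearMap.ext_on_range (v := P.coroot) RootPairing.IsRootSystem.span_coroot_eq_top
  intro i
  simpa [h1] using weightPairing_spec i μ

theorem weightForm_self_pos [P.IsRootSystem] {μ : weightLattice P} (h : μ ≠ 0) :
    0 < weightForm μ μ :=
  lt_of_le_of_ne (weightForm_self_nonneg μ) fun h' ↦ h (eq_zero_of_weightForm_self h'.symm)

theorem rootWeight_ne_zero (i : ι) : rootWeight P i ≠ 0 := by
  intro h
  have := weightPairing_rootWeight_self (P := P) i
  simp [h] at this

/-- The form is invariant under the reflection in the root, which negates the root itself; expanding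
gives the proportionality of root and coroot. -/
theorem two_mul_weightForm_rootWeight (i : ι) (μ : weightLattice P) :
    2 * weightForm (rootWeight P i) μ =
      weightForm (rootWeight P i) (rootWeight P i) * weightPairing i μ := by
  have h := weightForm_weylWeight (RootPairing.weylGroup.ofIdx P i) (rootWeight P i) μ
  simp only [weylWeight_ofIdx, weightPairing_rootWeight_self, map_sub, map_zsmul,
    AddMonoidHom.sub_apply, AddMonoidHom.smul_apply, smul_eq_mul] at h
  linarith

end Form

section Base

variable (b : P.Base)

/-- The submonoid of sums of simple roots. -/
def simpleCone : AddSubmonoid (weightLattice P) :=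
  AddSubmonoid.closure (rootWeight P '' b.support)

theorem mem_simpleCone_iff (μ : weightLattice P) :
    μ ∈ simpleCone b ↔ (μ : M) ∈ AddSubmonoid.closure (P.root '' b.support) := by
  have : AddSubmonoid.closure (P.root '' b.support) =
      (simpleCone b).map (weightLattice P).subtype := by
    rw [simpleCone, AddMonoidHom.map_mclosure, Set.image_image]
    rfl
  rw [this, AddSubmonoid.mem_map]
  constructor
  · exact fun h ↦ ⟨_, h, rfl⟩
  · rintro ⟨x, hx, h⟩
    rwa [show μ = x from Subtype.ext h.symm]

/-- `IsPos` is defined by the sign of the height. The coefficients of a root all have one sign, so a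
positive height makes them nonnegative. -/
theorem mem_closure_root_of_isPos {i : ι} (hi : b.IsPos i) :
    P.root i ∈ AddSubmonoid.closure (P.root '' b.support) := by
  classical
  obtain ⟨f, hf₀, hf₁, hf₂⟩ := b.exists_root_eq_sum_int i
  have hf : 0 ≤ f := by
    refine (hf₁.resolve_right fun h ↦ ?_).le
    rw [RootPairing.Base.isPos_iff, RootPairing.Base.height_eq_sum hf₂] at hi
    exact absurd hi (not_lt.2 (Finset.sum_nonpos fun i _ ↦ h.le i))
  rw [hf₂]
  refine sum_mem fun j hj ↦ ?_
  obtain ⟨n, hn⟩ := Int.eq_ofNat_of_zero_le (hf j)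
  rw [hn, natCast_zsmul]
  have hmem : P.root j ∈ AddSubmonoid.closure (P.root '' b.support) :=
    AddSubmonoid.subset_closure ⟨j, hj, rfl⟩
  exact nsmul_mem hmem n

theorem rootWeight_mem_simpleCone {i : ι} (hi : b.IsPos i) : rootWeight P i ∈ simpleCone b :=
  (mem_simpleCone_iff b _).2 (mem_closure_root_of_isPos b hi)

theorem isPos_of_mem_closure {i : ι}
    (hi : P.root i ∈ AddSubmonoid.closure (P.root '' b.support)) : b.IsPos i := by
  by_contra h
  let _ := P.indexNeg
  rw [← RootPairing.Base.IsPos.neg_iff_not] at h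
  have h2 := b.height_ne_zero i
  rw [RootPairing.Base.isPos_iff, RootPairing.Base.height_reflectionPerm_self] at h
  obtain ⟨n, hn⟩ : ∃ n : ι → ℕ, P.root i = ∑ j ∈ b.support, (n j : ℤ) • P.root j := by
    clear h h2
    generalize P.root i = x at hi
    induction hi using AddSubmonoid.closure_induction with
    | mem x hx =>
      classical
      obtain ⟨j, hj, rfl⟩ := hx
      refine ⟨Pi.single j 1, ?_⟩
      rw [Finset.sum_eq_single_of_mem j hj] <;> simp +contextual
    | zero => exact ⟨0, by simp⟩
    | add x y _ _ hx hy =>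
      obtain ⟨m, hm⟩ := hx
      obtain ⟨n, hn⟩ := hy
      exact ⟨m + n, by simp [hm, hn, add_smul, Finset.sum_add_distrib]⟩
  rw [RootPairing.Base.height_eq_sum hn] at h
  have : (0 : ℤ) ≤ ∑ j ∈ b.support, (n j : ℤ) := Finset.sum_nonneg fun _ _ ↦ by positivity
  linarith

theorem exists_coeff_of_mem_simpleCone {μ : weightLattice P} (h : μ ∈ simpleCone b) :
    ∃ n : b.support → ℕ, μ = ∑ j, n j • rootWeight P (j : ι) := by
  classical
  induction h using AddSubmonoid.closure_induction with
  | mem x hx =>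
    obtain ⟨j, hj, rfl⟩ := hx
    refine ⟨Pi.single ⟨j, hj⟩ 1, ?_⟩
    rw [Finset.sum_eq_single ⟨j, hj⟩] <;> simp +contextual
  | zero => exact ⟨0, by simp⟩
  | add x y _ _ hx hy =>
    obtain ⟨m, hm⟩ := hx
    obtain ⟨n, hn⟩ := hy
    exact ⟨m + n, by simp [hm, hn, add_smul, Finset.sum_add_distrib]⟩

theorem weightForm_nonneg_of_mem_simpleCone [Fintype ι] {μ ν : weightLattice P}
    (hμ : μ ∈ simpleCone b) (hν : IsDominant b ν) : 0 ≤ weightForm μ ν := by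
  induction hμ using AddSubmonoid.closure_induction with
  | mem x hx =>
    obtain ⟨j, hj, rfl⟩ := hx
    have h1 := two_mul_weightForm_rootWeight j ν
    have h2 := weightForm_self_nonneg (rootWeight P j)
    have h3 := hν ⟨j, hj⟩
    have := mul_nonneg h2 h3
    dsimp only at this
    linarith
  | zero => simp
  | add x y _ _ hx hy => simp only [map_add, AddMonoidHom.add_apply]; exact add_nonneg hx hy

variable [P.IsRootSystem]

theorem rootWeight_linearIndependent :
    LinearIndependent ℤ (fun j : b.support ↦ rootWeight P (j : ι)) := by
  have h : LinearIndependent ℤ (fun j : b.support ↦ P.root (j : ι)) :=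
    b.linearIndepOn_root.linearIndependent.restrict_scalars' ℤ
  exact h.of_comp (weightLattice P).subtype.toIntLinearMap

theorem weightForm_pos_of_mem_simpleCone [Fintype ι] {μ ν : weightLattice P}
    (hμ : μ ∈ simpleCone b) (h0 : μ ≠ 0) (hν : ∀ j ∈ b.support, 0 < weightPairing j ν) :
    0 < weightForm μ ν := by
  obtain ⟨n, rfl⟩ := exists_coeff_of_mem_simpleCone b hμ
  have hpos (j : b.support) : 0 < weightForm (rootWeight P (j : ι)) ν := by
    have h1 := two_mul_weightForm_rootWeight (j : ι) ν
    have h2 := weightForm_self_pos (rootWeight_ne_zero (P := P) (j : ι))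
    have := mul_pos h2 (hν j j.2)
    linarith
  obtain ⟨j, hj⟩ : ∃ j, n j ≠ 0 := by
    by_contra! h
    simp [h] at h0
  simp only [map_sum, AddMonoidHom.finsetSum_apply, map_nsmul, AddMonoidHom.nsmul_apply]
  refine Finset.sum_pos' (fun i _ ↦ nsmul_nonneg (hpos i).le _) ⟨j, Finset.mem_univ j, ?_⟩
  exact nsmul_pos (hpos j) hj

/-- The weight whose simple coordinates are all `1`. -/
def weylVector : weightLattice P := (weightCoords b).symm fun _ ↦ 1

theorem weightPairing_weightCoords_symm (f : b.support → ℤ) (i : b.support) :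
    weightPairing (i : ι) ((weightCoords b).symm f) = f i :=
  congrFun ((weightCoords b).apply_symm_apply f) i

theorem weightPairing_weylVector {i : ι} (hi : i ∈ b.support) :
    weightPairing i (weylVector b) = 1 :=
  weightPairing_weightCoords_symm b _ ⟨i, hi⟩

theorem weight_ext {μ ν : weightLattice P}
    (h : ∀ i ∈ b.support, weightPairing i μ = weightPairing i ν) : μ = ν :=
  (weightCoords b).injective (funext fun i ↦ h i i.2)

theorem weightPairing_pos_of_isPos [Fintype ι] {i : ι} (hi : b.IsPos i) {μ : weightLattice P}
    (hμ : ∀ j ∈ b.support, 0 < weightPairing j μ) : 0 < weightPairing i μ := by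
  have h1 := two_mul_weightForm_rootWeight i μ
  have h2 := weightForm_self_pos (rootWeight_ne_zero (P := P) i)
  have h3 := weightForm_pos_of_mem_simpleCone b (rootWeight_mem_simpleCone b hi)
    (rootWeight_ne_zero i) hμ
  by_contra! h
  nlinarith

/-- Choose w to maximize the product of wμ with ρ: a negative coordinate could be reflected away,
and that would increase the product. -/
theorem exists_weylWeight_isDominant [Finite ι] (μ : weightLattice P) :
    ∃ w, IsDominant b (weylWeight P w μ) := by
  have := Fintype.ofFinite ι
  have := finite_weylGroup (P := P)
  obtain ⟨w, hw⟩ := Finite.exists_max fun w ↦ weightForm (weylWeight P w μ) (weylVector b)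
  refine ⟨w, fun i ↦ ?_⟩
  have h := hw (RootPairing.weylGroup.ofIdx P (i : ι) * w)
  rw [weylWeight_mul, weylWeight_ofIdx] at h
  simp only [map_sub, map_zsmul, AddMonoidHom.sub_apply, AddMonoidHom.smul_apply,
    smul_eq_mul] at h
  have h1 := two_mul_weightForm_rootWeight (i : ι) (weylVector b)
  have h2 := weightForm_self_pos (rootWeight_ne_zero (P := P) (i : ι))
  rw [weightPairing_weylVector b i.2] at h1
  by_contra! h3
  simp at h
  nlinarith

/-- Here -μ is dominant, so its product with the cone element μ is nonnegative; hence the norm of μ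
is at most 0. -/
theorem eq_zero_of_simpleCone_of_nonpos [Finite ι] {μ : weightLattice P} (hμ : μ ∈ simpleCone b)
    (h : ∀ i ∈ b.support, weightPairing i μ ≤ 0) : μ = 0 := by
  have := Fintype.ofFinite ι
  apply eq_zero_of_weightForm_self
  refine le_antisymm ?_ (weightForm_self_nonneg μ)
  have := weightForm_nonneg_of_mem_simpleCone b hμ (ν := -μ) fun i ↦ by
    simpa using h i i.2
  simpa using this

theorem simpleCone_antisymm {μ : weightLattice P} (h₁ : μ ∈ simpleCone b)
    (h₂ : -μ ∈ simpleCone b) : μ = 0 := by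
  obtain ⟨m, hm⟩ := exists_coeff_of_mem_simpleCone b h₁
  obtain ⟨n, hn⟩ := exists_coeff_of_mem_simpleCone b h₂
  have h : ∑ j, ((m j : ℤ) + n j) • rootWeight P (j : ι) = 0 := by
    simp only [add_smul, Finset.sum_add_distrib, natCast_zsmul]
    rw [← hm, ← hn]; simp
  have := Fintype.linearIndependent_iff.1 (rootWeight_linearIndependent b) _ h
  have hm0 : ∀ j, m j = 0 := fun j ↦ by have := this j; omega
  simp [hm, hm0]

open Classical in
/-- The positive roots. -/
def positiveRoots [Fintype ι] : Finset ι := Finset.univ.filter fun i ↦ b.IsPos i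

theorem mem_positiveRoots [Fintype ι] {i : ι} : i ∈ positiveRoots b ↔ b.IsPos i := by
  simp [positiveRoots]

theorem reflectionPerm_mem_positiveRoots_erase [Fintype ι] [DecidableEq ι] [P.IsReduced] {i j : ι}
    (hj : j ∈ b.support) (hi : i ∈ (positiveRoots b).erase j) :
    P.reflectionPerm j i ∈ (positiveRoots b).erase j := by
  rw [Finset.mem_erase, mem_positiveRoots] at hi ⊢
  refine ⟨fun h ↦ ?_, hi.2.reflectionPerm hj hi.1⟩
  have h1 := congrArg (P.reflectionPerm j) h
  rw [P.reflectionPerm_involutive j i] at h1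
  have h2 := hi.2
  rw [h1] at h2
  have := (RootPairing.Base.IsPos.neg_iff_not b j).1 h2
  exact this (RootPairing.Base.isPos_of_mem_support hj)

/-- The simple reflection at j permutes the positive roots other than αⱼ. Their sum is therefore
fixed and pairs to 0 with the coroot, while αⱼ contributes 2. -/
theorem two_nsmul_weylVector [Fintype ι] [P.IsReduced] :
    2 • weylVector b = ∑ i ∈ positiveRoots b, rootWeight P i := by
  classical
  refine weight_ext b fun j hj ↦ ?_
  have hjp : j ∈ positiveRoots b :=
    (mem_positiveRoots b).2 (RootPairing.Base.isPos_of_mem_support hj)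
  rw [← Finset.add_sum_erase _ _ hjp, map_add, map_nsmul, weightPairing_weylVector b hj,
    weightPairing_rootWeight_self]
  set S := ∑ i ∈ (positiveRoots b).erase j, rootWeight P i with hS
  have h : weylWeight P (RootPairing.weylGroup.ofIdx P j) S = S := by
    rw [hS, map_sum]
    refine Finset.sum_nbij' (P.reflectionPerm j) (P.reflectionPerm j)
      (fun i hi ↦ reflectionPerm_mem_positiveRoots_erase b hj hi)
      (fun i hi ↦ reflectionPerm_mem_positiveRoots_erase b hj hi)
      (fun i _ ↦ P.reflectionPerm_involutive j i)
      (fun i _ ↦ P.reflectionPerm_involutive j i) ?_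
    intro i _
    rw [weylWeight_rootWeight, weylIndex_ofIdx]
  rw [weylWeight_ofIdx, sub_eq_self] at h
  have h2 := congrArg (weightPairing j) h
  simp at h2
  simp [h2]

end Base

end WeightLattice

/-! ### A nontrivial diagram automorphism forces equal root lengths -/

section SimplyLaced

variable {ι M N : Type*} [AddCommGroup M] [Module ℂ M] [AddCommGroup N] [Module ℂ N]
variable {P : RootPairing ι ℂ M N} [P.IsCrystallographic] [P.IsRootSystem] [Fintype ι]

/-- The squared length of a root. -/
def rootNorm (P : RootPairing ι ℂ M N) [P.IsCrystallographic] (i : ι) : ℤ :=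
  weightForm (rootWeight P i) (rootWeight P i)

theorem rootNorm_pos (i : ι) : 0 < rootNorm P i :=
  weightForm_self_pos (rootWeight_ne_zero i)

theorem two_mul_weightForm_eq (i : ι) (μ : weightLattice P) :
    2 * weightForm μ (rootWeight P i) = rootNorm P i * weightPairing i μ := by
  rw [weightForm_comm, two_mul_weightForm_rootWeight]
  rfl

theorem rootNorm_mul_pairingIn (i j : ι) :
    rootNorm P j * P.pairingIn ℤ i j = rootNorm P i * P.pairingIn ℤ j i := by
  rw [← weightPairing_rootWeight, ← weightPairing_rootWeight, ← two_mul_weightForm_eq,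
    ← two_mul_weightForm_eq, weightForm_comm]

theorem rootNorm_reflectionPerm (i j : ι) : rootNorm P (P.reflectionPerm j i) = rootNorm P i := by
  rw [rootNorm, ← weylIndex_ofIdx, ← weylWeight_rootWeight, weightForm_weylWeight]
  rfl

theorem pairingIn_ne_zero_comm {i j : ι} : P.pairingIn ℤ i j ≠ 0 ↔ P.pairingIn ℤ j i ≠ 0 := by
  have := rootNorm_mul_pairingIn (P := P) i j
  have h1 := rootNorm_pos (P := P) i
  have h2 := rootNorm_pos (P := P) j
  constructor
  · rintro h h'
    rw [h', mul_zero] at this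
    exact (mul_ne_zero h2.ne' h) this
  · rintro h h'
    rw [h', mul_zero] at this
    exact (mul_ne_zero h1.ne' h) this.symm

variable {b : P.Base}

/-- A set of simple roots which is the support of a positive root as long as the simple root
`i`. -/
def IsRootSupport (i : b.support) (C : Finset b.support) : Prop :=
  ∃ (γ : ι) (m : b.support → ℕ), rootWeight P γ = ∑ j, m j • rootWeight P (j : ι) ∧
    (∀ j, m j ≠ 0 ↔ j ∈ C) ∧ rootNorm P γ = rootNorm P i

theorem isRootSupport_singleton [DecidableEq ι] (i : b.support) : IsRootSupport i {i} := by
  refine ⟨i, Pi.single i 1, ?_, fun j ↦ ?_, rfl⟩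
  · rw [Finset.sum_eq_single i] <;> simp +contextual
  · by_cases h : j = i <;> simp [h]

theorem weightPairing_sum_nonpos {m : b.support → ℕ} {x : b.support} (hx : m x = 0) :
    weightPairing (x : ι) (∑ j, m j • rootWeight P (j : ι)) ≤ 0 := by
  rw [map_sum]
  refine Finset.sum_nonpos fun j _ ↦ ?_
  rw [map_nsmul, weightPairing_rootWeight]
  by_cases hj : j = x
  · simp [hj, hx]
  · exact nsmul_nonpos (b.pairingIn_le_zero_of_ne (fun h ↦ hj (Subtype.ext h)) j.2 x.2) _

theorem weightPairing_sum_neg {m : b.support → ℕ} {c x : b.support} (hx : m x = 0) (hc : m c ≠ 0)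
    (h : P.pairingIn ℤ c x ≠ 0) :
    weightPairing (x : ι) (∑ j, m j • rootWeight P (j : ι)) < 0 := by
  rw [map_sum]
  have hle (j : b.support) : weightPairing (x : ι) (m j • rootWeight P (j : ι)) ≤ 0 := by
    rw [map_nsmul, weightPairing_rootWeight]
    by_cases hj : j = x
    · simp [hj, hx]
    · exact nsmul_nonpos (b.pairingIn_le_zero_of_ne (fun h ↦ hj (Subtype.ext h)) j.2 x.2) _
  refine Finset.sum_neg' (fun j _ ↦ hle j) ⟨c, Finset.mem_univ c, lt_of_le_of_ne (hle c) ?_⟩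
  rw [map_nsmul, weightPairing_rootWeight]
  simp [hc, h]

/-- The root γ pairs negatively with a simple root adjacent to its support, so reflecting γ adds a
positive multiple of that simple root and keeps the length. -/
theorem IsRootSupport.insert [DecidableEq ι] {i : b.support} {C : Finset b.support}
    (hC : IsRootSupport i C) {c x : b.support} (hc : c ∈ C) (hx : x ∉ C)
    (h : P.pairingIn ℤ c x ≠ 0) : IsRootSupport i (insert x C) := by
  obtain ⟨γ, m, hγ, hm, hn⟩ := hC
  have hmx : m x = 0 := by by_contra h'; exact hx ((hm x).1 h')
  have hneg := weightPairing_sum_neg hmx ((hm c).2 hc) h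
  rw [← hγ] at hneg
  obtain ⟨n, hn'⟩ := Int.eq_ofNat_of_zero_le (neg_nonneg.2 hneg.le)
  refine ⟨P.reflectionPerm x γ, m + Pi.single x n, ?_, fun j ↦ ?_, ?_⟩
  · rw [← weylIndex_ofIdx, ← weylWeight_rootWeight, weylWeight_ofIdx, sub_eq_add_neg, ← neg_smul,
      hn']
    simp only [Pi.add_apply, add_smul, Finset.sum_add_distrib, ← hγ]
    congr 1
    rw [Finset.sum_eq_single x] <;> simp +contextual
  · by_cases hj : j = x
    · subst hj
      simp only [Pi.add_apply, Pi.single_eq_same, Finset.mem_insert, true_or, iff_true]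
      omega
    · simp [hj, hm]
  · rw [rootNorm_reflectionPerm, hn]

/-- The Dynkin valency bound. With v = ∑ ⟨γ, x̌⟩ x, the vector 2γ - v is nonzero because γ has no
support in s, so its norm is positive. The simple roots in s are mutually obtuse and the
coefficients have the same sign, so the norm of v is at most its diagonal part. That part equals
both 2(γ, v) and |γ|² times the sum in question. -/
theorem sum_pairingIn_mul_pairingIn_lt_four {γ : ι} {m : b.support → ℕ}
    (hγ : rootWeight P γ = ∑ j, m j • rootWeight P (j : ι)) (s : Finset b.support)
    (hs : ∀ x ∈ s, m x = 0) :
    ∑ x ∈ s, P.pairingIn ℤ γ x * P.pairingIn ℤ x γ < 4 := by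
  classical
  set p : b.support → ℤ := fun x ↦ P.pairingIn ℤ γ x with hp
  set g := rootWeight P γ with hg
  have hp' (x : b.support) (hx : x ∈ s) : p x ≤ 0 := by
    have := weightPairing_sum_nonpos (hs x hx)
    rwa [← hγ, weightPairing_rootWeight] at this
  set v := ∑ x ∈ s, p x • rootWeight P (x : ι) with hv
  have hne : 2 • g - v ≠ 0 := by
    intro h0
    have h1 : ∑ j, (2 * (m j : ℤ) - if j ∈ s then p j else 0) • rootWeight P (j : ι) = 0 := by
      rw [← h0, hv, hγ]
      simp only [sub_smul, mul_smul, Finset.sum_sub_distrib, ite_smul, zero_smul, natCast_zsmul]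
      rw [Finset.smul_sum, ← Finset.sum_filter, Finset.filter_mem_eq_inter, Finset.univ_inter]
      simp only [two_smul]
    have h2 := Fintype.linearIndependent_iff.1 (rootWeight_linearIndependent b) _ h1
    have h3 : ∀ j, m j = 0 := by
      intro j
      by_cases hj : j ∈ s
      · exact hs j hj
      · simpa [hj] using h2 j
    refine rootWeight_ne_zero γ (P := P) ?_
    rw [← hg, hγ]
    simp [h3]
  have hpos := weightForm_self_pos hne
  have hgv : 2 * weightForm g v = ∑ x ∈ s, rootNorm P (x : ι) * (p x * p x) := by
    rw [hv, map_sum, Finset.mul_sum]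
    refine Finset.sum_congr rfl fun x _ ↦ ?_
    rw [map_zsmul, smul_eq_mul, mul_left_comm, two_mul_weightForm_eq, weightPairing_rootWeight]
    ring
  have hvv : weightForm v v ≤ ∑ x ∈ s, rootNorm P (x : ι) * (p x * p x) := by
    have : weightForm v v = ∑ x ∈ s, ∑ y ∈ s, p x * p y *
        weightForm (rootWeight P (x : ι)) (rootWeight P (y : ι)) := by
      simp only [hv, map_sum, AddMonoidHom.finsetSum_apply, map_zsmul, AddMonoidHom.smul_apply,
        smul_eq_mul, Finset.mul_sum]
      rw [Finset.sum_comm]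
      refine Finset.sum_congr rfl fun x _ ↦ Finset.sum_congr rfl fun y _ ↦ by ring
    rw [this]
    refine Finset.sum_le_sum fun x hx ↦ ?_
    rw [← Finset.add_sum_erase _ _ hx]
    have h1 : ∑ y ∈ s.erase x, p x * p y *
        weightForm (rootWeight P (x : ι)) (rootWeight P (y : ι)) ≤ 0 := by
      refine Finset.sum_nonpos fun y hy ↦ ?_
      rw [Finset.mem_erase] at hy
      refine mul_nonpos_of_nonneg_of_nonpos
        (mul_nonneg_of_nonpos_of_nonpos (hp' x hx) (hp' y hy.2)) ?_
      have h2 := two_mul_weightForm_eq (y : ι) (rootWeight P (x : ι))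
      have h3 := b.pairingIn_le_zero_of_ne (fun h ↦ hy.1 (Subtype.ext h.symm)) x.2 y.2
      have h4 := rootNorm_pos (P := P) (y : ι)
      rw [weightPairing_rootWeight] at h2
      nlinarith
    have h5 : weightForm (rootWeight P (x : ι)) (rootWeight P (x : ι)) = rootNorm P (x : ι) := rfl
    rw [h5]
    linarith
  have hsum : ∑ x ∈ s, rootNorm P (x : ι) * (p x * p x) =
      rootNorm P γ * ∑ x ∈ s, P.pairingIn ℤ γ x * P.pairingIn ℤ x γ := by
    rw [Finset.mul_sum]
    refine Finset.sum_congr rfl fun x _ ↦ ?_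
    have := rootNorm_mul_pairingIn (P := P) γ x
    rw [← mul_assoc, show rootNorm P (x : ι) * p x = _ from this]
    simp only [hp]
    ring
  have hgg : weightForm g g = rootNorm P γ := rfl
  have hexp : weightForm (2 • g - v) (2 • g - v) =
      4 * rootNorm P γ - 2 * (2 * weightForm g v) + weightForm v v := by
    simp only [map_sub, map_nsmul, AddMonoidHom.sub_apply, AddMonoidHom.nsmul_apply, hgg,
      weightForm_comm v g, nsmul_eq_mul]
    push_cast
    ring
  rw [hexp, hgv] at hpos
  rw [hsum] at hpos hvv
  have hN := rootNorm_pos (P := P) γ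
  nlinarith

/-- Each neighbour x of the support contributes a product of two negative integers. This is at least
1, and it equals 1 only when x and γ have the same length. -/
theorem IsRootSupport.sum_lt_four {i : b.support} {C : Finset b.support}
    (hC : IsRootSupport i C) (s : Finset b.support)
    (hs : ∀ x ∈ s, x ∉ C ∧ ∃ c ∈ C, P.pairingIn ℤ c x ≠ 0) :
    ∑ x ∈ s, (if rootNorm P (x : ι) = rootNorm P i then 1 else 2 : ℤ) < 4 := by
  obtain ⟨γ, m, hγ, hm, hn⟩ := hC
  have hs' (x : b.support) (hx : x ∈ s) : m x = 0 := by
    by_contra h'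
    exact (hs x hx).1 ((hm x).1 h')
  refine (Finset.sum_le_sum fun x hx ↦ ?_).trans_lt
    (sum_pairingIn_mul_pairingIn_lt_four hγ s hs')
  obtain ⟨c, hc, hcx⟩ := (hs x hx).2
  have h1 := weightPairing_sum_neg (hs' x hx) ((hm c).2 hc) hcx
  rw [← hγ, weightPairing_rootWeight] at h1
  have h2 := rootNorm_mul_pairingIn (P := P) γ x
  have h3 := rootNorm_pos (P := P) γ
  have h4 := rootNorm_pos (P := P) (x : ι)
  have h5 : P.pairingIn ℤ x γ < 0 := by nlinarith
  split_ifs with h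
  · nlinarith
  · by_contra! h6
    have h7 : P.pairingIn ℤ γ x = -1 := by nlinarith
    have h8 : P.pairingIn ℤ x γ = -1 := by nlinarith
    rw [h7, h8] at h2
    apply h
    linarith

theorem exists_maximal_isRootSupport (p : b.support → Prop) (i : b.support) (hi : p i) :
    ∃ C, i ∈ C ∧ IsRootSupport i C ∧ (∀ c ∈ C, p c) ∧
      ∀ c ∈ C, ∀ x ∉ C, P.pairingIn ℤ c x ≠ 0 → ¬ p x := by
  classical
  let S : Finset (Finset b.support) := Finset.univ.filter fun C ↦
    i ∈ C ∧ IsRootSupport i C ∧ ∀ c ∈ C, p c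
  have hS : S.Nonempty := ⟨{i}, by
    simp only [S, Finset.mem_filter, Finset.mem_univ, true_and, Finset.mem_singleton]
    exact ⟨isRootSupport_singleton i, fun c hc ↦ hc ▸ hi⟩⟩
  obtain ⟨C, hC, hmax⟩ := S.exists_max_image Finset.card hS
  simp only [S, Finset.mem_filter, Finset.mem_univ, true_and] at hC hmax
  refine ⟨C, hC.1, hC.2.1, hC.2.2, fun c hc x hx hcx hpx ↦ ?_⟩
  have := hmax (insert x C) ⟨Finset.mem_insert_of_mem hC.1, hC.2.1.insert hc hx hcx, by
    simpa [hpx] using hC.2.2⟩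
  rw [Finset.card_insert_of_notMem hx] at this
  omega

/-- If all neighbours of the same length of a suitable set of simple roots satisfy `p`, then the
set has at most one neighbour. -/
theorem exists_isRootSupport_unique_neighbour (p : b.support → Prop) {i j : b.support}
    (hij : P.pairingIn ℤ i j ≠ 0) (hn : rootNorm P i ≠ rootNorm P j) (hi : p i)
    (hp : ∀ C, IsRootSupport i C → i ∈ C → (∀ c ∈ C, rootNorm P c = rootNorm P i ∧ p c) →
      ∀ c ∈ C, ∀ x ∉ C, P.pairingIn ℤ c x ≠ 0 → rootNorm P x = rootNorm P i → p x) :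
    ∃ C : Finset b.support, i ∈ C ∧ (∀ c ∈ C, rootNorm P c = rootNorm P i ∧ p c) ∧
      ∀ c ∈ C, ∀ x ∉ C, P.pairingIn ℤ c x ≠ 0 → x = j := by
  classical
  obtain ⟨C, hiC, hC, hCp, hmax⟩ := exists_maximal_isRootSupport
    (fun c : b.support ↦ rootNorm P c = rootNorm P i ∧ p c) i ⟨rfl, hi⟩
  refine ⟨C, hiC, hCp, fun c hc x hx hcx ↦ ?_⟩
  by_contra hxj
  have hjC : j ∉ C := fun h ↦ hn (hCp j h).1.symm
  have hx' : rootNorm P x ≠ rootNorm P i := fun h ↦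
    hmax c hc x hx hcx ⟨h, hp C hC hiC hCp c hc x hx hcx h⟩
  -- Two neighbours of a different length would contribute 2 + 2, which already reaches the bound 4.
  have := hC.sum_lt_four {x, j} (by
    intro y hy
    rw [Finset.mem_insert, Finset.mem_singleton] at hy
    obtain rfl | rfl := hy
    · exact ⟨hx, c, hc, hcx⟩
    · exact ⟨hjC, i, hiC, hij⟩)
  rw [Finset.sum_pair hxj, if_neg hx', if_neg hn.symm] at this
  omega

/-- If two lengths occur, the valency bound allows only one edge i–j between roots of different
length. Its two ends are distinguished by the pairings, so σ fixes both. The bound then spreads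
fixedness along each side of the edge, and σ would be trivial. -/
theorem rootNorm_eq_of_isDiagramAutomorphism [P.IsReduced] [P.IsIrreducible]
    (σ : Equiv.Perm b.support) (hσ : IsDiagramAutomorphism b σ) (hσ₁ : σ ≠ 1) (i j : ι) :
    rootNorm P i = rootNorm P j := by
  classical
  have hσ' (i j : b.support) : P.pairingIn ℤ (σ i) (σ j) = P.pairingIn ℤ i j := hσ i j
  suffices hadj : ∀ i j : b.support, P.pairingIn ℤ i j ≠ 0 → rootNorm P i = rootNorm P j by
    have hsimple (i j : b.support) : rootNorm P i = rootNorm P j :=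
      b.induction_on_cartanMatrix (fun j : b.support ↦ rootNorm P i = rootNorm P j) rfl
        fun k l hk hl ↦ hk.trans (hadj l k hl).symm
    have hall (i : ι) : ∃ k : b.support, rootNorm P i = rootNorm P k := by
      refine b.induction_reflect (p := fun i ↦ ∃ k : b.support, rootNorm P i = rootNorm P k) i
        (fun i ⟨k, hk⟩ ↦ ⟨k, ?_⟩) (fun i hi ↦ ⟨⟨i, hi⟩, rfl⟩)
        fun i j ⟨k, hk⟩ hj ↦ ⟨k, ?_⟩ <;> rw [rootNorm_reflectionPerm, hk]
    obtain ⟨k, hk⟩ := hall i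
    obtain ⟨l, hl⟩ := hall j
    rw [hk, hl, hsimple k l]
  intro i j hij
  by_contra hn
  have hn' : rootNorm P j ≠ rootNorm P i := fun h ↦ hn h.symm
  have hji := pairingIn_ne_zero_comm.1 hij
  -- The diagram is connected, and the only exits are from C to j ∈ D and from D to i ∈ C, so C and
  -- D together exhaust it.
  have hcover (C D : Finset b.support) (hiC : i ∈ C) (hjD : j ∈ D)
      (hC : ∀ c ∈ C, ∀ x ∉ C, P.pairingIn ℤ c x ≠ 0 → x = j)
      (hD : ∀ c ∈ D, ∀ x ∉ D, P.pairingIn ℤ c x ≠ 0 → x = i) (x : b.support) : x ∈ C ∨ x ∈ D := by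
    refine b.induction_on_cartanMatrix (fun x ↦ x ∈ C ∨ x ∈ D) (i := i) (Or.inl hiC)
      fun c x hc hx ↦ ?_
    have hcx : P.pairingIn ℤ c x ≠ 0 := pairingIn_ne_zero_comm.1 hx
    by_contra! hx'
    rcases hc with hc | hc
    · exact hx'.2 (hC c hc x hx'.1 hcx ▸ hjD)
    · exact hx'.1 (hD c hc x hx'.2 hcx ▸ hiC)
  -- An edge with unequal pairings joins different lengths, so it is the edge i–j. Since σ preserves
  -- pairings it also preserves the direction of this edge.
  have hfix : σ i = i ∧ σ j = j := by
    obtain ⟨C, hiC, hCn, hC⟩ := exists_isRootSupport_unique_neighbour (fun _ ↦ True) hij hn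
      trivial (by simp)
    obtain ⟨D, hjD, hDn, hD⟩ := exists_isRootSupport_unique_neighbour (fun _ ↦ True) hji hn'
      trivial (by simp)
    have hedge (x y : b.support) (hxy : P.pairingIn ℤ x y ≠ 0)
        (h : P.pairingIn ℤ x y ≠ P.pairingIn ℤ y x) : (x = i ∧ y = j) ∨ (x = j ∧ y = i) := by
      have hne : rootNorm P x ≠ rootNorm P y := by
        intro h'
        have := rootNorm_mul_pairingIn (P := P) x y
        rw [h'] at this
        exact h (mul_left_cancel₀ (rootNorm_pos (P := P) (y : ι)).ne' this)
      have hyx := pairingIn_ne_zero_comm.1 hxy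
      rcases hcover C D hiC hjD hC hD x with hx | hx
      · have hy : y ∉ C := fun hy ↦ hne ((hCn x hx).1.trans (hCn y hy).1.symm)
        have hy' := (hcover C D hiC hjD hC hD y).resolve_left hy
        have hx' : x ∉ D := fun hx ↦ hne ((hDn x hx).1.trans (hDn y hy').1.symm)
        exact Or.inl ⟨hD y hy' x hx' hyx, hC x hx y hy hxy⟩
      · have hy : y ∉ D := fun hy ↦ hne ((hDn x hx).1.trans (hDn y hy).1.symm)
        have hy' := (hcover C D hiC hjD hC hD y).resolve_right hy
        have hx' : x ∉ C := fun hx ↦ hne ((hCn x hx).1.trans (hCn y hy').1.symm)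
        exact Or.inr ⟨hC y hy' x hx' hyx, hD x hx y hy hxy⟩
    have hne : P.pairingIn ℤ i j ≠ P.pairingIn ℤ j i := by
      intro h
      have := rootNorm_mul_pairingIn (P := P) i j
      rw [h] at this
      exact hn' (mul_right_cancel₀ hji this)
    rcases hedge (σ i) (σ j) (by rwa [hσ']) (by rwa [hσ', hσ']) with h | h
    · exact h
    · have := hσ' i j
      rw [h.1, h.2] at this
      exact absurd this.symm hne
  -- If σ moved a neighbour x of a fixed set, then x, σ x and j would be three neighbours
  -- contributing at least 1 + 1 + 2 = 4.
  have hp (i j : b.support) (hij : P.pairingIn ℤ i j ≠ 0) (hn : rootNorm P i ≠ rootNorm P j)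
      (hj : σ j = j) : ∀ C, IsRootSupport i C → i ∈ C →
      (∀ c ∈ C, rootNorm P c = rootNorm P i ∧ σ c = c) →
      ∀ c ∈ C, ∀ x ∉ C, P.pairingIn ℤ c x ≠ 0 → rootNorm P x = rootNorm P i → σ x = x := by
    intro C hC hiC hCn c hc x hx hcx hxn
    by_contra hσx
    have hσxC : σ x ∉ C := fun h ↦ hσx (σ.injective (hCn _ h).2)
    have hjC : j ∉ C := fun h ↦ hn (hCn j h).1.symm
    have hjx : σ x ≠ j := fun h ↦ hσx (by
      rw [← hj] at h
      rw [σ.injective h, hj])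
    have hxj : x ≠ j := fun h ↦ hn (by rw [← hxn, h])
    have h4 := hC.sum_lt_four {x, σ x, j} (by
      intro y hy
      rw [Finset.mem_insert, Finset.mem_insert, Finset.mem_singleton] at hy
      obtain rfl | rfl | rfl := hy
      · exact ⟨hx, c, hc, hcx⟩
      · refine ⟨hσxC, c, hc, ?_⟩
        have := hσ' c x
        rw [(hCn c hc).2] at this
        rwa [this]
      · exact ⟨hjC, i, hiC, hij⟩)
    rw [Finset.sum_insert (by simp [Ne.symm hσx, hxj]), Finset.sum_pair hjx,
      if_neg hn.symm] at h4
    split_ifs at h4 <;> omega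
  obtain ⟨C, hiC, hCn, hC⟩ := exists_isRootSupport_unique_neighbour (fun c ↦ σ c = c) hij hn
    hfix.1 (hp i j hij hn hfix.2)
  obtain ⟨D, hjD, hDn, hD⟩ := exists_isRootSupport_unique_neighbour (fun c ↦ σ c = c) hji hn'
    hfix.2 (hp j i hji hn' hfix.1)
  refine hσ₁ (Equiv.ext fun x ↦ ?_)
  rcases hcover C D hiC hjD hC hD x with hx | hx
  · exact (hCn x hx).2
  · exact (hDn x hx).2

end SimplyLaced

/-! ### Roots of equal length: coroots are linear in roots -/

section EqualLength

variable {ι M N : Type*} [AddCommGroup M] [Module ℂ M] [AddCommGroup N] [Module ℂ N]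
variable {P : RootPairing ι ℂ M N} [P.IsCrystallographic] [P.IsRootSystem] [Fintype ι]

theorem pairingIn_comm (hlen : ∀ i j, rootNorm P i = rootNorm P j) (i j : ι) :
    P.pairingIn ℤ i j = P.pairingIn ℤ j i := by
  have := rootNorm_mul_pairingIn (P := P) i j
  rw [hlen j i] at this
  exact mul_left_cancel₀ (rootNorm_pos (P := P) i).ne' this

/-- For equal lengths the invariant form turns each root into its coroot by one common factor, so a
linear relation between roots holds for the coroots. -/
theorem weightPairing_eq_sum (hlen : ∀ i j, rootNorm P i = rootNorm P j) {κ : Type*}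
    (s : Finset κ) (n : κ → ℤ) (δ : κ → ι) {γ : ι}
    (hγ : rootWeight P γ = ∑ j ∈ s, n j • rootWeight P (δ j)) (μ : weightLattice P) :
    weightPairing γ μ = ∑ j ∈ s, n j * weightPairing (δ j) μ := by
  apply mul_left_cancel₀ (rootNorm_pos (P := P) γ).ne'
  rw [← two_mul_weightForm_eq, hγ, map_sum, Finset.mul_sum, Finset.mul_sum]
  refine Finset.sum_congr rfl fun j _ ↦ ?_
  rw [map_zsmul, smul_eq_mul, mul_left_comm, two_mul_weightForm_eq, hlen (δ j) γ]
  ring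

theorem weightPairing_of_eq_add (hlen : ∀ i j, rootNorm P i = rootNorm P j) {γ δ ε : ι}
    (hγ : rootWeight P γ = rootWeight P δ + rootWeight P ε) (μ : weightLattice P) :
    weightPairing γ μ = weightPairing δ μ + weightPairing ε μ := by
  have := weightPairing_eq_sum hlen Finset.univ (fun _ : Bool ↦ 1) (fun c ↦ cond c δ ε) (γ := γ)
    (by simpa using hγ) μ
  simpa using this

theorem rootWeight_injective : Function.Injective (rootWeight P) := fun _ _ h ↦
  P.root.injective (congrArg Subtype.val h)

/-- The difference of the two roots has norm 0. -/
theorem eq_of_pairingIn_eq_two (hlen : ∀ i j, rootNorm P i = rootNorm P j) {i j : ι}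
    (h : P.pairingIn ℤ i j = 2) : i = j := by
  apply rootWeight_injective (P := P)
  rw [← sub_eq_zero]
  apply eq_zero_of_weightForm_self
  have h1 := two_mul_weightForm_eq j (rootWeight P i)
  rw [weightPairing_rootWeight, h] at h1
  have h2 : weightForm (rootWeight P i) (rootWeight P i) = rootNorm P j := hlen i j
  have h3 : weightForm (rootWeight P j) (rootWeight P j) = rootNorm P j := rfl
  simp only [map_sub, AddMonoidHom.sub_apply, weightForm_comm (rootWeight P j) (rootWeight P i),
    h2, h3]
  linarith

theorem pairingIn_le_two (hlen : ∀ i j, rootNorm P i = rootNorm P j) (i j : ι) :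
    P.pairingIn ℤ i j ≤ 2 := by
  have h1 := two_mul_weightForm_eq j (rootWeight P i)
  rw [weightPairing_rootWeight] at h1
  have h2 : weightForm (rootWeight P i) (rootWeight P i) = rootNorm P j := hlen i j
  have h3 : weightForm (rootWeight P j) (rootWeight P j) = rootNorm P j := rfl
  have h4 := weightForm_self_nonneg (rootWeight P i - rootWeight P j)
  simp only [map_sub, AddMonoidHom.sub_apply, weightForm_comm (rootWeight P j) (rootWeight P i),
    h2, h3] at h4
  have h5 := rootNorm_pos (P := P) j
  nlinarith

end EqualLength

/-! ### Products of orthogonal reflections -/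

section OrthogonalRoots

variable {ι M N : Type*} [AddCommGroup M] [Module ℂ M] [AddCommGroup N] [Module ℂ N]
variable {P : RootPairing ι ℂ M N} [P.IsCrystallographic]

/-- The product of the reflections in a set of pairwise orthogonal roots. -/
theorem exists_weyl_of_pairwise_orthogonal (S : Finset ι)
    (hS : ∀ i ∈ S, ∀ j ∈ S, i ≠ j → P.pairingIn ℤ i j = 0) :
    ∃ w : P.weylGroup, ∀ μ, weylWeight P w μ = μ - ∑ i ∈ S, weightPairing i μ • rootWeight P i := by
  classical
  induction S using Finset.induction_on with
  | empty => exact ⟨1, by simp⟩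
  | insert j S hj ih =>
    obtain ⟨w, hw⟩ := ih fun i hi k hk ↦ hS i (Finset.mem_insert_of_mem hi) k
      (Finset.mem_insert_of_mem hk)
    refine ⟨RootPairing.weylGroup.ofIdx P j * w, fun μ ↦ ?_⟩
    have h : weightPairing j (∑ i ∈ S, weightPairing i μ • rootWeight P i) = 0 := by
      rw [map_sum]
      refine Finset.sum_eq_zero fun i hi ↦ ?_
      rw [map_zsmul, weightPairing_rootWeight, hS i (Finset.mem_insert_of_mem hi) j
        (Finset.mem_insert_self j S) (fun h ↦ hj (h ▸ hi)), smul_zero]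
    rw [weylWeight_mul, weylWeight_ofIdx, hw, map_sub, h, sub_zero, Finset.sum_insert hj]
    abel

end OrthogonalRoots

/-! ### Folding: lifting weights and Weyl group elements from the orbit root system -/

section Folding

variable {ι M N : Type*} [AddCommGroup M] [Module ℂ M] [AddCommGroup N] [Module ℂ N]
variable {P : RootPairing ι ℂ M N} [P.IsRootSystem] {b : P.Base}
variable {ι' M' N' : Type*} [AddCommGroup M'] [Module ℂ M'] [AddCommGroup N'] [Module ℂ N']
variable {P' : RootPairing ι' ℂ M' N'} [P'.IsRootSystem] {b' : P'.Base}
variable [P.IsCrystallographic] [P'.IsCrystallographic] [Fintype ι] [Fintype ι']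
variable {σ : Equiv.Perm b.support} (e : Orbits σ ≃ b'.support)

/-- The inverse of `orbitMap`, with values in the weight lattice. -/
def liftWeight : weightLattice P' →+ weightLattice P where
  toFun x := (weightCoords b).symm fun i ↦ weightPairing (e (toOrbit σ i) : ι') x
  map_zero' := by
    rw [← map_zero (weightCoords b).symm]
    congr 1
    ext
    simp
  map_add' x y := by
    rw [← map_add]
    congr 1
    ext
    simp

@[simp]
theorem weightPairing_liftWeight (i : b.support) (x : weightLattice P') :
    weightPairing (i : ι) (liftWeight e x) = weightPairing (e (toOrbit σ i) : ι') x :=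
  weightPairing_weightCoords_symm b _ i

theorem toOrbit_apply (i : b.support) : toOrbit σ (σ i) = toOrbit σ i :=
  Quotient.sound (Equiv.Perm.SameCycle.symm ⟨1, by simp⟩)

theorem mem_invariantWeights_iff (μ : weightLattice P) :
    μ ∈ invariantWeights b σ ↔
      ∀ i : b.support, weightPairing (σ i : ι) μ = weightPairing (i : ι) μ := by
  have : μ ∈ invariantWeights b σ ↔ diagramAction b σ μ = μ := Iff.rfl
  rw [this, ← (weightCoords b).injective.eq_iff, funext_iff]
  simp only [diagramAction, AddMonoidHom.coe_mk, ZeroHom.coe_mk, AddEquiv.apply_symm_apply]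
  refine ⟨fun h i ↦ ?_, fun h i ↦ ?_⟩
  · have := h (σ i)
    rw [Equiv.symm_apply_apply] at this
    exact this.symm
  · have := h (σ.symm i)
    rw [Equiv.apply_symm_apply] at this
    exact this.symm

theorem liftWeight_mem (x : weightLattice P') : liftWeight e x ∈ invariantWeights b σ := by
  rw [mem_invariantWeights_iff]
  intro i
  rw [weightPairing_liftWeight, weightPairing_liftWeight, toOrbit_apply]

theorem weightPairing_orbitMap (μ : invariantWeights b σ) (i : b.support) :
    weightPairing (e (toOrbit σ i) : ι') (orbitMap b b' σ e μ) = weightPairing (i : ι) μ.1 := by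
  refine (weightPairing_weightCoords_symm b' _ (e (toOrbit σ i))).trans ?_
  rw [Equiv.symm_apply_apply]
  rfl

theorem liftWeight_orbitMap (μ : invariantWeights b σ) :
    liftWeight e (orbitMap b b' σ e μ) = μ.1 :=
  weight_ext b fun i hi ↦ by
    rw [weightPairing_liftWeight e ⟨i, hi⟩, weightPairing_orbitMap]

theorem exists_toOrbit (j : b'.support) : ∃ i : b.support, e (toOrbit σ i) = j := by
  obtain ⟨i, hi⟩ := Quotient.exists_rep (e.symm j)
  exact ⟨i, by rw [show toOrbit σ i = e.symm j from hi]; simp⟩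

theorem liftWeight_injective : Function.Injective (liftWeight (b := b) (b' := b') e) := by
  intro x y h
  refine weight_ext b' fun j hj ↦ ?_
  obtain ⟨i, hi⟩ := exists_toOrbit e ⟨j, hj⟩
  have := congrArg (weightPairing (i : ι)) h
  rw [weightPairing_liftWeight, weightPairing_liftWeight, hi] at this
  exact this

theorem orbitMap_liftWeight (x : weightLattice P') :
    orbitMap b b' σ e ⟨liftWeight e x, liftWeight_mem e x⟩ = x :=
  liftWeight_injective e (liftWeight_orbitMap e _)

theorem liftWeight_weylVector : liftWeight e (weylVector b') = weylVector b :=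
  weight_ext b fun i hi ↦ by
    rw [weightPairing_liftWeight e ⟨i, hi⟩, weightPairing_weylVector b hi,
      weightPairing_weylVector b' (e _).2]

open Classical in
/-- The simple roots in an orbit. -/
def orbitFinset (o : Orbits σ) : Finset b.support := Finset.univ.filter fun i ↦ toOrbit σ i = o

theorem mem_orbitFinset {o : Orbits σ} {i : b.support} :
    i ∈ orbitFinset o ↔ toOrbit σ i = o := by
  simp [orbitFinset]

/-- The sum of the simple roots in an orbit. -/
def orbitSum (o : Orbits σ) : weightLattice P := ∑ i ∈ orbitFinset o, rootWeight P (i : ι)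

open Classical in
/-- The factor in the Cartan matrix of the orbit Lie algebra. -/
def orbitFactor (o : Orbits σ) : ℤ := if IsConnectedOrbit b σ o then 2 else 1

theorem IsOrbitBase.eq (he : IsOrbitBase b b' σ e) (o : Orbits σ) (j : b.support) :
    P'.pairingIn ℤ (e o) (e (toOrbit σ j)) =
      orbitFactor o * ∑ i ∈ orbitFinset o, P.pairingIn ℤ i j :=
  he o j

theorem IsOrbitBase.liftWeight_rootWeight (he : IsOrbitBase b b' σ e) (o : Orbits σ) :
    liftWeight e (rootWeight P' (e o)) = orbitFactor o • orbitSum o := by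
  refine weight_ext b fun j hj ↦ ?_
  rw [weightPairing_liftWeight e ⟨j, hj⟩, weightPairing_rootWeight, he.eq, map_zsmul, smul_eq_mul,
    orbitSum, map_sum]
  simp

/-- The diagonal entry of the Cartan matrix of `b'` is 2. This constrains the shape of an orbit: it
is what makes a connected orbit split into A₂ pairs. -/
theorem IsOrbitBase.two_eq (he : IsOrbitBase b b' σ e) {o : Orbits σ} {j : b.support}
    (hj : j ∈ orbitFinset o) : orbitFactor o * ∑ i ∈ orbitFinset o, P.pairingIn ℤ i j = 2 := by
  rw [← he.eq, mem_orbitFinset.1 hj]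
  simp

theorem weightPairing_liftWeight_of_mem {o : Orbits σ} {i : b.support} (hi : i ∈ orbitFinset o)
    (x : weightLattice P') :
    weightPairing (i : ι) (liftWeight e x) = weightPairing (e o : ι') x := by
  rw [weightPairing_liftWeight, mem_orbitFinset.1 hi]

/-- In a connected orbit, every simple root has exactly one neighbour. -/
theorem IsOrbitBase.exists_neighbour (he : IsOrbitBase b b' σ e) {o : Orbits σ}
    (ho : IsConnectedOrbit b σ o) {j : b.support} (hj : j ∈ orbitFinset o) :
    ∃ i ∈ orbitFinset o, i ≠ j ∧ P.pairingIn ℤ i j = -1 ∧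
      ∀ k ∈ orbitFinset o, k ≠ j → k ≠ i → P.pairingIn ℤ k j = 0 := by
  classical
  have h2 := he.two_eq e hj
  rw [orbitFactor, if_pos ho, ← Finset.add_sum_erase _ _ hj] at h2
  -- The factor 2 reduces the column sum to 1, of which the diagonal contributes 2.
  have h1 : ∑ i ∈ (orbitFinset o).erase j, P.pairingIn ℤ i j = -1 := by
    have : P.pairingIn ℤ j j = 2 := by simp
    omega
  have hle (i : b.support) (hi : i ∈ (orbitFinset o).erase j) : P.pairingIn ℤ i j ≤ 0 :=
    b.pairingIn_le_zero_of_ne (fun h ↦ (Finset.mem_erase.1 hi).1 (Subtype.ext h)) i.2 j.2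
  obtain ⟨i, hi, hi0⟩ : ∃ i ∈ (orbitFinset o).erase j, P.pairingIn ℤ i j ≠ 0 := by
    by_contra! h
    rw [Finset.sum_eq_zero h] at h1
    omega
  rw [← Finset.add_sum_erase _ _ hi] at h1
  have hle' : ∑ k ∈ ((orbitFinset o).erase j).erase i, P.pairingIn ℤ k j ≤ 0 :=
    Finset.sum_nonpos fun k hk ↦ hle k (Finset.mem_of_mem_erase hk)
  have hi' := hle i hi
  have hzero : ∑ k ∈ ((orbitFinset o).erase j).erase i, P.pairingIn ℤ k j = 0 := by omega
  rw [Finset.sum_eq_zero_iff_of_nonpos fun k hk ↦ hle k (Finset.mem_of_mem_erase hk)] at hzero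
  refine ⟨i, (Finset.mem_erase.1 hi).2, (Finset.mem_erase.1 hi).1, by omega, fun k hk hkj hki ↦ ?_⟩
  exact hzero k (by simp [hk, hkj, hki])

/-- A disconnected orbit consists of orthogonal simple roots, and w is the product of their
reflections. A connected orbit splits into A₂ pairs; the sums of the pairs are orthogonal roots, and
w is the product of the reflections in these. The last clause, that w moves weights only along the
orbit, later locates the roots whose sign w changes. -/
theorem exists_lift_reflection (hlen : ∀ i j, rootNorm P i = rootNorm P j)
    (he : IsOrbitBase b b' σ e) (o : Orbits σ) :
    ∃ w : P.weylGroup,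
      (∀ x, liftWeight e (weylWeight P' (RootPairing.weylGroup.ofIdx P' (e o)) x) =
        weylWeight P w (liftWeight e x)) ∧
      ∀ μ, ∃ n : b.support → ℤ, weylWeight P w μ =
        μ + ∑ i ∈ orbitFinset o, n i • rootWeight P (i : ι) := by
  classical
  have hleft (x : weightLattice P') :
      liftWeight e (weylWeight P' (RootPairing.weylGroup.ofIdx P' (e o)) x) =
        liftWeight e x - (weightPairing (e o : ι') x * orbitFactor o) • orbitSum o := by
    rw [weylWeight_ofIdx, map_sub, map_zsmul, he.liftWeight_rootWeight, smul_smul]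
  by_cases ho : IsConnectedOrbit b σ o
  · choose! n hn hne hn1 hn0 using fun j (hj : j ∈ orbitFinset o) ↦ he.exists_neighbour e ho hj
    have hnn (j) (hj : j ∈ orbitFinset o) : n (n j) = j := by
      by_contra h
      have h0 := hn0 (n j) (hn j hj) j hj (hne j hj).symm (Ne.symm h)
      have h1 := hn1 j hj
      rw [pairingIn_comm hlen] at h0
      omega
    -- The root αⱼ + α_(n j), where n j is the unique neighbour of j in the orbit.
    let δ (j : b.support) : ι := P.reflectionPerm j (n j)
    have hδ (j) (hj : j ∈ orbitFinset o) :
        rootWeight P (δ j) = rootWeight P (j : ι) + rootWeight P (n j : ι) := by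
      change rootWeight P (P.reflectionPerm j (n j)) = _
      rw [← weylIndex_ofIdx, ← weylWeight_rootWeight, weylWeight_ofIdx, weightPairing_rootWeight,
        hn1 j hj, neg_one_zsmul]
      abel
    have hδp (j) (hj : j ∈ orbitFinset o) (μ : weightLattice P) :
        weightPairing (δ j) μ = weightPairing (j : ι) μ + weightPairing (n j : ι) μ :=
      weightPairing_of_eq_add hlen (hδ j hj) μ
    have horth (j k) (hj : j ∈ orbitFinset o) (hk : k ∈ orbitFinset o) (hkj : k ≠ j)
        (hkn : k ≠ n j) : P.pairingIn ℤ (δ j) (δ k) = 0 := by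
      rw [← weightPairing_rootWeight, hδ j hj, hδp k hk]
      simp only [map_add, weightPairing_rootWeight]
      have hnk : n k ≠ j := fun h ↦ hkn (by rw [← h, hnn k hk])
      have hnk' : n k ≠ n j := fun h ↦ hkj (by rw [← hnn k hk, h, hnn j hj])
      rw [hn0 k hk j hj hkj.symm hnk.symm, hn0 k hk (n j) (hn j hj) hkn.symm hnk'.symm,
        hn0 (n k) (hn k hk) j hj hnk.symm (by rw [hnn k hk]; exact hkj.symm),
        hn0 (n k) (hn k hk) (n j) (hn j hj) hnk'.symm (by rw [hnn k hk]; exact hkn.symm)]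
      simp
    have hδn (j) (hj : j ∈ orbitFinset o) : δ (n j) = δ j := by
      apply rootWeight_injective (P := P)
      rw [hδ j hj, hδ _ (hn j hj), hnn j hj, add_comm]
    have hδeq (j k) (hj : j ∈ orbitFinset o) (hk : k ∈ orbitFinset o) (h : δ j = δ k) :
        k = j ∨ k = n j := by
      by_contra! h'
      have := horth j k hj hk h'.1 h'.2
      rw [h] at this
      simp at this
    obtain ⟨w, hw⟩ := exists_weyl_of_pairwise_orthogonal (P := P) ((orbitFinset o).image δ) (by
      intro i hi j hj hij
      obtain ⟨i, hi', rfl⟩ := Finset.mem_image.1 hi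
      obtain ⟨j, hj', rfl⟩ := Finset.mem_image.1 hj
      refine horth i j hi' hj' (fun h ↦ hij (by rw [h])) (fun h ↦ hij ?_)
      rw [h, hδn i hi'])
    -- Each value of δ has exactly the two preimages j and n j, whose simple roots add up to it.
    have hsum (f : ι → ℤ) : ∑ γ ∈ (orbitFinset o).image δ, f γ • rootWeight P γ =
        ∑ i ∈ orbitFinset o, f (δ i) • rootWeight P (i : ι) := by
      rw [← Finset.sum_fiberwise_of_maps_to (g := δ) (t := (orbitFinset o).image δ)
        (fun i hi ↦ Finset.mem_image_of_mem _ hi) (fun i ↦ f (δ i) • rootWeight P (i : ι))]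
      refine Finset.sum_congr rfl fun γ hγ ↦ ?_
      obtain ⟨j, hj, rfl⟩ := Finset.mem_image.1 hγ
      have hfib : (orbitFinset o).filter (fun i ↦ δ i = δ j) = {j, n j} := by
        ext k
        simp only [Finset.mem_filter, Finset.mem_insert, Finset.mem_singleton]
        constructor
        · rintro ⟨hk, h⟩
          exact hδeq j k hj hk h.symm
        · rintro (rfl | rfl)
          · exact ⟨hj, rfl⟩
          · exact ⟨hn j hj, hδn j hj⟩
      rw [hfib, Finset.sum_pair (hne j hj).symm, hδn j hj, ← smul_add, hδ j hj]
    refine ⟨w, fun x ↦ ?_, fun μ ↦ ⟨fun i ↦ -weightPairing (δ i) μ, ?_⟩⟩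
    · rw [hw, hleft, hsum, orbitSum, Finset.smul_sum]
      congr 1
      refine Finset.sum_congr rfl fun i hi ↦ ?_
      rw [hδp i hi, weightPairing_liftWeight_of_mem e hi,
        weightPairing_liftWeight_of_mem e (hn i hi), orbitFactor, if_pos ho, mul_two]
    · rw [hw, hsum]
      simp [sub_eq_add_neg]
  · obtain ⟨w, hw⟩ := exists_weyl_of_pairwise_orthogonal (P := P)
      ((orbitFinset o).image ((↑) : b.support → ι)) (by
        intro i hi j hj hij
        obtain ⟨i, hi', rfl⟩ := Finset.mem_image.1 hi
        obtain ⟨j, hj', rfl⟩ := Finset.mem_image.1 hj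
        by_contra h
        exact ho ⟨i, j, mem_orbitFinset.1 hi', mem_orbitFinset.1 hj', fun h ↦ hij (by rw [h]), h⟩)
    refine ⟨w, fun x ↦ ?_, fun μ ↦ ⟨fun i ↦ -weightPairing (i : ι) μ, ?_⟩⟩
    · rw [hw, hleft, Finset.sum_image (by simp), orbitSum, Finset.smul_sum]
      congr 1
      refine Finset.sum_congr rfl fun i hi ↦ ?_
      rw [weightPairing_liftWeight_of_mem e hi, orbitFactor, if_neg ho, mul_one]
    · rw [hw, Finset.sum_image (by simp)]
      simp [sub_eq_add_neg]

theorem exists_lift_weyl [P'.IsReduced] (hlen : ∀ i j, rootNorm P i = rootNorm P j)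
    (he : IsOrbitBase b b' σ e) (w : P'.weylGroup) :
    ∃ v : P.weylGroup, ∀ x,
      liftWeight e (weylWeight P' w x) = weylWeight P v (liftWeight e x) := by
  refine weylGroup_induction_simple b' (p := fun w ↦ ∃ v : P.weylGroup, ∀ x,
      liftWeight e (weylWeight P' w x) = weylWeight P v (liftWeight e x)) (fun j hj ↦ ?_)
      ⟨1, by simp⟩ (fun v w ⟨v', hv⟩ ⟨w', hw⟩ ↦ ⟨v' * w', fun x ↦ ?_⟩) w
  · obtain ⟨w, hw, -⟩ := exists_lift_reflection e hlen he (e.symm ⟨j, hj⟩)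
    rw [e.apply_symm_apply] at hw
    exact ⟨w, hw⟩
  · rw [weylWeight_mul, weylWeight_mul, hv, hw]

end Folding

/-! ### Invariant elements of the root lattice and the highest root -/

section DiagramAutomorphism

variable {ι M N : Type*} [AddCommGroup M] [Module ℂ M] [AddCommGroup N] [Module ℂ N]
variable {P : RootPairing ι ℂ M N} [P.IsRootSystem] [P.IsCrystallographic] [Fintype ι]
variable {b : P.Base} {σ : Equiv.Perm b.support}

theorem sum_rootWeight_injective {m n : b.support → ℤ}
    (h : ∑ j, m j • rootWeight P (j : ι) = ∑ j, n j • rootWeight P (j : ι)) : m = n := by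
  have h1 : ∑ j, (m j - n j) • rootWeight P (j : ι) = 0 := by
    simp only [sub_smul, Finset.sum_sub_distrib, h, sub_self]
  ext j
  have := Fintype.linearIndependent_iff.1 (rootWeight_linearIndependent b) _ h1 j
  omega

theorem weightPairing_apply_sum (hσ : IsDiagramAutomorphism b σ) (n : b.support → ℤ)
    (i : b.support) :
    weightPairing (σ i : ι) (∑ j, n j • rootWeight P (j : ι)) =
      weightPairing (i : ι) (∑ j, n (σ j) • rootWeight P (j : ι)) := by
  simp only [map_sum, map_zsmul, weightPairing_rootWeight, smul_eq_mul]
  rw [← Equiv.sum_comp σ]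
  exact Finset.sum_congr rfl fun j _ ↦ congrArg _ (hσ j i)

theorem sum_mem_invariantWeights_iff (hσ : IsDiagramAutomorphism b σ) (n : b.support → ℤ) :
    ∑ j, n j • rootWeight P (j : ι) ∈ invariantWeights b σ ↔ ∀ j, n (σ j) = n j := by
  rw [mem_invariantWeights_iff]
  simp only [weightPairing_apply_sum hσ]
  constructor
  · intro h
    have := sum_rootWeight_injective (weight_ext b fun i hi ↦ h ⟨i, hi⟩)
    exact fun j ↦ congrFun this j
  · intro h i
    simp only [h]

theorem eq_of_toOrbit_eq {n : b.support → ℤ} (h : ∀ j, n (σ j) = n j) {i j : b.support}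
    (hij : toOrbit σ i = toOrbit σ j) : n i = n j := by
  have hmem : (weightCoords b).symm n ∈ invariantWeights b σ := by
    rw [mem_invariantWeights_iff]
    intro i
    rw [weightPairing_weightCoords_symm, weightPairing_weightCoords_symm, h]
  have := invariant_coords b σ ⟨_, hmem⟩ i j (Quotient.exact hij)
  simpa using this

theorem exists_coeff_of_mem_rootLattice {μ : weightLattice P} (h : μ ∈ rootLattice P) :
    ∃ n : b.support → ℤ, μ = ∑ j, n j • rootWeight P (j : ι) := by
  induction h using AddSubgroup.closure_induction with
  | mem x hx =>
    obtain ⟨i, rfl⟩ := hx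
    rcases b.root_mem_or_neg_mem i with h | h
    · obtain ⟨n, hn⟩ := exists_coeff_of_mem_simpleCone b
        ((mem_simpleCone_iff b (rootWeight P i)).2 h)
      exact ⟨fun j ↦ n j, by simpa using hn⟩
    · obtain ⟨n, hn⟩ := exists_coeff_of_mem_simpleCone b
        ((mem_simpleCone_iff b (-rootWeight P i)).2 h)
      refine ⟨fun j ↦ -n j, ?_⟩
      rw [neg_eq_iff_eq_neg.1 hn]
      simp
  | zero => exact ⟨0, by simp⟩
  | add x y _ _ hx hy =>
    obtain ⟨m, hm⟩ := hx
    obtain ⟨n, hn⟩ := hy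
    exact ⟨m + n, by simp [hm, hn, add_smul, Finset.sum_add_distrib]⟩
  | neg x _ hx =>
    obtain ⟨m, hm⟩ := hx
    exact ⟨-m, by simp [hm]⟩

theorem sum_eq_sum_orbitSum {n : b.support → ℤ} (h : ∀ j, n (σ j) = n j) :
    ∃ c : Orbits σ → ℤ, ∑ j, n j • rootWeight P (j : ι) =
      ∑ᶠ o : Orbits σ, c o • orbitSum o := by
  classical
  have : Finite (Orbits σ) := Quotient.finite _
  have := Fintype.ofFinite (Orbits σ)
  refine ⟨fun o ↦ n o.out, ?_⟩
  rw [finsum_eq_sum_of_fintype,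
    ← Finset.sum_fiberwise_of_maps_to (g := toOrbit σ) (t := Finset.univ) (by simp)]
  refine Finset.sum_congr rfl fun o _ ↦ ?_
  rw [orbitSum, Finset.smul_sum]
  refine Finset.sum_congr (by ext; simp [mem_orbitFinset]) fun j hj ↦ ?_
  rw [eq_of_toOrbit_eq h (i := j) (j := o.out)]
  have h1 : toOrbit σ j = o := mem_orbitFinset.1 hj
  rw [h1]
  exact (Quotient.out_eq o).symm

section HighestRoot

variable {θ : ι}

theorem IsHighestRoot.sub_mem (hθ : IsHighestRoot b θ) (i : ι) :
    rootWeight P θ - rootWeight P i ∈ simpleCone b :=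
  (mem_simpleCone_iff b _).2 (hθ i)

/-- Otherwise reflecting θ in αᵢ would give a root strictly above θ. -/
theorem IsHighestRoot.weightPairing_nonneg (hθ : IsHighestRoot b θ) {i : ι}
    (hi : i ∈ b.support) : 0 ≤ weightPairing i (rootWeight P θ) := by
  by_contra! h
  have h1 := hθ.sub_mem (P.reflectionPerm i θ)
  rw [← weylIndex_ofIdx, ← weylWeight_rootWeight, weylWeight_ofIdx, sub_sub_cancel] at h1
  have h2 : -(weightPairing i (rootWeight P θ) • rootWeight P i) ∈ simpleCone b := by
    obtain ⟨n, hn⟩ := Int.eq_ofNat_of_zero_le (neg_nonneg.2 h.le)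
    rw [← neg_smul, hn, natCast_zsmul]
    exact nsmul_mem (AddSubmonoid.subset_closure ⟨i, hi, rfl⟩ : rootWeight P i ∈ simpleCone b) n
  have h3 := congrArg (weightPairing i) (simpleCone_antisymm b h1 h2)
  rw [map_zsmul, weightPairing_rootWeight_self, map_zero, smul_eq_mul] at h3
  omega

/-- Since θ - αᵢ lies in the cone, the coefficient of θ at i is at least 1; uniqueness of
coefficients makes one choice serve every i. -/
theorem IsHighestRoot.exists_coeff (hθ : IsHighestRoot b θ) [Nonempty b.support] :
    ∃ m : b.support → ℕ, rootWeight P θ = ∑ j, m j • rootWeight P (j : ι) ∧ ∀ j, 1 ≤ m j := by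
  classical
  have key (i : b.support) : ∃ m : b.support → ℕ,
      rootWeight P θ = ∑ j, m j • rootWeight P (j : ι) ∧ 1 ≤ m i := by
    obtain ⟨n, hn⟩ := exists_coeff_of_mem_simpleCone b (hθ.sub_mem i)
    refine ⟨n + Pi.single i 1, ?_, by simp⟩
    simp only [Pi.add_apply, add_smul, Finset.sum_add_distrib, ← hn]
    rw [Finset.sum_eq_single i] <;> simp +contextual
  obtain ⟨m, hm, -⟩ := key (Classical.arbitrary _)
  refine ⟨m, hm, fun i ↦ ?_⟩
  obtain ⟨m', hm', hi⟩ := key i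
  have := sum_rootWeight_injective (m := fun j ↦ m j) (n := fun j ↦ m' j)
    (by simpa using hm.symm.trans hm')
  have := congrFun this i
  omega

/-- The permutation σ extends to a linear map preserving the roots and their heights. So θ minus its
image is a cone element whose coefficients sum to 0. -/
theorem IsHighestRoot.mem_invariantWeights [P.IsReduced] (hθ : IsHighestRoot b θ)
    [Nonempty b.support] (hσ : IsDiagramAutomorphism b σ) :
    rootWeight P θ ∈ invariantWeights b σ := by
  classical
  obtain ⟨m, hm, -⟩ := hθ.exists_coeff
  let f := b.toWeightBasis.equiv b.toWeightBasis σ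
  have hf (i : b.support) : f (P.root i) = P.root (σ i : ι) := by
    have := b.toWeightBasis.equiv_apply i b.toWeightBasis σ
    simpa using this
  obtain ⟨κ, hκ⟩ := b.apply_mem_range_root_of_cartanMatrixEq b σ f hf (P.root θ) ⟨θ, rfl⟩ hσ
  have hκ' : rootWeight P κ = ∑ j, m (σ.symm j) • rootWeight P (j : ι) := by
    apply Subtype.ext
    change P.root κ = _
    have h1 : P.root θ = ∑ j, m j • P.root (j : ι) := by
      have := congrArg Subtype.val hm
      simpa [rootWeight] using! this
    rw [hκ, h1, map_sum]
    simp only [map_nsmul, hf]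
    rw [← Equiv.sum_comp σ.symm]
    simp [rootWeight]
  obtain ⟨n, hn⟩ := exists_coeff_of_mem_simpleCone b (hθ.sub_mem κ)
  have h2 : (fun j ↦ (m j : ℤ)) = fun j ↦ (n j : ℤ) + m (σ.symm j) := by
    apply sum_rootWeight_injective
    simp only [add_smul, Finset.sum_add_distrib, natCast_zsmul]
    rw [← hm, ← hn, ← hκ']
    simp
  have h3 : ∑ j, (n j : ℤ) = 0 := by
    have h4 : ∑ j, (m j : ℤ) = ∑ j, ((n j : ℤ) + m (σ.symm j)) := by rw [← h2]
    rw [Finset.sum_add_distrib, Equiv.sum_comp σ.symm (fun j ↦ (m j : ℤ))] at h4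
    linarith
  rw [Finset.sum_eq_zero_iff_of_nonneg (fun _ _ ↦ by positivity)] at h3
  have h5 : rootWeight P θ = ∑ j, (m j : ℤ) • rootWeight P (j : ι) := by simpa using hm
  rw [h5, sum_mem_invariantWeights_iff hσ]
  intro j
  have := congrFun h2 (σ j)
  simpa [h3 (σ j) (Finset.mem_univ _)] using this

end HighestRoot

end DiagramAutomorphism

/-! ### Invariant positive roots, by descent on the height -/

section Descent

variable {ι M N : Type*} [AddCommGroup M] [Module ℂ M] [AddCommGroup N] [Module ℂ N]
variable {P : RootPairing ι ℂ M N} [P.IsRootSystem] {b : P.Base}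
variable {ι' M' N' : Type*} [AddCommGroup M'] [Module ℂ M'] [AddCommGroup N'] [Module ℂ N']
variable {P' : RootPairing ι' ℂ M' N'} [P'.IsRootSystem] {b' : P'.Base}
variable [P.IsCrystallographic] [P'.IsCrystallographic] [Fintype ι] [Fintype ι']
variable {σ : Equiv.Perm b.support} (e : Orbits σ ≃ b'.support)

/-- For a `σ`-invariant positive root `γ`, the reflection in `γ` comes from the Weyl group of the
orbit root system, and the orbit of `γ` under this group generates the sums of the orbits in the
support of `γ`. -/
theorem reflection_and_span_of_invariant_root (hσ : IsDiagramAutomorphism b σ)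
    (hlen : ∀ i j, rootNorm P i = rootNorm P j) (he : IsOrbitBase b b' σ e) (γ : ι)
    (m : b.support → ℕ) (hm : rootWeight P γ = ∑ j, m j • rootWeight P (j : ι))
    (g : weightLattice P') (hg : liftWeight e g = rootWeight P γ) :
    (∃ r : P'.weylGroup, ∀ x,
      weylWeight P' r x = x - weightPairing γ (liftWeight e x) • g) ∧
    ∀ o : Orbits σ, (∃ i ∈ orbitFinset o, m i ≠ 0) →
      ∃ y ∈ AddSubgroup.closure (Set.range fun w : P'.weylGroup ↦ weylWeight P' w g),
        liftWeight e y = orbitSum o := by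
  classical
  -- Induction on the height of γ. Some simple αᵢ pairs positively with γ; let o be its orbit.
  -- Either γ is supported in o and is its orbit sum, or the reflection at o lowers γ by the orbit
  -- sum and everything is conjugated.
  induction hN : ∑ j, m j using Nat.strong_induction_on generalizing γ m g with
  | _ N ih =>
  have hpos : b.IsPos γ := by
    apply isPos_of_mem_closure
    rw [← show ((rootWeight P γ : weightLattice P) : M) = P.root γ from rfl, ← mem_simpleCone_iff,
      hm]
    exact sum_mem fun j _ ↦ nsmul_mem (AddSubmonoid.subset_closure ⟨j, j.2, rfl⟩ :
      rootWeight P (j : ι) ∈ simpleCone b) _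
  have hmZ : rootWeight P γ = ∑ j, (m j : ℤ) • rootWeight P (j : ι) := by simpa using hm
  have hinv : ∀ j, (m (σ j) : ℤ) = m j := by
    rw [← sum_mem_invariantWeights_iff hσ (fun j ↦ (m j : ℤ)), ← hmZ, ← hg]
    exact liftWeight_mem e g
  obtain ⟨i, hi, hiγ⟩ := hpos.exists_mem_support_pos_pairingIn
  rw [pairingIn_comm hlen, ← weightPairing_rootWeight] at hiγ
  set o : Orbits σ := toOrbit σ ⟨i, hi⟩ with ho
  have hio : (⟨i, hi⟩ : b.support) ∈ orbitFinset o := mem_orbitFinset.2 rfl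
  by_cases hsup : ∀ j, m j ≠ 0 → j ∈ orbitFinset o
  · set c : ℕ := m ⟨i, hi⟩ with hc
    have hmc (j) (hj : j ∈ orbitFinset o) : m j = c := by
      have := eq_of_toOrbit_eq (n := fun j ↦ (m j : ℤ)) hinv (mem_orbitFinset.1 hj)
      exact_mod_cast this
    have hγo : rootWeight P γ = (c : ℤ) • orbitSum o := by
      rw [hm, orbitSum, Finset.smul_sum,
        ← Finset.sum_subset (Finset.subset_univ (orbitFinset o))]
      · exact Finset.sum_congr rfl fun j hj ↦ by rw [hmc j hj, natCast_zsmul]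
      · intro j _ hj
        have : m j = 0 := by by_contra h; exact hj (hsup j h)
        simp [this]
    have hpair (μ : weightLattice P) : weightPairing γ μ =
        ∑ j ∈ orbitFinset o, (c : ℤ) * weightPairing (j : ι) μ := by
      refine weightPairing_eq_sum hlen (orbitFinset o) (fun _ ↦ (c : ℤ)) (fun j ↦ (j : ι)) ?_ μ
      rw [hγo, orbitSum, Finset.smul_sum]
    -- Compute ⟨γ, γ̌⟩ = 2 with γ equal to c times the orbit sum. As the factor is at most 2, this
    -- forces c = 1, and the orbit has as many elements as its factor.
    have hcard : orbitFactor o = (orbitFinset o).card * (c * c : ℤ) := by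
      have h1 := weightPairing_rootWeight_self (P := P) γ
      have h2 (j) (hj : j ∈ orbitFinset o) :
          orbitFactor o * weightPairing (j : ι) (rootWeight P γ) = 2 * c := by
        rw [hγo, map_zsmul, orbitSum, map_sum]
        simp only [weightPairing_rootWeight, smul_eq_mul]
        rw [mul_left_comm, he.two_eq e hj, mul_comm]
      have h3 := congrArg (orbitFactor o * ·) h1
      simp only [hpair, Finset.mul_sum] at h3
      rw [Finset.sum_congr rfl (g := fun _ ↦ (c : ℤ) * (2 * c)) (fun j hj ↦ by
        rw [mul_left_comm, h2 j hj])] at h3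
      rw [Finset.sum_const, nsmul_eq_mul] at h3
      linarith
    have hcpos : 0 < (orbitFinset o).card := Finset.card_pos.2 ⟨_, hio⟩
    have hle : orbitFactor o ≤ 2 := by rw [orbitFactor]; split_ifs <;> norm_num
    have hge : 1 ≤ orbitFactor o := by rw [orbitFactor]; split_ifs <;> norm_num
    have hc1 : (c : ℤ) = 1 := by
      have h0 : (c : ℤ) ≠ 0 := by
        rintro h
        rw [h] at hcard
        omega
      have h1 : (1 : ℤ) ≤ (orbitFinset o).card := by exact_mod_cast hcpos
      have h2 : (1 : ℤ) ≤ c := by omega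
      nlinarith
    rw [hc1, one_mul, mul_one] at hcard
    rw [hc1, one_smul] at hγo
    refine ⟨⟨RootPairing.weylGroup.ofIdx P' (e o), fun x ↦ ?_⟩, fun o' ⟨i', hi', hmi'⟩ ↦ ?_⟩
    · apply liftWeight_injective e
      rw [weylWeight_ofIdx, map_sub, map_sub, map_zsmul, map_zsmul, he.liftWeight_rootWeight, hg,
        hγo, smul_smul, hpair, hc1]
      congr 2
      rw [Finset.sum_congr rfl (g := fun _ ↦ weightPairing (e o : ι') x) (fun j hj ↦ by
        rw [weightPairing_liftWeight_of_mem e hj, one_mul])]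
      rw [Finset.sum_const, nsmul_eq_mul, hcard, mul_comm]
    · have : o' = o := by rw [← mem_orbitFinset.1 hi', mem_orbitFinset.1 (hsup i' hmi')]
      subst this
      exact ⟨g, AddSubgroup.subset_closure ⟨1, by simp⟩, by rw [hg, hγo]⟩
  · push Not at hsup
    obtain ⟨j, hmj, hj⟩ := hsup
    have hne (n : b.support → ℤ) (hn : n j = 0) :
        rootWeight P γ ≠ ∑ k, n k • rootWeight P (k : ι) := by
      intro h
      have := congrFun (sum_rootWeight_injective (hmZ.symm.trans h)) j
      rw [hn] at this
      exact hmj (by exact_mod_cast this)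
    have hji : j ≠ ⟨i, hi⟩ := fun h ↦ hj (h ▸ hio)
    -- The value 2 would mean γ = αᵢ, but γ also involves αⱼ outside the orbit.
    have h1 : weightPairing i (rootWeight P γ) = 1 := by
      have h2 := pairingIn_le_two hlen γ i
      have h3 : P.pairingIn ℤ γ i ≠ 2 := by
        intro h
        refine hne (Pi.single ⟨i, hi⟩ 1) (by simp [hji]) ?_
        rw [eq_of_pairingIn_eq_two hlen h, Finset.sum_eq_single ⟨i, hi⟩] <;> simp +contextual
      rw [weightPairing_rootWeight] at hiγ ⊢
      omega
    have hx : weightPairing (e o : ι') g = 1 := by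
      rw [← weightPairing_liftWeight_of_mem e hio, hg, h1]
    -- In a connected orbit γ would pair to 1 + 1 = 2 with the root αᵢ + αₖ of neighbours, hence
    -- equal it, which j excludes.
    have hfac : orbitFactor o = 1 := by
      rw [orbitFactor, if_neg]
      intro hcon
      obtain ⟨k, hk, hki, hk1, -⟩ := he.exists_neighbour e hcon hio
      have hδ : rootWeight P (P.reflectionPerm i k) = rootWeight P i + rootWeight P (k : ι) := by
        rw [← weylIndex_ofIdx, ← weylWeight_rootWeight, weylWeight_ofIdx, weightPairing_rootWeight,
          hk1, neg_one_zsmul]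
        abel
      have h2 : weightPairing (P.reflectionPerm i k) (rootWeight P γ) = 2 := by
        rw [weightPairing_of_eq_add hlen hδ, h1, ← hg, weightPairing_liftWeight_of_mem e hk, hx]
        norm_num
      rw [weightPairing_rootWeight] at h2
      have hjk : j ≠ k := fun h ↦ hj (h ▸ hk)
      refine hne (Pi.single ⟨i, hi⟩ 1 + Pi.single k 1) (by simp [hji, hjk]) ?_
      rw [eq_of_pairingIn_eq_two hlen h2, hδ]
      simp only [Pi.add_apply, add_smul, Finset.sum_add_distrib]
      rw [Finset.sum_eq_single ⟨i, hi⟩, Finset.sum_eq_single k] <;> simp +contextual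
    set s := RootPairing.weylGroup.ofIdx P' (e o) with hs
    have hss (x) : weylWeight P' s (weylWeight P' s x) = x := by
      rw [hs, weylWeight_ofIdx, weylWeight_ofIdx]
      simp only [map_sub, map_zsmul, weightPairing_rootWeight_self, smul_eq_mul]
      module
    obtain ⟨w, hw, -⟩ := exists_lift_reflection e hlen he o
    have hg2 : liftWeight e (weylWeight P' s g) = rootWeight P (weylIndex w γ) := by
      rw [hw, hg, weylWeight_rootWeight]
    have hg2' : liftWeight e (weylWeight P' s g) = rootWeight P γ - orbitSum o := by
      rw [hs, weylWeight_ofIdx, map_sub, map_zsmul, he.liftWeight_rootWeight, hg, hx, hfac,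
        one_smul,
        one_smul]
    have hsumo : orbitSum o = ∑ k, (if k ∈ orbitFinset o then 1 else 0 : ℤ) •
        rootWeight P (k : ι) := by
      simp only [ite_smul, one_smul, zero_smul, ← Finset.sum_filter]
      rw [orbitSum, Finset.filter_mem_eq_inter, Finset.univ_inter]
    have hγ2 : rootWeight P (weylIndex w γ) =
        ∑ k, ((m k : ℤ) - if k ∈ orbitFinset o then 1 else 0) • rootWeight P (k : ι) := by
      rw [← hg2, hg2', hsumo, hmZ]
      simp only [sub_smul, Finset.sum_sub_distrib]
    -- The lowered root is still positive: its coefficient at j, outside the orbit, has not changed.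
    have hcone : rootWeight P (weylIndex w γ) ∈ simpleCone b := by
      rcases b.root_mem_or_neg_mem (weylIndex w γ) with h | h
      · exact (mem_simpleCone_iff b (rootWeight P _)).2 h
      · obtain ⟨n, hn⟩ := exists_coeff_of_mem_simpleCone b
          ((mem_simpleCone_iff b (-rootWeight P (weylIndex w γ))).2 h)
        rw [hγ2] at hn
        have h2 := congrFun (sum_rootWeight_injective (b := b)
          (m := fun k ↦ -((m k : ℤ) - if k ∈ orbitFinset o then 1 else 0))
          (n := fun k ↦ (n k : ℤ)) (by
            simp only [neg_smul, Finset.sum_neg_distrib, natCast_zsmul]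
            exact hn)) j
        simp only [hj, if_false] at h2
        omega
    obtain ⟨m2, hm2⟩ := exists_coeff_of_mem_simpleCone b hcone
    have hmm (k) : (m2 k : ℤ) = (m k : ℤ) - if k ∈ orbitFinset o then 1 else 0 := by
      refine congrFun (sum_rootWeight_injective (b := b) (m := fun k ↦ (m2 k : ℤ))
        (n := fun k ↦ (m k : ℤ) - if k ∈ orbitFinset o then 1 else 0) ?_) k
      rw [← hγ2, hm2]
      simp
    have hlt : ∑ k, m2 k < N := by
      rw [← hN]
      refine Finset.sum_lt_sum (fun k _ ↦ ?_) ⟨⟨i, hi⟩, Finset.mem_univ _, ?_⟩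
      · have := hmm k
        split_ifs at this <;> omega
      · have := hmm ⟨i, hi⟩
        rw [if_pos hio] at this
        omega
    obtain ⟨⟨r, hr⟩, hspan⟩ := ih _ hlt (weylIndex w γ) m2 hm2 (weylWeight P' s g) hg2 rfl
    refine ⟨⟨s * r * s, fun x ↦ ?_⟩, fun o' ⟨i', hi', hmi'⟩ ↦ ?_⟩
    · rw [weylWeight_mul, weylWeight_mul, hr, map_sub, hss, map_zsmul, hss, hw,
        weightPairing_weylIndex]
    · by_cases hoo : o' = o
      · subst hoo
        refine ⟨g - weylWeight P' s g, sub_mem (AddSubgroup.subset_closure ⟨1, by simp⟩)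
          (AddSubgroup.subset_closure ⟨s, rfl⟩), ?_⟩
        rw [map_sub, hg2', hg, sub_sub_cancel]
      · obtain ⟨y, hy, hyo⟩ := hspan o' ⟨i', hi', by
          have := hmm i'
          rw [if_neg (fun h ↦ hoo (by rw [← mem_orbitFinset.1 hi', mem_orbitFinset.1 h]))] at this
          omega⟩
        refine ⟨y, (AddSubgroup.closure_le _).2 ?_ hy, hyo⟩
        rintro - ⟨v, rfl⟩
        exact AddSubgroup.subset_closure ⟨v * s, weylWeight_mul v s g⟩

end Descent

/-! ### An abstract deletion argument for reflection groups -/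

section Coxeter

variable {X S : Type*} (s : S → Function.End X) (a : S → X → ℤ) (A : Set X)

/-- A value that starts positive, ends negative and never vanishes changes sign between two
consecutive prefixes of the word. -/
theorem exists_sign_change {f : X → ℤ} {x : X}
    (hne : ∀ u ∈ Submonoid.closure (Set.range s), f (u x) ≠ 0) (hpos : 0 < f x) (l : List S) :
    f ((l.map s).prod x) < 0 → ∃ l₁ c l₂, l = l₁ ++ c :: l₂ ∧ 0 < f ((l₁.map s).prod x) ∧
      f (((l₁.map s).prod * s c) x) < 0 := by
  induction l using List.reverseRecOn with
  | nil => intro h; exact absurd h hpos.le.not_gt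
  | append_singleton l c ih =>
    intro h
    have hmem : (l.map s).prod ∈ Submonoid.closure (Set.range s) :=
      Submonoid.list_prod_mem _ fun y hy ↦ by
        obtain ⟨c, -, rfl⟩ := List.mem_map.1 hy
        exact Submonoid.subset_closure ⟨c, rfl⟩
    rcases lt_or_gt_of_ne (hne _ hmem) with h1 | h1
    · obtain ⟨l₁, d, l₂, h2, h3⟩ := ih h1
      exact ⟨l₁, d, l₂ ++ [c], by simp [h2], h3⟩
    · exact ⟨l, c, [], rfl, h1, by simpa using h⟩

/-- A group generated by reflections acts freely on the interior of a chamber. -/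
theorem eq_one_of_mem_chamber (hneg : ∀ c x, a c (s c x) = -a c x)
    (hA : ∀ x ∈ A, ∀ c, 0 < a c x)
    (hne : ∀ x ∈ A, ∀ d, ∀ u ∈ Submonoid.closure (Set.range s), a d (u x) ≠ 0)
    (hflip : ∀ x ∈ A, ∀ c d, ∀ u ∈ Submonoid.closure (Set.range s), 0 < a d (u x) →
      a d ((u * s c) x) < 0 → s d * u * s c = u)
    {g : Function.End X} (hg : g ∈ Submonoid.closure (Set.range s)) {x : X} (hx : x ∈ A)
    (hgx : g x ∈ A) : g = 1 := by
  obtain ⟨l, hl, rfl⟩ := Submonoid.exists_list_of_mem_closure hg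
  obtain ⟨l, rfl⟩ : ∃ l' : List S, l = l'.map s := by
    clear hg hgx
    induction l with
    | nil => exact ⟨[], rfl⟩
    | cons y l ih =>
      obtain ⟨l', hl'⟩ := ih fun z hz ↦ hl z (List.mem_cons_of_mem _ hz)
      obtain ⟨c, hc⟩ := hl y List.mem_cons_self
      exact ⟨c :: l', by simp [hl', hc]⟩
  clear hl hg
  -- If a nonempty word d :: l returns x to the chamber, then l moves x across the wall d. The
  -- letter of l where this crossing happens cancels against d, leaving a word shorter by two.
  induction hn : l.length using Nat.strong_induction_on generalizing l with
  | _ n ih =>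
    cases l with
    | nil => rfl
    | cons d l =>
      have h1 : a d ((l.map s).prod x) < 0 := by
        have h2 := hA _ hgx d
        rw [List.map_cons, List.prod_cons] at h2
        change 0 < a d (s d ((l.map s).prod x)) at h2
        rw [hneg] at h2
        linarith
      obtain ⟨l₁, c, l₂, rfl, h3, h4⟩ := exists_sign_change s
        (fun u hu ↦ hne x hx d u hu) (hA x hx d) l h1
      have hmem : (l₁.map s).prod ∈ Submonoid.closure (Set.range s) :=
        Submonoid.list_prod_mem _ fun y hy ↦ by
          obtain ⟨c, -, rfl⟩ := List.mem_map.1 hy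
          exact Submonoid.subset_closure ⟨c, rfl⟩
      have key := hflip x hx c d _ hmem h3 h4
      have h5 : ((d :: (l₁ ++ c :: l₂)).map s).prod = ((l₁ ++ l₂).map s).prod := by
        simp only [List.map_cons, List.map_append, List.prod_cons, List.prod_append, ← mul_assoc,
          key]
      rw [h5] at hgx ⊢
      exact ih _ (by simp at hn ⊢; omega) (l₁ ++ l₂) hgx rfl

end Coxeter

theorem mem_of_forall_eq {X : Type*} {S : Submonoid (Function.End X)} {u v : Function.End X}
    (hu : u ∈ S) (h : ∀ x, v x = u x) : v ∈ S := by
  rwa [show v = u from funext h]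

/-! ### Walls of the alcove and the affine reflection group -/

section Walls

variable {ι M N : Type*} [AddCommGroup M] [Module ℂ M] [AddCommGroup N] [Module ℂ N]
variable {P : RootPairing ι ℂ M N} [P.IsRootSystem] {b : P.Base}
variable {ι' M' N' : Type*} [AddCommGroup M'] [Module ℂ M'] [AddCommGroup N'] [Module ℂ N']
variable {P' : RootPairing ι' ℂ M' N'} [P'.IsRootSystem] {b' : P'.Base}
variable [P.IsCrystallographic] [P'.IsCrystallographic] [Fintype ι] [Fintype ι']
variable {σ : Equiv.Perm b.support} (e : Orbits σ ≃ b'.support)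

theorem two_mul_weightForm_of_reflection {w : P'.weylGroup} {f : weightLattice P' →+ ℤ}
    {v : weightLattice P'} (hw : ∀ x, weylWeight P' w x = x - f x • v) (hv : f v = 2)
    (y : weightLattice P') : 2 * weightForm v y = weightForm v v * f y := by
  have h := weightForm_weylWeight w v y
  simp only [hw, hv, map_sub, map_zsmul, AddMonoidHom.sub_apply, AddMonoidHom.smul_apply,
    smul_eq_mul] at h
  linarith

/-- The lattice of weights whose lifts lie in the root lattice. -/
def foldedLattice : AddSubgroup (weightLattice P') :=
  (rootLattice P).comap (liftWeight (b := b) e)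

theorem mem_foldedLattice {x : weightLattice P'} :
    x ∈ foldedLattice e ↔ liftWeight e x ∈ rootLattice P := Iff.rfl

theorem weylWeight_mem_rootLattice (w : P.weylGroup) {μ : weightLattice P}
    (h : μ ∈ rootLattice P) : weylWeight P w μ ∈ rootLattice P := by
  induction h using AddSubgroup.closure_induction with
  | mem x hx =>
    obtain ⟨i, rfl⟩ := hx
    rw [weylWeight_rootWeight]
    exact AddSubgroup.subset_closure ⟨_, rfl⟩
  | zero => simp
  | add x y _ _ hx hy => rw [map_add]; exact add_mem hx hy
  | neg x _ hx => rw [map_neg]; exact neg_mem hx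

theorem weylWeight_mem_foldedLattice [P'.IsReduced] (hlen : ∀ i j, rootNorm P i = rootNorm P j)
    (he : IsOrbitBase b b' σ e) (w : P'.weylGroup) {x : weightLattice P'}
    (hx : x ∈ foldedLattice e) : weylWeight P' w x ∈ foldedLattice e := by
  obtain ⟨v, hv⟩ := exists_lift_weyl e hlen he w
  rw [mem_foldedLattice, hv]
  exact weylWeight_mem_rootLattice v hx

variable {θ : ι} {g : weightLattice P'}

theorem mem_foldedLattice_of_eq (hg : liftWeight e g = rootWeight P θ) : g ∈ foldedLattice e := by
  rw [mem_foldedLattice, hg]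
  exact AddSubgroup.subset_closure ⟨θ, rfl⟩

/-- The folded lattice is generated by the Weyl group orbit of the folded highest root. -/
theorem foldedLattice_le_closure (hσ : IsDiagramAutomorphism b σ)
    (hlen : ∀ i j, rootNorm P i = rootNorm P j) (he : IsOrbitBase b b' σ e)
    (hθ : IsHighestRoot b θ) [Nonempty b.support] (hg : liftWeight e g = rootWeight P θ) :
    foldedLattice e ≤
      AddSubgroup.closure (Set.range fun w : P'.weylGroup ↦ weylWeight P' w g) := by
  intro x hx
  have : Finite (Orbits σ) := Quotient.finite _
  have := Fintype.ofFinite (Orbits σ)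
  obtain ⟨m, hm, hm1⟩ := hθ.exists_coeff
  obtain ⟨n, hn⟩ := exists_coeff_of_mem_rootLattice (b := b) hx
  have hinv := liftWeight_mem e x
  rw [hn, sum_mem_invariantWeights_iff hσ] at hinv
  obtain ⟨c, hc⟩ := sum_eq_sum_orbitSum hinv
  have key := (reflection_and_span_of_invariant_root e hσ hlen he θ m hm g hg).2
  have hy (o : Orbits σ) : ∃ y ∈ AddSubgroup.closure
      (Set.range fun w : P'.weylGroup ↦ weylWeight P' w g), liftWeight e y = orbitSum o := by
    obtain ⟨i, rfl⟩ := Quotient.exists_rep o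
    -- The highest root has full support, so the orbit of g reaches the orbit sum of every o.
    exact key _ ⟨i, mem_orbitFinset.2 rfl, Nat.one_le_iff_ne_zero.1 (hm1 i)⟩
  choose y hy hy' using hy
  have : x = ∑ o, c o • y o := by
    apply liftWeight_injective e
    rw [hn, hc, finsum_eq_sum_of_fintype, map_sum]
    simp [hy']
  rw [this]
  exact sum_mem fun o _ ↦ zsmul_mem (hy o) _

variable (θ g)

/-- The direction of the reflection in a wall of the alcove. -/
def wallVector : Option b'.support → weightLattice P'
  | some j => rootWeight P' j
  | none => -g

/-- The linear part of the function defining a wall of the alcove. -/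
def wallLinear : Option b'.support → weightLattice P' →+ ℤ
  | none => -((weightPairing θ).comp (liftWeight e))
  | some j => weightPairing (j : ι')

variable (k : ℤ)

/-- The value at zero of the function defining a wall of the alcove. -/
def wallConst : Option b'.support → ℤ
  | none => k
  | some _ => 0

/-- The function defining a wall of the alcove. -/
def wall (c : Option b'.support) (x : weightLattice P') : ℤ := wallLinear e θ c x + wallConst k c

/-- The reflection in a wall of the alcove. -/
def wallReflection (c : Option b'.support) : Function.End (weightLattice P') :=
  fun x ↦ x - wall e θ k c x • wallVector g c

/-- The interior of the alcove. -/
def alcove : Set (weightLattice P') :=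
  {x | (∀ j ∈ b'.support, 0 < weightPairing j x) ∧ weightPairing θ (liftWeight e x) < k}

variable {θ g k}

theorem wall_some (j : b'.support) (x : weightLattice P') :
    wall e θ k (some j) x = weightPairing (j : ι') x := by
  simp [wall, wallLinear, wallConst]

theorem wall_none (x : weightLattice P') :
    wall e θ k none x = k - weightPairing θ (liftWeight e x) := by
  simp [wall, wallLinear, wallConst]; ring

theorem wallLinear_wallVector (hg : liftWeight e g = rootWeight P θ) (c : Option b'.support) :
    wallLinear e θ c (wallVector g c) = 2 := by
  cases c with
  | none => simp [wallLinear, wallVector, hg]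
  | some j => simp [wallLinear, wallVector]

theorem wall_add (c : Option b'.support) (x y : weightLattice P') :
    wall e θ k c (x + y) = wall e θ k c x + wallLinear e θ c y := by
  simp [wall]; ring

theorem wall_wallReflection (hg : liftWeight e g = rootWeight P θ) (c : Option b'.support)
    (x : weightLattice P') : wall e θ k c (wallReflection e θ g k c x) = -wall e θ k c x := by
  rw [wallReflection, sub_eq_add_neg, wall_add, map_neg, map_zsmul, wallLinear_wallVector e hg,
    smul_eq_mul]
  ring

theorem exists_weyl_wall (hσ : IsDiagramAutomorphism b σ)
    (hlen : ∀ i j, rootNorm P i = rootNorm P j) (he : IsOrbitBase b b' σ e)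
    (hθ : IsHighestRoot b θ) [Nonempty b.support] (hg : liftWeight e g = rootWeight P θ)
    (c : Option b'.support) :
    ∃ w : P'.weylGroup, ∀ x, weylWeight P' w x = x - wallLinear e θ c x • wallVector g c := by
  cases c with
  | none =>
    obtain ⟨m, hm, hm1⟩ := hθ.exists_coeff
    obtain ⟨r, hr⟩ := (reflection_and_span_of_invariant_root e hσ hlen he θ m hm g hg).1
    exact ⟨r, fun x ↦ by simp [hr, wallLinear, wallVector]⟩
  | some j => exact ⟨_, weylWeight_ofIdx (j : ι')⟩

/-- The translation part of a wall reflection: it is 0 for a linear wall and k times g for the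
affine wall. -/
theorem exists_const_smul_wallVector (hg : liftWeight e g = rootWeight P θ)
    (c : Option b'.support) :
    ∃ m ∈ foldedLattice e, -(wallConst k c • wallVector g c) = k • m := by
  cases c with
  | none => exact ⟨g, mem_foldedLattice_of_eq e hg, by simp [wallConst, wallVector]⟩
  | some j => exact ⟨0, zero_mem _, by simp [wallConst]⟩

theorem exists_wallReflection_eq (hσ : IsDiagramAutomorphism b σ)
    (hlen : ∀ i j, rootNorm P i = rootNorm P j) (he : IsOrbitBase b b' σ e)
    (hθ : IsHighestRoot b θ) [Nonempty b.support] (hg : liftWeight e g = rootWeight P θ)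
    (c : Option b'.support) :
    ∃ w : P'.weylGroup, ∃ m ∈ foldedLattice e, ∀ x,
      wallReflection e θ g k c x = weylWeight P' w x + k • m := by
  obtain ⟨w, hw⟩ := exists_weyl_wall e hσ hlen he hθ hg c
  obtain ⟨m, hm, h⟩ := exists_const_smul_wallVector (k := k) e hg c
  refine ⟨w, m, hm, fun x ↦ ?_⟩
  rw [hw, ← h, wallReflection, wall, add_smul]
  abel

theorem exists_eq_of_mem_closure [P'.IsReduced] (hσ : IsDiagramAutomorphism b σ)
    (hlen : ∀ i j, rootNorm P i = rootNorm P j) (he : IsOrbitBase b b' σ e)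
    (hθ : IsHighestRoot b θ) [Nonempty b.support] (hg : liftWeight e g = rootWeight P θ)
    {u : Function.End (weightLattice P')}
    (hu : u ∈ Submonoid.closure (Set.range (wallReflection e θ g k))) :
    ∃ w : P'.weylGroup, ∃ m ∈ foldedLattice e, ∀ x, u x = weylWeight P' w x + k • m := by
  induction hu using Submonoid.closure_induction with
  | mem x hx =>
    obtain ⟨c, rfl⟩ := hx
    exact exists_wallReflection_eq e hσ hlen he hθ hg c
  | one => exact ⟨1, 0, zero_mem _, fun x ↦ by simp [Function.End.one_def]⟩
  | mul u v _ _ hu hv =>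
    obtain ⟨w, m, hm, hu⟩ := hu
    obtain ⟨w', m', hm', hv⟩ := hv
    refine ⟨w * w', m + weylWeight P' w m',
      add_mem hm (weylWeight_mem_foldedLattice e hlen he w hm'),
      fun x ↦ ?_⟩
    change u (v x) = _
    rw [hv, hu, weylWeight_mul, map_add, map_zsmul, smul_add]
    abel

theorem weylWeight_mem_closure [P'.IsReduced] (w : P'.weylGroup) :
    (fun x ↦ weylWeight P' w x : Function.End (weightLattice P')) ∈
      Submonoid.closure (Set.range (wallReflection e θ g k)) := by
  refine weylGroup_induction_simple b' (p := fun w ↦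
    (fun x ↦ weylWeight P' w x : Function.End (weightLattice P')) ∈
      Submonoid.closure (Set.range (wallReflection e θ g k))) (fun j hj ↦ ?_) ?_ ?_ w
  · refine Submonoid.subset_closure ⟨some ⟨j, hj⟩, funext fun x ↦ ?_⟩
    rw [weylWeight_ofIdx, wallReflection, wall_some]
    rfl
  · simp only [weylWeight_one]
    exact one_mem _
  · intro v w hv hw
    simp only [weylWeight_mul]
    exact mul_mem hv hw

/-- The affine reflection composed with the linear reflection in g is translation by k g.
Conjugation by the Weyl group gives the translations by k times the orbit of g, which generates the
folded lattice. -/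
theorem translation_mem_closure [P'.IsReduced] (hσ : IsDiagramAutomorphism b σ)
    (hlen : ∀ i j, rootNorm P i = rootNorm P j) (he : IsOrbitBase b b' σ e)
    (hθ : IsHighestRoot b θ) [Nonempty b.support] (hg : liftWeight e g = rootWeight P θ)
    {m : weightLattice P'} (hm : m ∈ foldedLattice e) :
    (fun x ↦ x + k • m : Function.End (weightLattice P')) ∈
      Submonoid.closure (Set.range (wallReflection e θ g k)) := by
  have h1 : (fun x ↦ x + k • g : Function.End (weightLattice P')) ∈
      Submonoid.closure (Set.range (wallReflection e θ g k)) := by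
    obtain ⟨w, hw⟩ := exists_weyl_wall e hσ hlen he hθ hg none
    have h2 := mul_mem (Submonoid.subset_closure
      (Set.mem_range_self (f := wallReflection e θ g k) none)) (weylWeight_mem_closure e w)
    refine mem_of_forall_eq h2 fun x ↦ ?_
    change x + k • g = weylWeight P' w x - wall e θ k none (weylWeight P' w x) • wallVector g none
    rw [hw, sub_eq_add_neg x, wall_add, map_neg, map_zsmul, wallLinear_wallVector e hg]
    simp only [wall, wallConst, wallVector]
    module
  -- Both signs are carried because the ambient object is only a submonoid. The sign -k is obtained
  -- by replacing w with w r, where r sends g to -g.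
  have h2 (w : P'.weylGroup) (z : ℤ) (hz : z = k ∨ z = -k) :
      (fun x ↦ x + z • weylWeight P' w g : Function.End (weightLattice P')) ∈
      Submonoid.closure (Set.range (wallReflection e θ g k)) := by
    rcases hz with rfl | rfl
    · have h3 := mul_mem (mul_mem (weylWeight_mem_closure e w) h1) (weylWeight_mem_closure e w⁻¹)
      refine mem_of_forall_eq h3 fun x ↦ ?_
      change _ = weylWeight P' w (weylWeight P' w⁻¹ x + z • g)
      rw [map_add, weylWeight_apply_inv, map_zsmul]
    · obtain ⟨r, hr⟩ := exists_weyl_wall e hσ hlen he hθ hg none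
      have hrg : weylWeight P' r g = -g := by
        have := wallLinear_wallVector e hg none
        rw [hr]
        simp only [wallVector, map_neg] at this ⊢
        rw [show wallLinear e θ none g = -2 by linarith]
        module
      have h3 := mul_mem (mul_mem (weylWeight_mem_closure e (w * r)) h1)
        (weylWeight_mem_closure e (w * r)⁻¹)
      refine mem_of_forall_eq h3 fun x ↦ ?_
      change _ = weylWeight P' (w * r) (weylWeight P' (w * r)⁻¹ x + k • g)
      rw [map_add, weylWeight_apply_inv, map_zsmul, weylWeight_mul w r g, hrg, map_neg]
      simp
  have h3 := foldedLattice_le_closure e hσ hlen he hθ hg hm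
  suffices h : ∀ m ∈ AddSubgroup.closure (Set.range fun w : P'.weylGroup ↦ weylWeight P' w g),
      ∀ z : ℤ, z = k ∨ z = -k → (fun x ↦ x + z • m : Function.End (weightLattice P')) ∈
      Submonoid.closure (Set.range (wallReflection e θ g k)) from h m h3 k (Or.inl rfl)
  intro m hm
  induction hm using AddSubgroup.closure_induction with
  | mem x hx => obtain ⟨w, rfl⟩ := hx; exact h2 w
  | zero => intro z _; simp only [smul_zero, add_zero]; exact one_mem _
  | add x y _ _ hx hy =>
    intro z hz
    have := mul_mem (hy z hz) (hx z hz)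
    refine mem_of_forall_eq this fun u ↦ ?_
    change _ = u + z • x + z • y
    rw [smul_add, add_assoc]
  | neg x _ hx =>
    intro z hz
    have := hx (-z) (hz.symm.imp (by rintro rfl; simp) (by rintro rfl; simp))
    simpa using this

theorem affine_mem_closure [P'.IsReduced] (hσ : IsDiagramAutomorphism b σ)
    (hlen : ∀ i j, rootNorm P i = rootNorm P j) (he : IsOrbitBase b b' σ e)
    (hθ : IsHighestRoot b θ) [Nonempty b.support] (hg : liftWeight e g = rootWeight P θ)
    (w : P'.weylGroup) {m : weightLattice P'} (hm : m ∈ foldedLattice e) :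
    (fun x ↦ weylWeight P' w x + k • m : Function.End (weightLattice P')) ∈
      Submonoid.closure (Set.range (wallReflection e θ g k)) :=
  mul_mem (translation_mem_closure e hσ hlen he hθ hg hm) (weylWeight_mem_closure e w)

end Walls

/-! ### The alcove as a fundamental domain of the affine group -/

section Alcove

variable {ι M N : Type*} [AddCommGroup M] [Module ℂ M] [AddCommGroup N] [Module ℂ N]
variable {P : RootPairing ι ℂ M N} [P.IsRootSystem] {b : P.Base}
variable {ι' M' N' : Type*} [AddCommGroup M'] [Module ℂ M'] [AddCommGroup N'] [Module ℂ N']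
variable {P' : RootPairing ι' ℂ M' N'} [P'.IsRootSystem] {b' : P'.Base}
variable [P.IsCrystallographic] [P'.IsCrystallographic] [Fintype ι] [Fintype ι']
variable {σ : Equiv.Perm b.support} (e : Orbits σ ≃ b'.support)
variable {θ : ι} {g : weightLattice P'} {k : ℤ}

theorem IsHighestRoot.weightPairing_le (hθ : IsHighestRoot b θ)
    (hlen : ∀ i j, rootNorm P i = rootNorm P j) (γ : ι) {μ : weightLattice P}
    (hμ : IsDominant b μ) : weightPairing γ μ ≤ weightPairing θ μ := by
  have h := weightForm_nonneg_of_mem_simpleCone b (hθ.sub_mem γ) hμ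
  rw [map_sub, AddMonoidHom.sub_apply, weightForm_comm _ μ, weightForm_comm _ μ] at h
  have h1 := two_mul_weightForm_eq γ μ
  have h2 := two_mul_weightForm_eq θ μ
  rw [hlen θ γ] at h2
  have h3 := rootNorm_pos (P := P) γ
  nlinarith

theorem rootWeight_reflectionPerm_self (i : ι) :
    rootWeight P (P.reflectionPerm i i) = -rootWeight P i := by
  ext
  change P.root (P.reflectionPerm i i) = -P.root i
  rw [P.root_reflectionPerm, P.reflection_apply_self]

theorem weightPairing_reflectionPerm_self (i : ι) (μ : weightLattice P) :
    weightPairing (P.reflectionPerm i i) μ = -weightPairing i μ := by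
  rw [weightPairing_eq_iff, P.coroot_reflectionPerm, P.coreflection_apply_self, map_neg,
    weightPairing_spec]
  simp

variable (b) in
theorem isPos_or_isPos_reflectionPerm_self (i : ι) :
    b.IsPos i ∨ b.IsPos (P.reflectionPerm i i) := by
  rcases b.root_mem_or_neg_mem i with h | h
  · exact Or.inl (isPos_of_mem_closure b h)
  · refine Or.inr (isPos_of_mem_closure b ?_)
    rwa [P.root_reflectionPerm, P.reflection_apply_self]

theorem liftWeight_pos {x : weightLattice P'} (hx : x ∈ alcove e θ k) (i : ι) (hi : i ∈ b.support) :
    0 < weightPairing i (liftWeight e x) := by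
  rw [weightPairing_liftWeight e ⟨i, hi⟩]
  exact hx.1 _ (e _).2

/-- On the alcove, a root takes values strictly between `-k` and `k`, with its own sign. -/
theorem weightPairing_lift_of_mem_alcove (hlen : ∀ i j, rootNorm P i = rootNorm P j)
    (hθ : IsHighestRoot b θ) {x : weightLattice P'} (hx : x ∈ alcove e θ k) {γ : ι}
    (hγ : b.IsPos γ) : 0 < weightPairing γ (liftWeight e x) ∧
      weightPairing γ (liftWeight e x) ≤ weightPairing θ (liftWeight e x) :=
  ⟨weightPairing_pos_of_isPos b hγ (liftWeight_pos e hx),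
    hθ.weightPairing_le hlen γ fun i ↦ (liftWeight_pos e hx i i.2).le⟩

theorem abs_weightPairing_lift_lt (hlen : ∀ i j, rootNorm P i = rootNorm P j)
    (hθ : IsHighestRoot b θ) {x : weightLattice P'} (hx : x ∈ alcove e θ k) (γ : ι) :
    weightPairing γ (liftWeight e x) ≠ 0 ∧ |weightPairing γ (liftWeight e x)| < k := by
  have h0 := hx.2
  rcases isPos_or_isPos_reflectionPerm_self b γ with h | h
  · obtain ⟨h1, h2⟩ := weightPairing_lift_of_mem_alcove e hlen hθ hx h
    exact ⟨h1.ne', abs_lt.2 ⟨by linarith, by linarith⟩⟩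
  · obtain ⟨h1, h2⟩ := weightPairing_lift_of_mem_alcove e hlen hθ hx h
    rw [weightPairing_reflectionPerm_self] at h1 h2
    exact ⟨by linarith [h1], abs_lt.2 ⟨by linarith, by linarith⟩⟩

/-- Lifting w to the Weyl group of `P` turns every transform of a wall into a coroot of `P`
evaluated on lifted weights, so sign questions are settled among the roots of `P`. -/
theorem exists_wallLinear_weylWeight [P'.IsReduced] (hlen : ∀ i j, rootNorm P i = rootNorm P j)
    (he : IsOrbitBase b b' σ e) (d : Option b'.support) (w : P'.weylGroup) :
    ∃ γ : ι, ∀ x, wallLinear e θ d (weylWeight P' w x) = weightPairing γ (liftWeight e x) := by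
  obtain ⟨v, hv⟩ := exists_lift_weyl e hlen he w
  cases d with
  | none =>
    refine ⟨P.reflectionPerm (weylIndex v⁻¹ θ) (weylIndex v⁻¹ θ), fun x ↦ ?_⟩
    rw [weightPairing_reflectionPerm_self, ← weightPairing_weylWeight, ← hv]
    rfl
  | some j =>
    obtain ⟨i, rfl⟩ := exists_toOrbit e j
    refine ⟨weylIndex v⁻¹ (i : ι), fun x ↦ ?_⟩
    rw [← weightPairing_weylWeight, ← hv, weightPairing_liftWeight]
    rfl

theorem exists_wall_eq [P'.IsReduced] (hσ : IsDiagramAutomorphism b σ)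
    (hlen : ∀ i j, rootNorm P i = rootNorm P j) (he : IsOrbitBase b b' σ e)
    (hθ : IsHighestRoot b θ) [Nonempty b.support] (hg : liftWeight e g = rootWeight P θ)
    {u : Function.End (weightLattice P')}
    (hu : u ∈ Submonoid.closure (Set.range (wallReflection e θ g k))) (d : Option b'.support) :
    ∃ (γ : ι) (n : ℤ), ∀ x, wall e θ k d (u x) = weightPairing γ (liftWeight e x) + n * k := by
  obtain ⟨w, m, -, hu⟩ := exists_eq_of_mem_closure e hσ hlen he hθ hg hu
  obtain ⟨γ, hγ⟩ := exists_wallLinear_weylWeight (θ := θ) e hlen he d w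
  obtain ⟨q, hq⟩ : ∃ q : ℤ, wallConst k d = q * k := by
    cases d with
    | none => exact ⟨1, by simp [wallConst]⟩
    | some j => exact ⟨0, by simp [wallConst]⟩
  refine ⟨γ, wallLinear e θ d m + q, fun x ↦ ?_⟩
  rw [wall, hu, map_add, hγ, map_zsmul, hq, smul_eq_mul]
  ring

/-- On the alcove the pairing is nonzero and smaller than k in absolute value, so it is not a
multiple of k. -/
theorem ne_zero_of_mem_alcove (hlen : ∀ i j, rootNorm P i = rootNorm P j)
    (hθ : IsHighestRoot b θ) {x : weightLattice P'} (hx : x ∈ alcove e θ k) (γ : ι) (n : ℤ) :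
    weightPairing γ (liftWeight e x) + n * k ≠ 0 := by
  obtain ⟨h1, h2⟩ := abs_weightPairing_lift_lt e hlen hθ hx γ
  intro h
  have h3 : k ∣ weightPairing γ (liftWeight e x) := ⟨-n, by linarith⟩
  exact h1 (Int.eq_zero_of_abs_lt_dvd h3 h2)

/-- A simple wall reflection lifts to v, which moves γ only along the orbit of that wall. A sign
change makes γ positive and v⁻¹γ negative, so γ is supported in the orbit. On lifted weights,
constant along orbits, such a γ is a multiple of the wall function. -/
theorem eq_mul_wall_some (hlen : ∀ i j, rootNorm P i = rootNorm P j) (he : IsOrbitBase b b' σ e)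
    (hθ : IsHighestRoot b θ) {x : weightLattice P'} (hx : x ∈ alcove e θ k) {γ : ι} {n : ℤ}
    (j : b'.support) (h₁ : 0 < weightPairing γ (liftWeight e x) + n * k)
    (h₂ : weightPairing γ (liftWeight e (wallReflection e θ g k (some j) x)) + n * k < 0) :
    ∃ p : ℤ, 0 < p ∧
      ∀ y, weightPairing γ (liftWeight e y) + n * k = p * wall e θ k (some j) y := by
  classical
  obtain ⟨o, rfl⟩ := e.surjective j
  obtain ⟨v, hv, hv'⟩ := exists_lift_reflection e hlen he o
  have hs : wallReflection e θ g k (some (e o)) x =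
      weylWeight P' (RootPairing.weylGroup.ofIdx P' (e o)) x := by
    rw [weylWeight_ofIdx, wallReflection, wall_some]
    rfl
  rw [hs, hv, weightPairing_weylWeight] at h₂
  have hk : 0 < k := by
    have := (abs_weightPairing_lift_lt e hlen hθ hx γ).2
    exact (abs_nonneg _).trans_lt this
  have hA := abs_lt.1 (abs_weightPairing_lift_lt e hlen hθ hx γ).2
  have hB := abs_lt.1 (abs_weightPairing_lift_lt e hlen hθ hx (weylIndex v⁻¹ γ)).2
  -- Two numbers of absolute value less than k get opposite signs after adding n k.
  have hn : n = 0 := by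
    have h3 : n < 1 := by nlinarith
    have h4 : -1 < n := by nlinarith
    omega
  subst hn
  simp only [zero_mul, add_zero] at h₁ h₂ ⊢
  have hγ : b.IsPos γ := (isPos_or_isPos_reflectionPerm_self b γ).resolve_right fun h ↦ by
    have := (weightPairing_lift_of_mem_alcove e hlen hθ hx h).1
    rw [weightPairing_reflectionPerm_self] at this
    linarith
  set γ' := weylIndex v⁻¹ γ with hγ'
  have hγ'neg : b.IsPos (P.reflectionPerm γ' γ') :=
    (isPos_or_isPos_reflectionPerm_self b γ').resolve_left fun h ↦ by
      have := (weightPairing_lift_of_mem_alcove e hlen hθ hx h).1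
      linarith
  obtain ⟨r, hr⟩ := hv' (rootWeight P γ')
  rw [weylWeight_rootWeight, hγ', ← weylIndex_mul, mul_inv_cancel,
    show weylIndex (1 : P.weylGroup) γ = γ by simp [weylIndex]] at hr
  obtain ⟨m, hm⟩ := exists_coeff_of_mem_simpleCone b (rootWeight_mem_simpleCone b hγ)
  obtain ⟨m', hm'⟩ := exists_coeff_of_mem_simpleCone b (rootWeight_mem_simpleCone b hγ'neg)
  rw [rootWeight_reflectionPerm_self, neg_eq_iff_eq_neg] at hm'
  have hz : ∀ i ∉ orbitFinset o, m i = 0 := by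
    have hsum : ∑ i, (m i : ℤ) • rootWeight P (i : ι) =
        ∑ i, (-(m' i : ℤ) + if i ∈ orbitFinset o then r i else 0) • rootWeight P (i : ι) := by
      simp only [add_smul, Finset.sum_add_distrib, neg_smul, natCast_zsmul, ← hm,
        Finset.sum_neg_distrib, ← hm', ite_smul, zero_smul, Finset.sum_ite_mem,
        Finset.univ_inter]
      exact hr
    intro i hi
    have := congrFun (sum_rootWeight_injective hsum) i
    simp only [hi, if_false] at this
    omega
  have hval (y : weightLattice P') : weightPairing γ (liftWeight e y) =
      (∑ i, (m i : ℤ)) * wall e θ k (some (e o)) y := by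
    rw [weightPairing_eq_sum hlen Finset.univ (fun i ↦ (m i : ℤ)) (fun i : b.support ↦ (i : ι))
      (by simpa using hm), Finset.sum_mul]
    refine Finset.sum_congr rfl fun i _ ↦ ?_
    by_cases hi : i ∈ orbitFinset o
    · rw [weightPairing_liftWeight_of_mem e hi, wall_some]
    · simp [hz i hi]
  refine ⟨_, ?_, hval⟩
  have h5 := hval x
  have h6 : 0 < wall e θ k (some (e o)) x := by
    rw [wall_some]; exact hx.1 _ (e o).2
  rw [h5] at h₁
  exact pos_of_mul_pos_left h₁ h6.le

/-- The affine reflection changes the pairing with γ by (k - ⟨x, θ̌⟩)⟨θ, γ̌⟩. For γ positive this is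
nonnegative, as θ is dominant, and no sign is lost. For γ negative, n ≥ 1 and ⟨θ, γ̌⟩ ≥ -2; the
values from -1 on cannot cause the change, and -2 occurs only for γ = -θ, which gives the wall
function itself. -/
theorem eq_mul_wall_none (hlen : ∀ i j, rootNorm P i = rootNorm P j)
    (hθ : IsHighestRoot b θ) [Nonempty b.support] (hg : liftWeight e g = rootWeight P θ)
    {x : weightLattice P'} (hx : x ∈ alcove e θ k) {γ : ι} {n : ℤ}
    (h₁ : 0 < weightPairing γ (liftWeight e x) + n * k)
    (h₂ : weightPairing γ (liftWeight e (wallReflection e θ g k none x)) + n * k < 0) :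
    ∃ p : ℤ, 0 < p ∧
      ∀ y, weightPairing γ (liftWeight e y) + n * k = p * wall e θ k none y := by
  have hH := hx.2
  obtain ⟨hA, hA'⟩ := abs_weightPairing_lift_lt e hlen hθ hx γ
  have hA' := abs_lt.1 hA'
  have hdom : ∀ i : b.support, 0 ≤ weightPairing (i : ι) (rootWeight P θ) :=
    fun i ↦ hθ.weightPairing_nonneg i.2
  simp only [wallReflection, wall_none, wallVector, smul_neg, sub_neg_eq_add, map_add, map_zsmul,
    hg, weightPairing_rootWeight, smul_eq_mul] at h₂
  rcases isPos_or_isPos_reflectionPerm_self b γ with hγ | hγ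
  · exfalso
    obtain ⟨h3, h4⟩ := weightPairing_lift_of_mem_alcove e hlen hθ hx hγ
    have hn : -1 < n := by nlinarith
    have hq : 0 ≤ P.pairingIn ℤ θ γ := by
      have h5 := weightForm_nonneg_of_mem_simpleCone b (rootWeight_mem_simpleCone b hγ) hdom
      have h6 := two_mul_weightForm_eq γ (rootWeight P θ)
      rw [weightPairing_rootWeight, weightForm_comm] at h6
      have := rootNorm_pos (P := P) γ
      nlinarith
    nlinarith [mul_nonneg (sub_nonneg.2 hH.le) hq]
  · obtain ⟨h3, h4⟩ := weightPairing_lift_of_mem_alcove e hlen hθ hx hγ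
    have hle := pairingIn_le_two hlen θ (P.reflectionPerm γ γ)
    have hqq : P.pairingIn ℤ θ (P.reflectionPerm γ γ) = -P.pairingIn ℤ θ γ := by
      rw [← weightPairing_rootWeight, weightPairing_reflectionPerm_self, weightPairing_rootWeight]
    rw [weightPairing_reflectionPerm_self] at h3 h4
    have hn : 0 < n := by nlinarith
    rw [hqq] at hle
    have hk : 0 < k := by linarith
    by_cases hq2 : P.pairingIn ℤ θ γ = -2
    · have hθγ : θ = P.reflectionPerm γ γ := eq_of_pairingIn_eq_two hlen (by rw [hqq, hq2]; rfl)
      have hval (y) : weightPairing γ (liftWeight e y) = -weightPairing θ (liftWeight e y) := by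
        rw [hθγ, weightPairing_reflectionPerm_self, neg_neg]
      have hn1 : n = 1 := by
        rw [hq2, hval] at h₂
        have : n < 2 := by nlinarith
        omega
      exact ⟨1, one_pos, fun y ↦ by rw [hval, wall_none, hn1]; ring⟩
    · exfalso
      have : -1 ≤ P.pairingIn ℤ θ γ := by omega
      nlinarith [mul_le_mul_of_nonneg_left this (sub_nonneg.2 hH.le)]

/-- A reflection preserving the form has a linear functional proportional to the product with its
vector. So proportional functionals have proportional vectors; the difference of the two sides has
norm 0. -/
theorem weylWeight_wallVector [P'.IsReduced] (hσ : IsDiagramAutomorphism b σ)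
    (hlen : ∀ i j, rootNorm P i = rootNorm P j) (he : IsOrbitBase b b' σ e)
    (hθ : IsHighestRoot b θ) [Nonempty b.support] (hg : liftWeight e g = rootWeight P θ)
    {c d : Option b'.support} {w : P'.weylGroup} {p : ℤ}
    (h : ∀ y, wallLinear e θ d (weylWeight P' w y) = p * wallLinear e θ c y) :
    weylWeight P' w (wallVector g c) = p • wallVector g d := by
  have hform (c : Option b'.support) (y : weightLattice P') :
      2 * weightForm (wallVector g c) y =
        weightForm (wallVector g c) (wallVector g c) * wallLinear e θ c y := by
    obtain ⟨r, hr⟩ := exists_weyl_wall e hσ hlen he hθ hg c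
    exact two_mul_weightForm_of_reflection hr (wallLinear_wallVector e hg c) y
  have hd0 : wallVector g d ≠ 0 := fun h0 ↦ by
    have := wallLinear_wallVector e hg d
    rw [h0, map_zero] at this
    omega
  have hNd := weightForm_self_pos hd0
  set Nc := weightForm (wallVector g c) (wallVector g c) with hNc
  set Nd := weightForm (wallVector g d) (wallVector g d) with hNd'
  have h1 := hform d (weylWeight P' w (wallVector g c))
  rw [h, wallLinear_wallVector e hg] at h1
  have h2 := h (weylWeight P' w⁻¹ (wallVector g d))
  rw [weylWeight_apply_inv, wallLinear_wallVector e hg] at h2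
  have h3 := hform c (weylWeight P' w⁻¹ (wallVector g d))
  rw [← weightForm_weylWeight w, weylWeight_apply_inv, ← hNc] at h3
  rw [weightForm_comm] at h3
  rw [← sub_eq_zero]
  apply eq_zero_of_weightForm_self
  simp only [map_sub, map_zsmul, AddMonoidHom.sub_apply, AddMonoidHom.smul_apply, smul_eq_mul,
    weightForm_weylWeight, weightForm_comm (weylWeight P' w (wallVector g c)) (wallVector g d),
    ← hNc, ← hNd']
  rw [← hNd'] at h1
  set β := weightForm (wallVector g d) (weylWeight P' w (wallVector g c))
  have h4 : β = Nd * p := by linarith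
  have h5 : 2 * Nc = 2 * (p * β) := by linear_combination Nc * h2 - p * h3
  replace h5 : Nc = p * β := by linarith
  rw [h5, h4]
  ring

/-- The affine Weyl group acts freely on the interior of the alcove. -/
theorem eq_of_mem_alcove [P'.IsReduced] (hσ : IsDiagramAutomorphism b σ)
    (hlen : ∀ i j, rootNorm P i = rootNorm P j) (he : IsOrbitBase b b' σ e)
    (hθ : IsHighestRoot b θ) [Nonempty b.support] (hg : liftWeight e g = rootWeight P θ)
    {x m : weightLattice P'} {w : P'.weylGroup} (hx : x ∈ alcove e θ k)
    (hm : m ∈ foldedLattice e) (hwx : weylWeight P' w x + k • m ∈ alcove e θ k) :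
    w = 1 ∧ k • m = 0 := by
  have h := eq_one_of_mem_chamber (wallReflection e θ g k) (wall e θ k) (alcove e θ k)
    (wall_wallReflection e hg) (fun x hx c ↦ ?_) (fun x hx d u hu ↦ ?_)
    (fun x hx c d u hu h1 h2 ↦ ?_) (affine_mem_closure e hσ hlen he hθ hg w hm) hx hwx
  · have h0 : k • m = 0 := by
      have := congrFun h 0
      simpa [Function.End.one_def] using this
    refine ⟨weylGroup_eq_one w fun μ ↦ ?_, h0⟩
    have := congrFun h μ
    rw [h0] at this
    simpa [Function.End.one_def] using this
  · cases c with
    | none => rw [wall_none]; exact sub_pos.2 hx.2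
    | some j => rw [wall_some]; exact hx.1 j j.2
  · obtain ⟨γ, n, h⟩ := exists_wall_eq e hσ hlen he hθ hg hu d
    rw [h]
    exact ne_zero_of_mem_alcove e hlen hθ hx γ n
  · obtain ⟨γ, n, h⟩ := exists_wall_eq e hσ hlen he hθ hg hu d
    rw [h] at h1
    change wall e θ k d (u (wallReflection e θ g k c x)) < 0 at h2
    rw [h] at h2
    -- The wall of d pulled back by u separates x from its reflection in c, so it is a positive
    -- multiple of the wall of c. Hence u conjugates the reflection in c into the one in d.
    obtain ⟨p, hp, hpp⟩ : ∃ p : ℤ, 0 < p ∧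
        ∀ y, weightPairing γ (liftWeight e y) + n * k = p * wall e θ k c y := by
      cases c with
      | none => exact eq_mul_wall_none e hlen hθ hg hx h1 h2
      | some j => exact eq_mul_wall_some e hlen he hθ hx j h1 h2
    simp only [← h] at hpp
    obtain ⟨w, m, -, hu⟩ := exists_eq_of_mem_closure e hσ hlen he hθ hg hu
    have hlin (y) : wallLinear e θ d (weylWeight P' w y) = p * wallLinear e θ c y := by
      have h3 := hpp y
      have h4 := hpp 0
      simp only [hu, map_zero, zero_add] at h3 h4
      rw [add_comm, wall_add, h4, wall, wall, map_zero] at h3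
      linarith
    have hvec := weylWeight_wallVector e hσ hlen he hθ hg hlin
    funext y
    change wallReflection e θ g k d (u (wallReflection e θ g k c y)) = u y
    rw [wallReflection, hpp, wall_wallReflection e hg, hu, hu, wallReflection, map_sub, map_zsmul,
      hvec, mul_neg, neg_smul, mul_comm p, mul_smul]
    abel

/-- Every weight can be moved into the closed alcove by the affine Weyl group. -/
theorem exists_affine_mem_closed_alcove [P'.IsReduced] (hσ : IsDiagramAutomorphism b σ)
    (hlen : ∀ i j, rootNorm P i = rootNorm P j) (he : IsOrbitBase b b' σ e)
    (hθ : IsHighestRoot b θ) [Nonempty b.support] (hg : liftWeight e g = rootWeight P θ)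
    {ρ : weightLattice P'} (hρ : ρ ∈ alcove e θ k) (x : weightLattice P') :
    ∃ (w : P'.weylGroup) (m : weightLattice P'), m ∈ foldedLattice e ∧
      ∀ c, 0 ≤ wall e θ k c (weylWeight P' w x + k • m) := by
  -- Take the image of x nearest to the interior point ρ. If it lay on the wrong side of a wall,
  -- reflecting it would bring it nearer.
  let f : Function.End (weightLattice P') → ℕ := fun u ↦ (weightForm (u x - ρ) (u x - ρ)).toNat
  obtain ⟨u, hu, hmin⟩ := WellFounded.has_min (measure f).wf
    (Submonoid.closure (Set.range (wallReflection e θ g k)) : Set _) ⟨1, one_mem _⟩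
  obtain ⟨w, m, hm, huw⟩ := exists_eq_of_mem_closure e hσ hlen he hθ hg hu
  refine ⟨w, m, hm, fun c ↦ ?_⟩
  rw [← huw]
  by_contra! hc
  refine hmin (wallReflection e θ g k c * u)
    (mul_mem (Submonoid.subset_closure ⟨c, rfl⟩) hu) ?_
  change (weightForm (wallReflection e θ g k c (u x) - ρ)
    (wallReflection e θ g k c (u x) - ρ)).toNat < (weightForm (u x - ρ) (u x - ρ)).toNat
  have hρc : 0 < wall e θ k c ρ := by
    cases c with
    | none => rw [wall_none]; exact sub_pos.2 hρ.2
    | some j => rw [wall_some]; exact hρ.1 j j.2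
  set z := u x
  obtain ⟨r, hr⟩ := exists_weyl_wall e hσ hlen he hθ hg c
  have h1 := two_mul_weightForm_of_reflection hr (wallLinear_wallVector e hg c) (z - ρ)
  have hv0 : wallVector g c ≠ 0 := fun h0 ↦ by
    have := wallLinear_wallVector e hg c
    rw [h0, map_zero] at this
    omega
  have hN := weightForm_self_pos hv0
  have h2 : wallLinear e θ c (z - ρ) = wall e θ k c z - wall e θ k c ρ := by
    simp [wall]
  have hnn := weightForm_self_nonneg (wallReflection e θ g k c z - ρ)
  suffices h : weightForm (wallReflection e θ g k c z - ρ) (wallReflection e θ g k c z - ρ) <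
      weightForm (z - ρ) (z - ρ) by omega
  rw [wallReflection, sub_right_comm]
  rw [h2] at h1
  generalize z - ρ = y at h1
  simp only [map_sub, map_zsmul, AddMonoidHom.sub_apply, AddMonoidHom.smul_apply, smul_eq_mul,
    weightForm_comm y (wallVector g c)]
  nlinarith [mul_pos hN hρc, mul_pos_of_neg_of_neg hc (neg_neg_of_pos (mul_pos hN hρc))]

/-- All coefficients of θ are at least 1, so the affine wall bounds every simple coordinate by k. -/
theorem finite_closed_alcove (hlen : ∀ i j, rootNorm P i = rootNorm P j)
    (hθ : IsHighestRoot b θ) [Nonempty b.support] :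
    {x : weightLattice P' | ∀ c, 0 ≤ wall e θ k c x}.Finite := by
  classical
  obtain ⟨m, hm, hm1⟩ := hθ.exists_coeff
  refine Set.Finite.of_finite_image (f := weightCoords b') ?_ (weightCoords b').injective.injOn
  refine (Set.finite_Icc (0 : b'.support → ℤ) fun _ ↦ k).subset ?_
  rintro _ ⟨x, hx, rfl⟩
  refine ⟨fun j ↦ by have := hx (some j); rwa [wall_some] at this, fun j ↦ ?_⟩
  obtain ⟨i, rfl⟩ := exists_toOrbit e j
  have h1 := hx none
  rw [wall_none, weightPairing_eq_sum hlen Finset.univ (fun i ↦ (m i : ℤ))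
    (fun i : b.support ↦ (i : ι)) (by simpa using hm)] at h1
  have hnn (i : b.support) : 0 ≤ weightPairing (i : ι) (liftWeight e x) := by
    rw [weightPairing_liftWeight, ← wall_some e]
    exact hx _
  have h2 := Finset.single_le_sum (f := fun i : b.support ↦
    (m i : ℤ) * weightPairing (i : ι) (liftWeight e x))
    (fun i _ ↦ mul_nonneg (by positivity) (hnn i)) (Finset.mem_univ i)
  have h3 : (1 : ℤ) ≤ m i := by exact_mod_cast hm1 i
  change weightPairing (e (toOrbit σ i) : ι') x ≤ k
  rw [← weightPairing_liftWeight]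
  have := hnn i
  nlinarith

end Alcove

/-! ### Weight bases of highest weight modules -/

section HighestWeight

variable {L : Type*} [LieRing L] [LieAlgebra ℂ L] [FiniteDimensional ℂ L] [IsKilling ℂ L]
variable {H : LieSubalgebra ℂ L} [H.IsCartanSubalgebra]
variable {W : Type*} [AddCommGroup W] [Module ℂ W] [LieRingModule L W] [LieModule ℂ L W]

theorem mem_of_cartan_of_rootSpace {S : Submodule ℂ L} (hH : ∀ h : H, (h : L) ∈ S)
    (hroot : ∀ α : H.root, ∀ x ∈ rootSpace H α.1, x ∈ S) (x : L) : x ∈ S := by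
  have h := congrArg LieSubmodule.toSubmodule (cartan_sup_iSup_rootSpace_eq_top (K := ℂ) H)
  have h1 : (⊤ : Submodule ℂ L) ≤ S := by
    rw [← LieSubmodule.top_toSubmodule (R := ℂ) (L := H) (M := L), ← h,
      LieSubmodule.sup_toSubmodule, LieSubmodule.iSup_toSubmodule]
    simp only [LieSubmodule.iSup_toSubmodule]
    refine sup_le (fun y hy ↦ hH ⟨y, hy⟩) (iSup₂_le fun α hα ↦ ?_)
    exact fun y hy ↦ hroot ⟨α, by simpa using hα⟩ y hy
  exact h1 trivial

/-- `w` is a weight vector of weight `μ`, or zero. -/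
def IsWeightVector (H : LieSubalgebra ℂ L) [H.IsCartanSubalgebra] (μ : Dual ℂ H) (w : W) : Prop :=
  ∀ h : H, ⁅(h : L), w⁆ = μ h • w

theorem IsWeightVector.lie {χ μ : Dual ℂ H} {x : L} {w : W} (hw : IsWeightVector H μ w)
    (hx : x ∈ rootSpace H χ) : IsWeightVector H (μ + χ) ⁅x, w⁆ := by
  intro h
  have h1 : ⁅(h : L), x⁆ = χ h • x := lie_eq_smul_of_mem_rootSpace hx h
  rw [leibniz_lie, h1, hw h, smul_lie, lie_smul, ← add_smul, LinearMap.add_apply, add_comm]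

/-- The vectors obtained from `v`, of weight `μ`, by successively applying vectors from negative
root spaces, with their weights. -/
inductive Word (b : (rootSystem H).Base) (v : W) (Λ : weightLattice (rootSystem H)) :
    W → weightLattice (rootSystem H) → Prop
  | base : Word b v Λ v Λ
  | step {u : W} {μ : weightLattice (rootSystem H)} (α : H.root) (hα : b.IsPos α) (x : L)
      (hx : x ∈ rootSpace H (-α.1).toLinear) (h : Word b v Λ u μ) :
      Word b v Λ ⁅x, u⁆ (μ - rootWeight (rootSystem H) α)

variable {b : (rootSystem H).Base} {v : W} {Λ : weightLattice (rootSystem H)}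

theorem Word.isWeightVector (hv : IsWeightVector H (Λ : Dual ℂ H) v) {u : W}
    {μ : weightLattice (rootSystem H)} (h : Word b v Λ u μ) :
    IsWeightVector H (μ : Dual ℂ H) u := by
  induction h with
  | base => exact hv
  | step α hα x hx h ih =>
    have := ih.lie hx
    convert this using 1
    rw [Weight.toLinear_neg, ← sub_eq_add_neg]
    rfl

theorem Word.sub_mem {u : W} {μ : weightLattice (rootSystem H)} (h : Word b v Λ u μ) :
    Λ - μ ∈ simpleCone b := by
  induction h with
  | base => simp
  | step α hα x hx h ih =>
    rw [sub_sub_eq_add_sub, add_sub_right_comm]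
    exact add_mem ih (rootWeight_mem_simpleCone b hα)

/-- Every step lowers the weight strictly, so only the empty word has weight Λ. -/
theorem Word.eq_of_eq {u : W} {μ : weightLattice (rootSystem H)} (h : Word b v Λ u μ)
    (hμ : μ = Λ) : u = v := by
  cases h with
  | base => rfl
  | step α hα x hx h =>
    exfalso
    have h1 := h.sub_mem
    rw [sub_eq_iff_eq_add] at hμ
    rw [hμ] at h1
    refine rootWeight_ne_zero (P := rootSystem H) α
      (simpleCone_antisymm b (rootWeight_mem_simpleCone b hα) ?_)
    simpa using h1

/-- The span of all words. -/
def wordSpan (b : (rootSystem H).Base) (v : W) (Λ : weightLattice (rootSystem H)) :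
    Submodule ℂ W :=
  Submodule.span ℂ {u | ∃ μ, Word b v Λ u μ}

theorem Word.mem {u : W} {μ : weightLattice (rootSystem H)} (h : Word b v Λ u μ) :
    u ∈ wordSpan b v Λ :=
  Submodule.subset_span ⟨μ, h⟩

theorem lie_mem_wordSpan_of_forall {x : L} (h : ∀ u μ, Word b v Λ u μ → ⁅x, u⁆ ∈ wordSpan b v Λ)
    {u : W} (hu : u ∈ wordSpan b v Λ) : ⁅x, u⁆ ∈ wordSpan b v Λ := by
  induction hu using Submodule.span_induction with
  | mem x hx => obtain ⟨μ, hμ⟩ := hx; exact h _ μ hμ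
  | zero => simp
  | add x y _ _ hx hy => rw [lie_add]; exact add_mem hx hy
  | smul a x _ hx => rw [lie_smul]; exact Submodule.smul_mem _ _ hx

theorem mem_rootSpace_neg_toLinear (α : H.root) (β : H.root)
    (h : (rootSystem H).root β = -(rootSystem H).root α) : (β.1 : H → ℂ) = (-α.1).toLinear := by
  funext x
  have := LinearMap.congr_fun h x
  simpa using this

variable (b) in
theorem isPos_or_exists_neg (α : H.root) :
    b.IsPos α ∨ ∃ β : H.root, b.IsPos β ∧ (α.1 : H → ℂ) = (-β.1).toLinear := by
  refine (isPos_or_isPos_reflectionPerm_self b α).imp_right fun h ↦ ⟨_, h, ?_⟩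
  apply mem_rootSpace_neg_toLinear
  rw [(rootSystem H).root_reflectionPerm, (rootSystem H).reflection_apply_self, neg_neg]

/-- Induction on the word, for all x in the Lie algebra at once: in ⁅x, ⁅y, u⁆⁆ the Leibniz rule
leaves ⁅⁅x, y⁆, u⁆ and ⁅y, ⁅x, u⁆⁆, both covered by the shorter word u. -/
theorem lie_mem_wordSpan (hv : IsWeightVector H (Λ : Dual ℂ H) v)
    (hpos : ∀ α : H.root, b.IsPos α → ∀ x ∈ rootSpace H α.1, ⁅x, v⁆ = 0)
    (x : L) {u : W} (hu : u ∈ wordSpan b v Λ) : ⁅x, u⁆ ∈ wordSpan b v Λ := by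
  have hneg (β : H.root) (hβ : b.IsPos β) (x : L) (hx : x ∈ rootSpace H (-β.1).toLinear)
      {u : W} (hu : u ∈ wordSpan b v Λ) : ⁅x, u⁆ ∈ wordSpan b v Λ :=
    lie_mem_wordSpan_of_forall (fun u μ h ↦ (Word.step β hβ x hx h).mem) hu
  have hcartan (h : H) {u : W} {μ : weightLattice (rootSystem H)} (hu : Word b v Λ u μ) :
      ⁅(h : L), u⁆ ∈ wordSpan b v Λ := by
    rw [hu.isWeightVector hv h]
    exact Submodule.smul_mem _ _ hu.mem
  have key {u : W} {μ : weightLattice (rootSystem H)} (hu : Word b v Λ u μ) :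
      ∀ x : L, ⁅x, u⁆ ∈ wordSpan b v Λ := by
    induction hu with
    | base =>
      refine mem_of_cartan_of_rootSpace (S := (wordSpan b v Λ).comap
        ((toEnd ℂ L W : L →ₗ[ℂ] End ℂ W).flip v)) (fun h ↦ hcartan h .base) fun α x hx ↦ ?_
      change ⁅x, v⁆ ∈ wordSpan b v Λ
      rcases isPos_or_exists_neg b α with hα | ⟨β, hβ, hαβ⟩
      · rw [hpos α hα x hx]; exact zero_mem _
      · rw [hαβ] at hx
        exact hneg β hβ x hx Word.base.mem
    | @step u μ β hβ y hy h ih =>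
      intro x
      rw [leibniz_lie]
      exact add_mem (ih _) (hneg β hβ y hy (ih x))
  exact lie_mem_wordSpan_of_forall (fun u μ h ↦ key h x) hu

theorem span_words_eq_top [LieModule.IsIrreducible ℂ L W] (hv0 : v ≠ 0)
    (hv : IsWeightVector H (Λ : Dual ℂ H) v)
    (hpos : ∀ α : H.root, b.IsPos α → ∀ x ∈ rootSpace H α.1, ⁅x, v⁆ = 0) :
    wordSpan b v Λ = ⊤ := by
  let N : LieSubmodule ℂ L W :=
    { wordSpan b v Λ with lie_mem := fun {x u} hu ↦ lie_mem_wordSpan hv hpos x hu }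
  have : Nontrivial N := (LieSubmodule.nontrivial_iff_ne_bot ℂ L W).2 fun h ↦ hv0 (by
    have : v ∈ N := Word.base.mem
    rw [h] at this
    simpa using this)
  have hN : N = ⊤ := LieSubmodule.eq_top_of_isIrreducible ℂ L W N
  exact congrArg LieSubmodule.toSubmodule hN

/-- A basis of weight vectors, with weights below `Λ` and exactly one vector of weight `Λ`. -/
structure WeightBasis (W : Type*) [AddCommGroup W] [Module ℂ W] [LieRingModule L W]
    [LieModule ℂ L W] (b : (rootSystem H).Base) (Λ : weightLattice (rootSystem H)) (κ : Type*) where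
  /-- The basis. -/
  basis : Basis κ ℂ W
  /-- The weights of the basis vectors. -/
  weight : κ → weightLattice (rootSystem H)
  isWeightVector : ∀ i, IsWeightVector H (weight i : Dual ℂ H) (basis i)
  sub_mem : ∀ i, Λ - weight i ∈ simpleCone b
  existsUnique : ∃! i, weight i = Λ
  lie_eq_zero : ∀ i, weight i = Λ → ∀ α : H.root, b.IsPos α → ∀ x ∈ rootSpace H α.1,
    ⁅x, basis i⁆ = 0

theorem coeff_eq_zero_of_isWeightVector {κ : Type*} [Fintype κ] (B : Basis κ ℂ W)
    {ν : κ → weightLattice (rootSystem H)} (hB : ∀ i, IsWeightVector H (ν i : Dual ℂ H) (B i))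
    {μ : weightLattice (rootSystem H)} {w : W} (hw : IsWeightVector H (μ : Dual ℂ H) w) {i : κ}
    (hi : ν i ≠ μ) : B.repr w i = 0 := by
  by_contra hne
  refine hi (Subtype.ext (LinearMap.ext fun h ↦ ?_))
  have h1 := hw h
  have h2 : ⁅(h : L), w⁆ = ∑ j, (B.repr w j * (ν j : Dual ℂ H) h) • B j := by
    conv_lhs => rw [← B.sum_repr w]
    rw [lie_sum]
    refine Finset.sum_congr rfl fun j _ ↦ ?_
    rw [lie_smul, hB j h, smul_smul]
  have h3 := congrArg (fun u ↦ B.repr u i) (h2.symm.trans h1)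
  simp only [B.repr_sum_self, map_smul, Finsupp.smul_apply, smul_eq_mul] at h3
  rw [mul_comm] at h3
  exact mul_right_cancel₀ hne h3

/-- Words span the irreducible module, so a basis can be chosen among them. The only word of weight
Λ is v, and it must occur, since otherwise all coefficients of v would vanish. -/
theorem HasHighestWeight.exists_weightBasis [LieModule.IsIrreducible ℂ L W]
    [FiniteDimensional ℂ W] (h : HasHighestWeight W b (Λ : Dual ℂ H)) :
    ∃ n, Nonempty (WeightBasis W b Λ (Fin n)) := by
  obtain ⟨v, hv0, hv, hpos⟩ := h
  replace hv : IsWeightVector H (Λ : Dual ℂ H) v := hv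
  have hspan : ⊤ ≤ Submodule.span ℂ {u | ∃ μ, Word b v Λ u μ} :=
    (span_words_eq_top hv0 hv hpos).ge
  have := FiniteDimensional.fintypeBasisIndex (Basis.ofSpan hspan)
  let B := (Basis.ofSpan hspan).reindex (Fintype.equivFin _)
  have hB (i) : ∃ μ, Word b v Λ (B i) μ := by
    rw [Basis.reindex_apply]
    exact Basis.ofSpan_subset hspan ⟨_, rfl⟩
  choose ν hν using hB
  have hw (i) : IsWeightVector H (ν i : Dual ℂ H) (B i) := (hν i).isWeightVector hv
  have hsub (i) : Λ - ν i ∈ simpleCone b := (hν i).sub_mem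
  have hunique : ∃! i, ν i = Λ := by
    obtain ⟨i, hi⟩ : ∃ i, ν i = Λ := by
      by_contra! hne
      refine hv0 (B.ext_elem fun i ↦ ?_)
      rw [coeff_eq_zero_of_isWeightVector B hw hv (hne i)]
      simp
    refine ⟨i, hi, fun j hj ↦ B.injective ?_⟩
    rw [(hν i).eq_of_eq hi, (hν j).eq_of_eq hj]
  let D : WeightBasis W b Λ _ :=
    { basis := B
      weight := ν
      isWeightVector := hw
      sub_mem := hsub
      existsUnique := hunique
      lie_eq_zero := fun i hi ↦ by rw [(hν i).eq_of_eq hi]; exact hpos }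
  exact ⟨_, ⟨D⟩⟩

end HighestWeight

/-! ### Injectivity of powers of f in 𝔰𝔩₂-modules -/

section SlTwo

variable {L : Type*} [LieRing L] [LieAlgebra ℂ L]
variable {W : Type*} [AddCommGroup W] [Module ℂ W] [LieRingModule L W] [LieModule ℂ L W]
variable {h e f : L}

theorem lie_h_pow_f (t : IsSl2Triple h e f) {m : W} {μ : ℂ} (hm : ⁅h, m⁆ = μ • m) (n : ℕ) :
    ⁅h, (toEnd ℂ L W f ^ n) m⁆ = (μ - 2 * n) • (toEnd ℂ L W f ^ n) m := by
  induction n with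
  | zero => simpa using hm
  | succ n ih =>
    rw [pow_succ', Module.End.mul_apply, toEnd_apply_apply, leibniz_lie h, t.lie_lie_smul_f ℂ, ih,
      lie_smul, neg_lie, smul_lie]
    push_cast
    module

/-- The vector m need not be primitive, hence the extra term in ⁅e, m⁆. -/
theorem lie_e_pow_f (t : IsSl2Triple h e f) {m : W} {μ : ℂ} (hm : ⁅h, m⁆ = μ • m) (n : ℕ) :
    ⁅e, (toEnd ℂ L W f ^ (n + 1)) m⁆ = (toEnd ℂ L W f ^ (n + 1)) ⁅e, m⁆ +
      ((n + 1) * (μ - n)) • (toEnd ℂ L W f ^ n) m := by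
  induction n with
  | zero =>
    rw [zero_add, pow_one, toEnd_apply_apply, toEnd_apply_apply, leibniz_lie e, t.lie_e_f, hm]
    simp [add_comm]
  | succ n ih =>
    rw [pow_succ', Module.End.mul_apply, toEnd_apply_apply, leibniz_lie e, t.lie_e_f,
      lie_h_pow_f t hm, ih, lie_add, lie_smul, Module.End.mul_apply, toEnd_apply_apply,
      pow_succ' _ n, Module.End.mul_apply, Module.End.mul_apply, toEnd_apply_apply,
      toEnd_apply_apply]
    push_cast
    module

/-- On weight n the scalar in the commutator of e with f^(n+1) vanishes, so ⁅e, m⁆, of weight n + 2,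
is killed by f^(n+2) and is 0 by induction on r. Then m would be primitive of weight n, and for such
m ≠ 0 the vector f^n m is nonzero. -/
theorem eq_zero_of_pow_f_eq_zero (t : IsSl2Triple h e f) (r : ℕ) :
    ∀ (n : ℕ) (m : W), ⁅h, m⁆ = (n : ℂ) • m →
    (toEnd ℂ L W e ^ r) m = 0 → (toEnd ℂ L W f ^ n) m = 0 → m = 0 := by
  induction r with
  | zero => intro n m _ h _; simpa using h
  | succ r ih =>
    intro n m hm he hf
    have h1 := lie_e_pow_f t hm n
    rw [sub_self, mul_zero, zero_smul, add_zero, pow_succ', Module.End.mul_apply, hf, map_zero,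
      lie_zero] at h1
    have h2 : ⁅e, m⁆ = 0 := by
      refine ih (n + 2) _ ?_ ?_ ?_
      · rw [leibniz_lie, t.lie_h_e_smul ℂ, hm, lie_smul, smul_lie]
        push_cast
        module
      · rwa [pow_succ, Module.End.mul_apply] at he
      · rw [pow_succ', Module.End.mul_apply, pow_succ', ← h1, map_zero]
    by_contra h0
    exact IsSl2Triple.HasPrimitiveVectorWith.pow_toEnd_f_ne_zero_of_eq_nat
      (⟨h0, hm, h2⟩ : t.HasPrimitiveVectorWith m (n : ℂ)) rfl le_rfl hf

end SlTwo

/-! ### Weyl invariance of weight multiplicities -/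

section Multiplicity

variable {L : Type*} [LieRing L] [LieAlgebra ℂ L] [FiniteDimensional ℂ L] [IsKilling ℂ L]
variable {H : LieSubalgebra ℂ L} [H.IsCartanSubalgebra]
variable {W : Type*} [AddCommGroup W] [Module ℂ W] [LieRingModule L W] [LieModule ℂ L W]

theorem IsWeightVector.pow {χ : Dual ℂ H} {x : L} (hx : x ∈ rootSpace H χ) {μ : Dual ℂ H} {w : W}
    (hw : IsWeightVector H μ w) (n : ℕ) :
    IsWeightVector H (μ + n • χ) ((toEnd ℂ L W x ^ n) w) := by
  induction n with
  | zero => simpa using hw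
  | succ n ih =>
    rw [pow_succ', Module.End.mul_apply, add_smul, one_smul, ← add_assoc]
    exact ih.lie hx

theorem IsWeightVector.sum {μ : Dual ℂ H} {κ : Type*} (s : Finset κ) {w : κ → W} (c : κ → ℂ)
    (hw : ∀ i ∈ s, IsWeightVector H μ (w i)) : IsWeightVector H μ (∑ i ∈ s, c i • w i) := by
  intro h
  rw [lie_sum, Finset.smul_sum]
  refine Finset.sum_congr rfl fun i hi ↦ ?_
  rw [lie_smul, hw i hi h, smul_comm]

variable {κ : Type*} [Fintype κ] (B : Basis κ ℂ W) {ν : κ → weightLattice (rootSystem H)}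

theorem eq_zero_of_isWeightVector (hB : ∀ i, IsWeightVector H (ν i : Dual ℂ H) (B i))
    {μ : weightLattice (rootSystem H)} {w : W} (hw : IsWeightVector H (μ : Dual ℂ H) w)
    (h : ∀ i, ν i = μ → B.repr w i = 0) : w = 0 := by
  refine B.ext_elem fun i ↦ ?_
  rw [map_zero, Finsupp.zero_apply]
  by_cases hi : ν i = μ
  · exact h i hi
  · exact coeff_eq_zero_of_isWeightVector B hB hw hi

theorem exists_pow_eq_zero (hB : ∀ i, IsWeightVector H (ν i : Dual ℂ H) (B i)) (α : H.root)
    {x : L} (hx : x ∈ rootSpace H α.1) {μ : weightLattice (rootSystem H)} {w : W}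
    (hw : IsWeightVector H (μ : Dual ℂ H) w) : ∃ r, (toEnd ℂ L W x ^ r) w = 0 := by
  classical
  have hinj : Function.Injective fun r : ℕ ↦ μ + r • rootWeight (rootSystem H) α := by
    intro r s h
    have h1 := congrArg (weightPairing α) (add_left_cancel h)
    simpa using h1
  obtain ⟨_, ⟨r, rfl⟩, hr⟩ := (Set.infinite_range_of_injective hinj).exists_notMem_finset
    (Finset.univ.image ν)
  refine ⟨r, eq_zero_of_isWeightVector B hB (μ := μ + r • rootWeight (rootSystem H) α) ?_
    fun i hi ↦ (hr ?_).elim⟩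
  · exact hw.pow (χ := α.1.toLinear) hx r
  · exact Finset.mem_image.2 ⟨i, Finset.mem_univ i, hi⟩

open Classical in
/-- The multiplicity of a weight in a family of weights. -/
def weightMult (ν : κ → weightLattice (rootSystem H)) (μ : weightLattice (rootSystem H)) : ℕ :=
  Fintype.card {i // ν i = μ}

/-- The operator f^n maps the weight space of μ injectively into that of μ - nα. -/
theorem weightMult_le_of_nonneg (hB : ∀ i, IsWeightVector H (ν i : Dual ℂ H) (B i)) (α : H.root)
    (μ : weightLattice (rootSystem H)) (n : ℕ) (hn : weightPairing α μ = n) :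
    weightMult ν μ ≤ weightMult ν (μ - n • rootWeight (rootSystem H) α) := by
  classical
  have hα : α.1.IsNonZero := H.isNonZero_coe_root α
  obtain ⟨h, e, f, t, he, hf⟩ := exists_isSl2Triple_of_weight_isNonZero hα
  have hh := t.h_eq_coroot hα he hf
  have hf' : f ∈ rootSpace H (-α.1).toLinear := hf
  let u (c : {i // ν i = μ} → ℂ) : W := ∑ i, c i • B i
  have hu (c) : IsWeightVector H (μ : Dual ℂ H) (u c) :=
    IsWeightVector.sum _ _ fun i _ ↦ by
      have := hB i
      rwa [i.2] at this
  have hfu (c) : IsWeightVector H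
      ((μ - n • rootWeight (rootSystem H) α : weightLattice (rootSystem H)) : Dual ℂ H)
      ((toEnd ℂ L W f ^ n) (u c)) := by
    have := (hu c).pow hf' n
    convert this using 1
    rw [Weight.toLinear_neg, smul_neg, ← sub_eq_add_neg]
    rfl
  let F : ({i // ν i = μ} → ℂ) →ₗ[ℂ]
      ({i // ν i = μ - n • rootWeight (rootSystem H) α} → ℂ) :=
    { toFun := fun c j ↦ B.repr ((toEnd ℂ L W f ^ n) (u c)) j
      map_add' := fun c d ↦ by
        ext j
        simp [u, add_smul, Finset.sum_add_distrib]
      map_smul' := fun a c ↦ by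
        ext j
        simp [u, mul_smul, Finset.mul_sum, Finsupp.finsetSum_apply] }
  have hF : Function.Injective F := by
    rw [← LinearMap.ker_eq_bot, LinearMap.ker_eq_bot']
    intro c hc
    have h1 : (toEnd ℂ L W f ^ n) (u c) = 0 :=
      eq_zero_of_isWeightVector B hB (hfu c) fun i hi ↦ congrFun hc ⟨i, hi⟩
    obtain ⟨r, hr⟩ := exists_pow_eq_zero B hB α he (hu c)
    have h2 : ⁅h, u c⁆ = (n : ℂ) • u c := by
      rw [hh, hu c (coroot α.1)]
      congr 1
      have := weightPairing_spec α μ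
      rw [hn] at this
      simpa using this
    have h3 := eq_zero_of_pow_f_eq_zero t r n _ h2 hr h1
    have h4 : LinearIndependent ℂ fun i : {i // ν i = μ} ↦ B i :=
      B.linearIndependent.comp _ Subtype.val_injective
    exact funext fun i ↦ Fintype.linearIndependent_iff.1 h4 c h3 i
  have := LinearMap.finrank_le_finrank_of_injective hF
  simpa [weightMult] using this

theorem weightMult_le (hB : ∀ i, IsWeightVector H (ν i : Dual ℂ H) (B i)) (α : H.root)
    (μ : weightLattice (rootSystem H)) :
    weightMult ν μ ≤ weightMult ν (μ - weightPairing α μ • rootWeight (rootSystem H) α) := by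
  rcases le_total 0 (weightPairing α μ) with h | h
  · obtain ⟨n, hn⟩ := Int.eq_ofNat_of_zero_le h
    rw [hn, natCast_zsmul]
    exact weightMult_le_of_nonneg B hB α μ n hn
  · set β := (rootSystem H).reflectionPerm α α
    have h1 : weightPairing β μ = -weightPairing α μ := weightPairing_reflectionPerm_self α μ
    obtain ⟨n, hn⟩ := Int.eq_ofNat_of_zero_le (neg_nonneg.2 h)
    have h2 : μ - weightPairing α μ • rootWeight (rootSystem H) α =
        μ - n • rootWeight (rootSystem H) β := by
      rw [rootWeight_reflectionPerm_self, ← natCast_zsmul, ← hn]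
      simp
    rw [h2]
    exact weightMult_le_of_nonneg B hB β μ n (h1.trans hn)

/-- Weight multiplicities are invariant under the Weyl group. -/
theorem weightMult_reflection (hB : ∀ i, IsWeightVector H (ν i : Dual ℂ H) (B i)) (α : H.root)
    (μ : weightLattice (rootSystem H)) :
    weightMult ν (μ - weightPairing α μ • rootWeight (rootSystem H) α) = weightMult ν μ := by
  refine le_antisymm ?_ (weightMult_le B hB α μ)
  have := weightMult_le B hB α (μ - weightPairing α μ • rootWeight (rootSystem H) α)
  rwa [map_sub, map_zsmul, weightPairing_rootWeight_self, show μ -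
    weightPairing α μ • rootWeight (rootSystem H) α - (weightPairing α μ - weightPairing α μ • 2) •
    rootWeight (rootSystem H) α = μ by rw [smul_eq_mul]; module] at this

end Multiplicity

/-! ### Invariance of the Casimir operator -/

section Casimir

variable {L : Type*} [LieRing L] [LieAlgebra ℂ L] [FiniteDimensional ℂ L] [IsKilling ℂ L]
variable {W : Type*} [AddCommGroup W] [Module ℂ W] [LieRingModule L W] [LieModule ℂ L W]

theorem eq_of_killingForm_eq {x y : L} (h : ∀ z, killingForm ℂ L z x = killingForm ℂ L z y) :
    x = y := by
  rw [← sub_eq_zero, ← Submodule.mem_bot (R := ℂ), ← ker_killingForm_eq_bot ℂ L,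
    LinearMap.mem_ker]
  ext z
  rw [map_sub, LinearMap.sub_apply, LieModule.traceForm_comm ℂ L L x,
    LieModule.traceForm_comm ℂ L L y, LinearMap.zero_apply, sub_eq_zero]
  exact h z

/-- The families are dual for the Killing form. Expanding the brackets in them, the two commutator
sums cancel termwise by invariance of the form. -/
theorem lie_sum_lie_lie {κ : Type*} [Fintype κ] {x y : κ → L}
    (hres : ∀ z, z = ∑ a, killingForm ℂ L (y a) z • x a) (z : L) (w : W) :
    ⁅z, ∑ a, ⁅x a, ⁅y a, w⁆⁆⁆ = ∑ a, ⁅x a, ⁅y a, ⁅z, w⁆⁆⁆ := by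
  have hres' (z : L) : z = ∑ a, killingForm ℂ L (x a) z • y a := by
    refine eq_of_killingForm_eq fun u ↦ ?_
    conv_lhs => rw [hres u]
    simp only [map_sum, map_smul, LinearMap.sum_apply, LinearMap.smul_apply, smul_eq_mul]
    refine Finset.sum_congr rfl fun a _ ↦ ?_
    rw [mul_comm, LieModule.traceForm_comm ℂ L L u]
  have h1 (a : κ) : ⁅z, ⁅x a, ⁅y a, w⁆⁆⁆ =
      ⁅⁅z, x a⁆, ⁅y a, w⁆⁆ + ⁅x a, ⁅⁅z, y a⁆, w⁆⁆ + ⁅x a, ⁅y a, ⁅z, w⁆⁆⁆ := by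
    rw [leibniz_lie z (x a), leibniz_lie z (y a), lie_add, add_assoc]
  rw [lie_sum, Finset.sum_congr rfl fun a _ ↦ h1 a, Finset.sum_add_distrib,
    Finset.sum_add_distrib]
  suffices h : ∑ a, ⁅⁅z, x a⁆, ⁅y a, w⁆⁆ + ∑ a, ⁅x a, ⁅⁅z, y a⁆, w⁆⁆ = 0 by rw [h, zero_add]
  have h2 : ∑ a, ⁅⁅z, x a⁆, ⁅y a, w⁆⁆ =
      ∑ a, ∑ c, killingForm ℂ L (y c) ⁅z, x a⁆ • ⁅x c, ⁅y a, w⁆⁆ := by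
    refine Finset.sum_congr rfl fun a _ ↦ ?_
    conv_lhs => rw [hres ⁅z, x a⁆]
    simp only [sum_lie, smul_lie]
  have h3 : ∑ a, ⁅x a, ⁅⁅z, y a⁆, w⁆⁆ =
      ∑ a, ∑ c, killingForm ℂ L (x c) ⁅z, y a⁆ • ⁅x a, ⁅y c, w⁆⁆ := by
    refine Finset.sum_congr rfl fun a _ ↦ ?_
    conv_lhs => rw [hres' ⁅z, y a⁆]
    simp only [sum_lie, smul_lie, lie_sum, lie_smul]
  rw [h2, h3, Finset.sum_comm, ← Finset.sum_add_distrib]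
  refine Finset.sum_eq_zero fun a _ ↦ ?_
  rw [← Finset.sum_add_distrib]
  refine Finset.sum_eq_zero fun c _ ↦ ?_
  have h4 : killingForm ℂ L (x c) ⁅z, y a⁆ = -killingForm ℂ L (y a) ⁅z, x c⁆ := by
    refine (LieModule.traceForm_apply_lie_apply ℂ L L (x c) z (y a)).symm.trans ?_
    rw [← lie_skew, map_neg, LinearMap.neg_apply, LieModule.traceForm_comm]
  rw [← add_smul, h4, add_neg_cancel, zero_smul]

end Casimir

/-! ### Root vectors, dual bases and the Casimir scalar -/

section RootVectors

variable {L : Type*} [LieRing L] [LieAlgebra ℂ L] [FiniteDimensional ℂ L] [IsKilling ℂ L]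
variable {H : LieSubalgebra ℂ L} [H.IsCartanSubalgebra]
variable {W : Type*} [AddCommGroup W] [Module ℂ W] [LieRingModule L W] [LieModule ℂ L W]

theorem exists_rootVectors (α : H.root) : ∃ p : L × L, p.1 ∈ rootSpace H α.1.toLinear ∧
    p.2 ∈ rootSpace H (-α.1).toLinear ∧ killingForm ℂ L p.1 p.2 = 1 := by
  obtain ⟨e, he, he₀⟩ := α.1.exists_ne_zero
  obtain ⟨f, hf, hef⟩ : ∃ f ∈ rootSpace H (-α.1), killingForm ℂ L e f ≠ 0 := by
    contrapose! he₀
    simpa using mem_ker_killingForm_of_mem_rootSpace_of_forall_rootSpace_neg ℂ L H he he₀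
  exact ⟨(e, (killingForm ℂ L e f)⁻¹ • f), he, Submodule.smul_mem _ _ hf, by simp [hef]⟩

/-- A root vector. -/
def rootVector (α : H.root) : L := (exists_rootVectors α).choose.1

/-- The vector in the opposite root space dual to the root vector. -/
def dualRootVector (α : H.root) : L := (exists_rootVectors α).choose.2

theorem rootVector_mem (α : H.root) : rootVector α ∈ rootSpace H α.1.toLinear :=
  (exists_rootVectors α).choose_spec.1

theorem dualRootVector_mem (α : H.root) : dualRootVector α ∈ rootSpace H (-α.1).toLinear :=
  (exists_rootVectors α).choose_spec.2.1

theorem killingForm_rootVector (α : H.root) :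
    killingForm ℂ L (rootVector α) (dualRootVector α) = 1 :=
  (exists_rootVectors α).choose_spec.2.2

theorem lie_rootVector (α : H.root) : ⁅rootVector α, dualRootVector α⁆ =
    ((cartanEquivDual H).symm α.1.toLinear : L) := by
  have := lie_eq_killingForm_smul_of_mem_rootSpace_of_mem_rootSpace_neg (rootVector_mem α)
    (dualRootVector_mem α)
  rwa [killingForm_rootVector, one_smul] at this

theorem eq_killingForm_smul_rootVector (α : H.root) {y : L} (hy : y ∈ rootSpace H α.1.toLinear) :
    y = killingForm ℂ L (dualRootVector α) y • rootVector α := by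
  have h0 : (⟨rootVector α, rootVector_mem α⟩ : rootSpace H α.1.toLinear) ≠ 0 := fun h ↦ by
    have h1 := killingForm_rootVector α
    rw [show rootVector α = 0 from congrArg Subtype.val h] at h1
    simp at h1
  obtain ⟨c, hc⟩ := (finrank_eq_one_iff_of_nonzero' _ h0).1
    (finrank_rootSpace_eq_one α.1 (H.isNonZero_coe_root α)) ⟨y, hy⟩
  replace hc : c • rootVector α = y := congrArg Subtype.val hc
  rw [← hc, map_smul, LieModule.traceForm_comm ℂ L L (dualRootVector α), killingForm_rootVector]
  simp

theorem eq_killingForm_smul_dualRootVector (α : H.root) {y : L}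
    (hy : y ∈ rootSpace H (-α.1).toLinear) :
    y = killingForm ℂ L (rootVector α) y • dualRootVector α := by
  have h0 : (⟨dualRootVector α, dualRootVector_mem α⟩ : rootSpace H (-α.1).toLinear) ≠ 0 :=
    fun h ↦ by
      have h1 := killingForm_rootVector α
      rw [show dualRootVector α = 0 from congrArg Subtype.val h] at h1
      simp at h1
  obtain ⟨c, hc⟩ := (finrank_eq_one_iff_of_nonzero' _ h0).1
    (finrank_rootSpace_eq_one (-α.1) (H.isNonZero_coe_root α).neg) ⟨y, hy⟩
  replace hc : c • dualRootVector α = y := congrArg Subtype.val hc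
  rw [← hc, map_smul, killingForm_rootVector]
  simp

variable (H) in
/-- A basis of the Cartan subalgebra. -/
def cartanBasis : Basis (Fin (finrank ℂ H)) ℂ H := finBasis ℂ H

variable (H) in
/-- The basis of the Cartan subalgebra dual to `cartanBasis` for the Killing form. -/
def cartanDualVector (i : Fin (finrank ℂ H)) : H :=
  (cartanEquivDual H).symm ((cartanBasis H).coord i)

theorem killingForm_cartanEquivDual_symm (φ : Dual ℂ H) (h : H) :
    killingForm ℂ L ((cartanEquivDual H).symm φ : L) (h : L) = φ h := by
  have := LinearMap.congr_fun ((cartanEquivDual H).apply_symm_apply φ) h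
  rw [cartanEquivDual_apply_apply] at this
  exact this

theorem coe_mem_rootSpace_zero (h : H) : (h : L) ∈ rootSpace H (0 : H → ℂ) := by
  rw [rootSpace_zero_eq]
  exact h.2

theorem killingForm_eq_zero {φ ψ : Dual ℂ H} {x y : L} (hx : x ∈ rootSpace H φ)
    (hy : y ∈ rootSpace H ψ) (h : φ + ψ ≠ 0) : killingForm ℂ L x y = 0 :=
  killingForm_apply_eq_zero_of_mem_rootSpace_of_add_ne_zero ℂ L H hx hy fun h' ↦
    h (DFunLike.coe_injective h')

theorem add_ne_zero_of_isPos {b : (rootSystem H).Base} {α β : H.root} (hα : b.IsPos α)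
    (hβ : b.IsPos β) : α.1.toLinear + β.1.toLinear ≠ 0 := by
  intro h
  refine rootWeight_ne_zero (P := rootSystem H) α (simpleCone_antisymm b
    (rootWeight_mem_simpleCone b hα) ?_)
  have : -rootWeight (rootSystem H) α = rootWeight (rootSystem H) β :=
    Subtype.ext (neg_eq_of_add_eq_zero_right h)
  rw [this]
  exact rootWeight_mem_simpleCone b hβ

theorem toLinear_ne_zero (α : H.root) : α.1.toLinear ≠ 0 := by
  intro h
  exact rootWeight_ne_zero (P := rootSystem H) α (Subtype.ext h)

theorem toLinear_injective {α β : H.root} (h : α.1.toLinear = β.1.toLinear) : α = β :=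
  (rootSystem H).root.injective h

/-- The dual bases for the Killing form adapted to the root space decomposition. -/
theorem eq_sum_killingForm (b : (rootSystem H).Base) (y : L) :
    y = ∑ i, killingForm ℂ L (cartanDualVector H i : L) y • (cartanBasis H i : L) +
      ∑ α ∈ positiveRoots b, (killingForm ℂ L (dualRootVector α) y • rootVector α +
        killingForm ℂ L (rootVector α) y • dualRootVector α) := by
  classical
  let F : L →ₗ[ℂ] L :=
    ∑ i, (killingForm ℂ L (cartanDualVector H i : L)).smulRight (cartanBasis H i : L) +
      ∑ α ∈ positiveRoots b, ((killingForm ℂ L (dualRootVector α)).smulRight (rootVector α) +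
        (killingForm ℂ L (rootVector α)).smulRight (dualRootVector α))
  have hF (y : L) : F y =
      ∑ i, killingForm ℂ L (cartanDualVector H i : L) y • (cartanBasis H i : L) +
      ∑ α ∈ positiveRoots b, (killingForm ℂ L (dualRootVector α) y • rootVector α +
        killingForm ℂ L (rootVector α) y • dualRootVector α) := by
    simp [F, LinearMap.sum_apply]
  rw [← hF]
  refine mem_of_cartan_of_rootSpace (H := H) (S := LinearMap.eqLocus LinearMap.id F) ?_ ?_ y
  · intro h
    change (h : L) = F h
    have h0 : (h : L) ∈ rootSpace H (0 : Dual ℂ H) := coe_mem_rootSpace_zero h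
    rw [hF, Finset.sum_eq_zero (s := positiveRoots b), add_zero]
    · conv_lhs => rw [← (cartanBasis H).sum_repr h]
      simp only [cartanDualVector, killingForm_cartanEquivDual_symm, Basis.coord_apply]
      push_cast
      rfl
    · intro α _
      rw [killingForm_eq_zero (rootVector_mem α) h0 (by simp [toLinear_ne_zero α]),
        killingForm_eq_zero (dualRootVector_mem α) h0 (by simp [toLinear_ne_zero α])]
      simp
  · intro β y hy
    change y = F y
    have hcart (χ : Dual ℂ H) (hχ : χ ≠ 0) (hy : y ∈ rootSpace H χ) (i) :
        killingForm ℂ L (cartanDualVector H i : L) y • (cartanBasis H i : L) = 0 := by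
      rw [killingForm_eq_zero (φ := 0) (coe_mem_rootSpace_zero _) hy (by simpa using hχ), zero_smul]
    rcases isPos_or_exists_neg b β with hβ | ⟨γ, hγ, hβγ⟩
    · replace hy : y ∈ rootSpace H β.1.toLinear := hy
      rw [hF, Finset.sum_eq_zero fun i _ ↦ hcart _ (toLinear_ne_zero β) hy i, zero_add,
        Finset.sum_eq_single_of_mem β ((mem_positiveRoots b).2 hβ)]
      · rw [killingForm_eq_zero (rootVector_mem β) hy (add_ne_zero_of_isPos hβ hβ), zero_smul,
          add_zero]
        exact eq_killingForm_smul_rootVector β hy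
      · intro α hα hαβ
        rw [killingForm_eq_zero (rootVector_mem α) hy
          (add_ne_zero_of_isPos ((mem_positiveRoots b).1 hα) hβ),
          killingForm_eq_zero (dualRootVector_mem α) hy, zero_smul, zero_smul, add_zero]
        rw [Weight.toLinear_neg, neg_add_eq_sub, sub_ne_zero]
        exact fun h ↦ hαβ (toLinear_injective h).symm
    · rw [hβγ] at hy
      rw [hF, Finset.sum_eq_zero fun i _ ↦ hcart _ (by simp [toLinear_ne_zero γ]) hy i,
        zero_add, Finset.sum_eq_single_of_mem γ ((mem_positiveRoots b).2 hγ)]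
      · rw [killingForm_eq_zero (dualRootVector_mem γ) hy
          (by
            have := add_ne_zero_of_isPos hγ hγ
            rw [Weight.toLinear_neg, ← neg_add]
            exact neg_ne_zero.2 this), zero_smul, zero_add]
        exact eq_killingForm_smul_dualRootVector γ hy
      · intro α hα hαβ
        rw [killingForm_eq_zero (dualRootVector_mem α) hy
          (by
            have := add_ne_zero_of_isPos ((mem_positiveRoots b).1 hα) hγ
            rw [Weight.toLinear_neg, Weight.toLinear_neg, ← neg_add]
            exact neg_ne_zero.2 this),
          killingForm_eq_zero (rootVector_mem α) hy, zero_smul, zero_smul, add_zero]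
        rw [Weight.toLinear_neg, ← sub_eq_add_neg, sub_ne_zero]
        exact fun h ↦ hαβ (toLinear_injective h)

/-- The Killing form on weights. -/
def cartanForm (μ ν : Dual ℂ H) : ℂ := μ ((cartanEquivDual H).symm ν)

theorem sum_cartanBasis (μ ν : Dual ℂ H) :
    ∑ i, μ (cartanBasis H i) * ν (cartanDualVector H i) = cartanForm ν μ := by
  rw [cartanForm]
  conv_rhs => rw [← (cartanBasis H).sum_dual_apply_smul_coord μ]
  rw [map_sum, map_sum]
  simp [cartanDualVector]

variable (W) in
/-- The Casimir operator. -/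
def casimir (b : (rootSystem H).Base) : End ℂ W :=
  ∑ i, toEnd ℂ L W (cartanBasis H i : L) * toEnd ℂ L W (cartanDualVector H i : L) +
    ∑ α ∈ positiveRoots b, (toEnd ℂ L W (rootVector α) * toEnd ℂ L W (dualRootVector α) +
      toEnd ℂ L W (dualRootVector α) * toEnd ℂ L W (rootVector α))

theorem casimir_apply (b : (rootSystem H).Base) (w : W) : casimir W b w =
    ∑ i, ⁅(cartanBasis H i : L), ⁅(cartanDualVector H i : L), w⁆⁆ +
      ∑ α ∈ positiveRoots b, (⁅rootVector α, ⁅dualRootVector α, w⁆⁆ +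
        ⁅dualRootVector α, ⁅rootVector α, w⁆⁆) := by
  simp [casimir, LinearMap.sum_apply]

theorem lie_casimir (b : (rootSystem H).Base) (z : L) (w : W) :
    ⁅z, casimir W b w⁆ = casimir W b ⁅z, w⁆ := by
  have h := lie_sum_lie_lie (W := W) (L := L)
    (x := Sum.elim (fun i ↦ (cartanBasis H i : L)) (Sum.elim
      (fun α : positiveRoots b ↦ rootVector α.1) (fun α : positiveRoots b ↦ dualRootVector α.1)))
    (y := Sum.elim (fun i ↦ (cartanDualVector H i : L)) (Sum.elim
      (fun α : positiveRoots b ↦ dualRootVector α.1) (fun α : positiveRoots b ↦ rootVector α.1)))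
    (fun z ↦ by
      conv_lhs => rw [eq_sum_killingForm b z]
      simp only [Fintype.sum_sum_type, Sum.elim_inl, Sum.elim_inr, Finset.sum_add_distrib]
      rw [← Finset.sum_coe_sort (positiveRoots b), ← Finset.sum_coe_sort (positiveRoots b)]) z w
  simp only [Fintype.sum_sum_type, Sum.elim_inl, Sum.elim_inr] at h
  rw [casimir_apply, casimir_apply]
  simp only [Finset.sum_add_distrib]
  rw [← Finset.sum_coe_sort (positiveRoots b), ← Finset.sum_coe_sort (positiveRoots b), h,
    ← Finset.sum_coe_sort (positiveRoots b), ← Finset.sum_coe_sort (positiveRoots b)]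

theorem IsWeightVector.sum_cartan {μ : Dual ℂ H} {w : W} (hw : IsWeightVector H μ w) :
    ∑ i, ⁅(cartanBasis H i : L), ⁅(cartanDualVector H i : L), w⁆⁆ = cartanForm μ μ • w := by
  rw [← sum_cartanBasis, Finset.sum_smul]
  refine Finset.sum_congr rfl fun i _ ↦ ?_
  rw [hw, lie_smul, hw, smul_smul, mul_comm]

/-- The eigenspace is a submodule, and it contains the highest weight vector v: positive root
vectors kill v, so ⁅e, ⁅f, v⁆⁆ = ⁅⁅e, f⁆, v⁆ is a scalar multiple of v for each positive root.
Irreducibility gives all of W. -/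
theorem WeightBasis.casimir_apply [LieModule.IsIrreducible ℂ L W] {b : (rootSystem H).Base}
    {Λ : weightLattice (rootSystem H)} {κ : Type*} (D : WeightBasis W b Λ κ) (w : W) :
    casimir W b w = (cartanForm (Λ : Dual ℂ H) Λ +
      ∑ α ∈ positiveRoots b, cartanForm (Λ : Dual ℂ H) α.1.toLinear) • w := by
  set c := cartanForm (Λ : Dual ℂ H) Λ +
      ∑ α ∈ positiveRoots b, cartanForm (Λ : Dual ℂ H) α.1.toLinear with hc
  let N : LieSubmodule ℂ L W :=
    { LinearMap.eqLocus (casimir W b) (c • LinearMap.id) with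
      lie_mem := fun {x u} hu ↦ by
        change casimir W b ⁅x, u⁆ = c • ⁅x, u⁆
        replace hu : casimir W b u = c • u := hu
        rw [← lie_casimir, hu, lie_smul] }
  obtain ⟨i, hi, -⟩ := D.existsUnique
  have hmem : D.basis i ∈ N := by
    change casimir W b (D.basis i) = c • D.basis i
    have hw := D.isWeightVector i
    rw [hi] at hw
    rw [OrbitVerlinde.casimir_apply, hw.sum_cartan, hc, add_smul, Finset.sum_smul]
    congr 1
    refine Finset.sum_congr rfl fun α hα ↦ ?_
    rw [D.lie_eq_zero i hi α ((mem_positiveRoots b).1 hα) _ (rootVector_mem α), lie_zero,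
      add_zero, leibniz_lie, lie_rootVector, hw,
      D.lie_eq_zero i hi α ((mem_positiveRoots b).1 hα) _ (rootVector_mem α), lie_zero, add_zero,
      cartanForm]
  have : Nontrivial N := (LieSubmodule.nontrivial_iff_ne_bot ℂ L W).2 fun h ↦ by
    rw [h] at hmem
    exact D.basis.ne_zero i (by simpa using hmem)
  have hN : N = ⊤ := LieSubmodule.eq_top_of_isIrreducible ℂ L W N
  have : w ∈ N := by rw [hN]; trivial
  exact this

end RootVectors

/-! ### The Laplace operator on the group algebra -/

section GroupAlgebra

open AddMonoidAlgebra

variable {G : Type*} [AddCommGroup G]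

/-- The operator on the group algebra multiplying `e^x` by `φ x`. -/
def diagonal (φ : G → ℂ) : AddMonoidAlgebra ℂ G →ₗ[ℂ] AddMonoidAlgebra ℂ G where
  toFun f := .ofCoeff (Finsupp.onFinset f.coeff.support (fun x ↦ φ x * f.coeff x) fun x hx ↦ by
    rw [Finsupp.mem_support_iff]
    exact right_ne_zero_of_mul hx)
  map_add' f g := by ext x; simp [mul_add]
  map_smul' a f := by ext x; simp [mul_left_comm]

@[simp]
theorem coeff_diagonal (φ : G → ℂ) (f : AddMonoidAlgebra ℂ G) (x : G) :
    (diagonal φ f).coeff x = φ x * f.coeff x := by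
  simp [diagonal]

@[simp]
theorem diagonal_single (φ : G → ℂ) (x : G) (a : ℂ) :
    diagonal φ (single x a) = single x (φ x * a) := by
  classical
  ext y
  by_cases h : x = y <;> simp [h]

theorem diagonal_add_fun (φ ψ : G → ℂ) (f : AddMonoidAlgebra ℂ G) :
    diagonal (fun x ↦ φ x + ψ x) f = diagonal φ f + diagonal ψ f := by
  ext x; simp [add_mul]

variable (B : G →+ G →+ ℂ)

/-- The failure of the Leibniz rule for the second order operator attached to a form. -/
def crossTerm (f g : AddMonoidAlgebra ℂ G) : AddMonoidAlgebra ℂ G :=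
  diagonal (fun x ↦ B x x) (f * g) - diagonal (fun x ↦ B x x) f * g -
    f * diagonal (fun x ↦ B x x) g

theorem crossTerm_add_left (f f' g : AddMonoidAlgebra ℂ G) :
    crossTerm B (f + f') g = crossTerm B f g + crossTerm B f' g := by
  simp only [crossTerm, add_mul, map_add]; ring

theorem crossTerm_add_right (f g g' : AddMonoidAlgebra ℂ G) :
    crossTerm B f (g + g') = crossTerm B f g + crossTerm B f g' := by
  simp only [crossTerm, mul_add, map_add]; ring

variable {B}

theorem crossTerm_single_single (hB : ∀ x y, B x y = B y x) (x y : G) (a c : ℂ) :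
    crossTerm B (single x a) (single y c) = single (x + y) (2 * B x y * (a * c)) := by
  simp only [crossTerm, single_mul_single, diagonal_single, map_add, AddMonoidHom.add_apply,
    ← single_sub, hB y x]
  congr 1
  ring

theorem crossTerm_single (hB : ∀ x y, B x y = B y x) (x : G) (a : ℂ) (g : AddMonoidAlgebra ℂ G) :
    crossTerm B (single x a) g = single x (2 * a) * diagonal (B x) g := by
  induction g using AddMonoidAlgebra.induction_linear with
  | zero => simp [crossTerm]
  | add g g' h h' => rw [crossTerm_add_right, h, h', map_add, mul_add]
  | single y c =>
    rw [crossTerm_single_single hB, diagonal_single, single_mul_single]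
    congr 1
    ring

/-- The cross term of a second order operator is a derivation in each argument; on exponentials this
is bilinearity of B. -/
theorem crossTerm_mul_left (hB : ∀ x y, B x y = B y x) (f g h : AddMonoidAlgebra ℂ G) :
    crossTerm B (f * g) h = f * crossTerm B g h + g * crossTerm B f h := by
  induction f using AddMonoidAlgebra.induction_linear with
  | zero => simp [crossTerm]
  | add f f' h h' => rw [add_mul, crossTerm_add_left, h, h', crossTerm_add_left]; ring
  | single x a =>
    induction g using AddMonoidAlgebra.induction_linear with
    | zero => simp [crossTerm]
    | add g g' h h' => rw [mul_add, crossTerm_add_left, h, h', crossTerm_add_left]; ring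
    | single y c =>
      simp only [single_mul_single, crossTerm_single hB, ← mul_assoc]
      have : diagonal (B (x + y)) h = diagonal (B x) h + diagonal (B y) h := by
        rw [← diagonal_add_fun, map_add]; rfl
      rw [this, mul_add, add_comm]
      congr 3
      · ring
      · rw [add_comm]
      · ring

theorem crossTerm_one (g : AddMonoidAlgebra ℂ G) : crossTerm B 1 g = 0 := by
  have : diagonal (fun x ↦ B x x) (1 : AddMonoidAlgebra ℂ G) = 0 := by
    rw [one_def, diagonal_single]; simp
  rw [crossTerm, this]
  simp

variable {ι : Type*} {s : Finset ι} {a : ι → G} {ρ : G} {χ : AddMonoidAlgebra ℂ G}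
  {T : ι → AddMonoidAlgebra ℂ G}

/-- The derivation rule applied to the product. In the term for i, the hypothesis on T i restores
the factor 1 - e^(-aᵢ) that was differentiated away. -/
theorem crossTerm_prod (hB : ∀ x y, B x y = B y x)
    (hT : ∀ i ∈ s, (1 - single (-a i) 1) * T i = diagonal (B (a i)) χ) :
    crossTerm B (∏ i ∈ s, (1 - single (-a i) 1)) χ =
      2 * (∏ i ∈ s, (1 - single (-a i) 1)) * ∑ i ∈ s, single (-a i) 1 * T i := by
  classical
  induction s using Finset.induction_on with
  | empty => simp [crossTerm_one]
  | insert i s hi ih =>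
    rw [Finset.prod_insert hi, crossTerm_mul_left hB, Finset.sum_insert hi,
      ih fun j hj ↦ hT j (Finset.mem_insert_of_mem hj)]
    have h1 : crossTerm B (1 - single (-a i) 1) χ =
        2 * single (-a i) 1 * ((1 - single (-a i) 1) * T i) := by
      have h2 : (1 - single (-a i) 1 : AddMonoidAlgebra ℂ G) = 1 + single (-a i) (-1) := by
        rw [single_neg, sub_eq_add_neg]
      rw [hT i (Finset.mem_insert_self i s), h2, crossTerm_add_left, crossTerm_one,
        crossTerm_single hB, zero_add]
      have h3 : diagonal (B (-a i)) χ = -diagonal (B (a i)) χ := by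
        ext x; simp
      rw [h3, show (2 * -1 : ℂ) = -(1 + 1) by ring, single_neg, single_add]
      ring
    rw [h1]
    ring

/-- If an element `χ` satisfies the trace identities coming from a Casimir operator, then its
product with the Weyl denominator is an eigenvector of the Laplace operator. -/
theorem diagonal_denominator_mul (hB : ∀ x y, B x y = B y x) (hρ : 2 • ρ = ∑ i ∈ s, a i)
    (hT : ∀ i ∈ s, (1 - single (-a i) 1) * T i = diagonal (B (a i)) χ) {c : ℂ}
    (hc : diagonal (fun x ↦ B x x) χ + ∑ i ∈ s, (1 + single (-a i) 1) * T i = c • χ)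
    {J : AddMonoidAlgebra ℂ G} (hJ : J = single ρ 1 * ∏ i ∈ s, (1 - single (-a i) 1))
    (hJ' : diagonal (fun x ↦ B x x) J = B ρ ρ • J) :
    diagonal (fun x ↦ B x x) (J * χ) = (B ρ ρ + c) • (J * χ) := by
  have h1 : diagonal (fun x ↦ B x x) (J * χ) = crossTerm B J χ +
      diagonal (fun x ↦ B x x) J * χ + J * diagonal (fun x ↦ B x x) χ := by
    rw [crossTerm]; ring
  have h2 : 2 * diagonal (B ρ) χ = ∑ i ∈ s, (1 - single (-a i) 1) * T i := by
    rw [Finset.sum_congr rfl hT]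
    ext x
    have h3 := congrArg (fun y ↦ B y x) hρ
    simp only [map_nsmul, map_sum, AddMonoidHom.finsetSum_apply, AddMonoidHom.smul_apply] at h3
    rw [two_mul]
    simp only [coeff_add, coeff_sum, Finsupp.add_apply, Finsupp.finsetSum_apply, coeff_diagonal,
      ← Finset.sum_mul, ← h3]
    ring
  -- The factor e^ρ contributes twice the derivative of χ along ρ, which `h2` rewrites through the T
  -- i; with the part from the product this makes exactly the Casimir sum.
  have h3 : crossTerm B J χ = J * ∑ i ∈ s, (1 + single (-a i) 1) * T i := by
    rw [hJ, crossTerm_mul_left hB, crossTerm_prod hB hT, crossTerm_single hB]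
    have h4 : (single ρ (2 * 1) : AddMonoidAlgebra ℂ G) = 2 * single ρ 1 := by
      rw [mul_one, ← one_add_one_eq_two, single_add]; ring
    have h5 : ∑ i ∈ s, (1 + single (-a i) 1) * T i =
        2 * diagonal (B ρ) χ + 2 * ∑ i ∈ s, single (-a i) 1 * T i := by
      rw [h2, Finset.mul_sum, ← Finset.sum_add_distrib]
      exact Finset.sum_congr rfl fun i _ ↦ by ring
    rw [h4, h5]
    ring
  rw [h1, h3, hJ', eq_sub_of_add_eq hc, add_smul, smul_mul_assoc, mul_sub, mul_smul_comm]
  abel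

end GroupAlgebra

/-! ### Alternating elements and the Weyl denominator -/

section Alternating

open AddMonoidAlgebra

variable {ι M N : Type*} [AddCommGroup M] [Module ℂ M] [AddCommGroup N] [Module ℂ N]
variable {P : RootPairing ι ℂ M N} [P.IsCrystallographic] [P.IsRootSystem] [Fintype ι]

/-- The sign of an element of the Weyl group. -/
def weylSign (w : P.weylGroup) : ℂ :=
  LinearMap.det (RootPairing.Equiv.weightHom P w : M →ₗ[ℂ] M)

theorem weylSign_one : weylSign (1 : P.weylGroup) = 1 := by
  have : ((RootPairing.Equiv.weightHom P (1 : P.weylGroup) : M ≃ₗ[ℂ] M) : M →ₗ[ℂ] M) =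
      LinearMap.id := by
    rw [OneMemClass.coe_one, map_one]
    rfl
  rw [weylSign, this, LinearMap.det_id]

theorem weylSign_mul (v w : P.weylGroup) : weylSign (v * w) = weylSign v * weylSign w := by
  have : ((RootPairing.Equiv.weightHom P (v * w : P.weylGroup) : M ≃ₗ[ℂ] M) : M →ₗ[ℂ] M) =
      (RootPairing.Equiv.weightHom P v : M →ₗ[ℂ] M) ∘ₗ
        (RootPairing.Equiv.weightHom P w : M →ₗ[ℂ] M) := by
    rw [Subgroup.coe_mul, map_mul]
    rfl
  rw [weylSign, this, LinearMap.det_comp]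
  rfl

theorem weylSign_ofIdx (b : P.Base) (i : ι) :
    weylSign (RootPairing.weylGroup.ofIdx P i) = -1 := by
  have : Module.Finite ℂ M := Module.Finite.of_basis b.toWeightBasis
  have h : (RootPairing.Equiv.weightHom P (RootPairing.weylGroup.ofIdx P i) : M →ₗ[ℂ] M) =
      LinearMap.transvection (-(P.coroot' i)) (P.root i) := by
    ext x
    change P.reflection i x = _
    rw [P.reflection_apply, LinearMap.transvection.apply]
    simp [sub_eq_add_neg]
  rw [weylSign, h, LinearMap.transvection.det]
  simp
  norm_num

theorem weylSign_sq [P.IsReduced] (b : P.Base) (w : P.weylGroup) : weylSign w * weylSign w = 1 := by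
  refine weylGroup_induction_simple b (p := fun w ↦ weylSign w * weylSign w = 1) (fun i _ ↦ ?_) ?_
    (fun v w hv hw ↦ ?_) w
  · rw [weylSign_ofIdx b]; norm_num
  · simp [weylSign_one]
  · rw [weylSign_mul, mul_mul_mul_comm, hv, hw, one_mul]

variable (b : P.Base)

/-- The coefficients of `F` change sign under simple reflections. -/
def IsAlternating (F : AddMonoidAlgebra ℂ (weightLattice P)) : Prop :=
  ∀ j ∈ b.support, ∀ μ,
    F.coeff (weylWeight P (RootPairing.weylGroup.ofIdx P j) μ) = -F.coeff μ

/-- The leading term of `F` is `e^Λ`, and all other terms are lower. -/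
def IsMonicBelow (Λ : weightLattice P) (F : AddMonoidAlgebra ℂ (weightLattice P)) : Prop :=
  F.coeff Λ = 1 ∧ ∀ μ, F.coeff μ ≠ 0 → Λ - μ ∈ simpleCone b

variable {b}

theorem IsAlternating.coeff_weylWeight [P.IsReduced]
    {F : AddMonoidAlgebra ℂ (weightLattice P)} (hF : IsAlternating b F) (w : P.weylGroup)
    (μ : weightLattice P) : F.coeff (weylWeight P w μ) = weylSign w * F.coeff μ := by
  refine weylGroup_induction_simple b (p := fun w ↦ ∀ μ,
    F.coeff (weylWeight P w μ) = weylSign w * F.coeff μ) (fun i hi μ ↦ ?_) (fun μ ↦ ?_)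
    (fun v w hv hw μ ↦ ?_) w μ
  · rw [hF i hi, weylSign_ofIdx b]; ring
  · rw [weylWeight_one, weylSign_one, one_mul]
  · rw [weylWeight_mul, hv, hw, weylSign_mul, mul_assoc]

/-- A dominant conjugate with a zero coordinate is fixed by a simple reflection, so its coefficient
equals its own negative. -/
theorem IsAlternating.exists_weylWeight [P.IsReduced]
    {F : AddMonoidAlgebra ℂ (weightLattice P)} (hF : IsAlternating b F) {μ : weightLattice P}
    (hμ : F.coeff μ ≠ 0) : ∃ w : P.weylGroup, F.coeff (weylWeight P w μ) ≠ 0 ∧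
      ∀ j ∈ b.support, 0 < weightPairing j (weylWeight P w μ) := by
  obtain ⟨w, hw⟩ := exists_weylWeight_isDominant b μ
  have h0 : F.coeff (weylWeight P w μ) ≠ 0 := by
    rw [hF.coeff_weylWeight]
    exact mul_ne_zero (left_ne_zero_of_mul_eq_one (weylSign_sq b w)) hμ
  refine ⟨w, h0, fun j hj ↦ lt_of_le_of_ne (hw ⟨j, hj⟩) fun h ↦ h0 ?_⟩
  have h1 := hF j hj (weylWeight P w μ)
  rw [weylWeight_ofIdx, ← h, zero_smul, sub_zero] at h1
  linear_combination (1 / 2) * h1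

theorem IsAlternating.eq_sum [P.IsReduced] [Fintype P.weylGroup]
    {F : AddMonoidAlgebra ℂ (weightLattice P)} (hF : IsAlternating b F) {Λ : weightLattice P}
    (hΛ : F.coeff Λ = 1)
    (hdom : ∀ μ, F.coeff μ ≠ 0 → (∀ j ∈ b.support, 0 < weightPairing j μ) → μ = Λ)
    (hstab : ∀ w : P.weylGroup, weylWeight P w Λ = Λ → w = 1) :
    F = ∑ w : P.weylGroup, single (weylWeight P w Λ) (weylSign w) := by
  classical
  ext μ
  rw [coeff_sum, Finsupp.finsetSum_apply]
  simp only [coeff_single, Finsupp.single_apply]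
  by_cases h : ∃ v : P.weylGroup, weylWeight P v Λ = μ
  · obtain ⟨v, rfl⟩ := h
    rw [hF.coeff_weylWeight, hΛ, mul_one, Finset.sum_eq_single v]
    · simp
    · intro w _ hw
      rw [if_neg]
      intro h
      refine hw ?_
      have := hstab (v⁻¹ * w) (by rw [weylWeight_mul, h, weylWeight_inv_apply])
      rwa [inv_mul_eq_one, eq_comm] at this
    · simp
  · rw [Finset.sum_eq_zero fun w _ ↦ if_neg fun h' ↦ h ⟨w, h'⟩]
    by_contra hμ
    obtain ⟨w, hw, hw'⟩ := hF.exists_weylWeight hμ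
    refine h ⟨w⁻¹, ?_⟩
    rw [← hdom _ hw hw', weylWeight_inv_apply]

theorem exists_of_coeff_mul_ne_zero {F G : AddMonoidAlgebra ℂ (weightLattice P)}
    {μ : weightLattice P} (h : (F * G).coeff μ ≠ 0) :
    ∃ x y, F.coeff x ≠ 0 ∧ G.coeff y ≠ 0 ∧ x + y = μ := by
  classical
  contrapose! h
  rw [AddMonoidAlgebra.mul_def, coeff_finsuppSum, Finsupp.sum_apply]
  refine Finset.sum_eq_zero fun x hx ↦ ?_
  dsimp only
  rw [coeff_finsuppSum, Finsupp.sum_apply]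
  refine Finset.sum_eq_zero fun y hy ↦ ?_
  dsimp only
  rw [coeff_single, Finsupp.single_apply, if_neg]
  exact h x y (Finsupp.mem_support_iff.1 hx) (Finsupp.mem_support_iff.1 hy)

/-- The leading exponent is a sum in only one way, because opposite elements of the cone are 0. -/
theorem IsMonicBelow.mul {F G : AddMonoidAlgebra ℂ (weightLattice P)} {Λ Λ' : weightLattice P}
    (hF : IsMonicBelow b Λ F) (hG : IsMonicBelow b Λ' G) :
    IsMonicBelow b (Λ + Λ') (F * G) := by
  refine ⟨?_, fun μ hμ ↦ ?_⟩
  · rw [coeff_mul_add_of_uniqueAdd, hF.1, hG.1, one_mul]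
    intro x y hx hy hxy
    have h1 := hF.2 x (Finsupp.mem_support_iff.1 hx)
    have h2 := hG.2 y (Finsupp.mem_support_iff.1 hy)
    have h3 : Λ - x = -(Λ' - y) := by
      rw [← sub_eq_zero, sub_neg_eq_add, sub_add_sub_comm, hxy, sub_self]
    have h4 := simpleCone_antisymm b h1 (by rw [h3, neg_neg]; exact h2)
    have h5 : x = Λ := (sub_eq_zero.1 h4).symm
    exact ⟨h5, by rw [h5] at hxy; exact add_left_cancel hxy⟩
  · obtain ⟨x, y, hx, hy, rfl⟩ := exists_of_coeff_mul_ne_zero hμ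
    rw [add_sub_add_comm]
    exact add_mem (hF.2 x hx) (hG.2 y hy)

theorem isMonicBelow_one : IsMonicBelow b 0 (1 : AddMonoidAlgebra ℂ (weightLattice P)) := by
  classical
  refine ⟨by simp, fun μ hμ ↦ ?_⟩
  rw [one_def, coeff_single, Finsupp.single_apply] at hμ
  obtain rfl : 0 = μ := by by_contra h; simp [h] at hμ
  simp

theorem isMonicBelow_single (Λ : weightLattice P) : IsMonicBelow b Λ (single Λ 1) := by
  classical
  refine ⟨by simp, fun μ hμ ↦ ?_⟩
  rw [coeff_single, Finsupp.single_apply] at hμ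
  obtain rfl : Λ = μ := by by_contra h; simp [h] at hμ
  simp

theorem isMonicBelow_one_sub_single {i : ι} (hi : b.IsPos i) :
    IsMonicBelow b 0 (1 - single (-rootWeight P i) 1) := by
  classical
  have h0 := rootWeight_ne_zero (P := P) i
  refine ⟨by simp [one_def, h0], fun μ hμ ↦ ?_⟩
  by_cases h1 : μ = 0
  · simp [h1]
  · obtain rfl : -rootWeight P i = μ := by
      by_contra h
      simp [one_def, h, Ne.symm h1] at hμ
    simpa using rootWeight_mem_simpleCone b hi

theorem isMonicBelow_prod (s : Finset ι) (hs : ∀ i ∈ s, b.IsPos i) :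
    IsMonicBelow b 0 (∏ i ∈ s, (1 - single (-rootWeight P i) (1 : ℂ))) := by
  classical
  induction s using Finset.induction_on with
  | empty => simpa using isMonicBelow_one
  | insert i s hi ih =>
    rw [Finset.prod_insert hi, ← add_zero 0]
    exact (isMonicBelow_one_sub_single (hs i (Finset.mem_insert_self i s))).mul
      (ih fun j hj ↦ hs j (Finset.mem_insert_of_mem hj))

variable (b) in
/-- The Weyl denominator. -/
def weylDenominator : AddMonoidAlgebra ℂ (weightLattice P) :=
  single (weylVector b) 1 * ∏ i ∈ positiveRoots b, (1 - single (-rootWeight P i) 1)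

theorem isMonicBelow_weylDenominator : IsMonicBelow b (weylVector b) (weylDenominator b) := by
  have := (isMonicBelow_single (b := b) (weylVector b)).mul
    (isMonicBelow_prod (b := b) (positiveRoots b) fun i hi ↦ (mem_positiveRoots b).1 hi)
  rwa [add_zero] at this

theorem isAlternating_of_mapDomainRingHom {F : AddMonoidAlgebra ℂ (weightLattice P)}
    (h : ∀ j ∈ b.support,
      mapDomainRingHom ℂ (weylWeight P (RootPairing.weylGroup.ofIdx P j)) F = -F) :
    IsAlternating b F := by
  intro j hj μ
  have h1 := congrArg (fun x ↦ x.coeff (weylWeight P (RootPairing.weylGroup.ofIdx P j) μ)) (h j hj)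
  simp only [mapDomainRingHom_apply, coeff_mapDomain] at h1
  rw [Finsupp.mapDomain_apply] at h1
  · rw [h1]; simp
  · intro x y hxy
    rw [← weylWeight_inv_apply (RootPairing.weylGroup.ofIdx P j) x, hxy, weylWeight_inv_apply]

/-- The reflection permutes the factors other than the one for αⱼ, and it turns e^ρ(1 - e^(-αⱼ))
into e^(ρ-αⱼ)(1 - e^(αⱼ)), its negative. -/
theorem mapDomainRingHom_weylDenominator [P.IsReduced] {j : ι} (hj : j ∈ b.support) :
    mapDomainRingHom ℂ (weylWeight P (RootPairing.weylGroup.ofIdx P j)) (weylDenominator b) =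
      -weylDenominator b := by
  classical
  have hjp : j ∈ positiveRoots b :=
    (mem_positiveRoots b).2 (RootPairing.Base.isPos_of_mem_support hj)
  have hfac (i : ι) : mapDomainRingHom ℂ (weylWeight P (RootPairing.weylGroup.ofIdx P j))
      (1 - single (-rootWeight P i) 1) =
      1 - single (-rootWeight P (P.reflectionPerm j i)) 1 := by
    rw [map_sub, map_one, mapDomainRingHom_apply, mapDomain_single, map_neg,
      weylWeight_rootWeight, weylIndex_ofIdx]
  have hprod : ∏ i ∈ (positiveRoots b).erase j,
      (1 - single (-rootWeight P (P.reflectionPerm j i)) (1 : ℂ)) =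
      ∏ i ∈ (positiveRoots b).erase j, (1 - single (-rootWeight P i) 1) :=
    Finset.prod_nbij' (P.reflectionPerm j) (P.reflectionPerm j)
      (fun i hi ↦ reflectionPerm_mem_positiveRoots_erase b hj hi)
      (fun i hi ↦ reflectionPerm_mem_positiveRoots_erase b hj hi) (by simp) (by simp) (by simp)
  rw [weylDenominator, map_mul, map_prod, Finset.prod_congr rfl fun i _ ↦ hfac i,
    ← Finset.mul_prod_erase _ _ hjp, ← Finset.mul_prod_erase _ _ hjp, hprod,
    mapDomainRingHom_apply, mapDomain_single, rootWeight_reflectionPerm_self, neg_neg,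
    weylWeight_ofIdx, weightPairing_weylVector b hj, one_smul, ← mul_assoc, ← mul_assoc,
    ← neg_mul]
  congr 1
  rw [mul_sub, mul_sub, single_mul_single, single_mul_single]
  simp [sub_eq_add_neg, add_comm]

theorem isAlternating_weylDenominator [P.IsReduced] : IsAlternating b (weylDenominator b) :=
  isAlternating_of_mapDomainRingHom fun _ hj ↦ mapDomainRingHom_weylDenominator hj

/-- Strict dominance makes every coordinate of μ at least 1, so the cone element ρ - μ has no
positive coordinate. -/
theorem eq_weylVector_of_coeff_ne_zero {μ : weightLattice P}
    (h : (weylDenominator b).coeff μ ≠ 0) (hμ : ∀ j ∈ b.support, 0 < weightPairing j μ) :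
    μ = weylVector b := by
  refine (sub_eq_zero.1 (eq_zero_of_simpleCone_of_nonpos b
    (isMonicBelow_weylDenominator.2 μ h) fun i hi ↦ ?_)).symm
  rw [map_sub, weightPairing_weylVector b hi]
  have := hμ i hi
  linarith

end Alternating

/-! ### The Killing form on weights and its positivity -/

section CartanForm

variable {L : Type*} [LieRing L] [LieAlgebra ℂ L] [FiniteDimensional ℂ L] [IsKilling ℂ L]
variable {H : LieSubalgebra ℂ L} [H.IsCartanSubalgebra]

theorem killingForm_cartanEquivDual_symm_symm (μ ν : Dual ℂ H) :
    killingForm ℂ L ((cartanEquivDual H).symm μ : L) ((cartanEquivDual H).symm ν : L) =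
      cartanForm μ ν :=
  killingForm_cartanEquivDual_symm μ _

theorem cartanForm_comm (μ ν : Dual ℂ H) : cartanForm μ ν = cartanForm ν μ := by
  rw [← killingForm_cartanEquivDual_symm_symm, LieModule.traceForm_comm,
    killingForm_cartanEquivDual_symm_symm]

theorem cartanForm_add_left (μ μ' ν : Dual ℂ H) :
    cartanForm (μ + μ') ν = cartanForm μ ν + cartanForm μ' ν := rfl

variable (H) in
/-- The Killing form on the weight lattice. -/
def weightCartan : weightLattice (rootSystem H) →+ weightLattice (rootSystem H) →+ ℂ :=
  AddMonoidHom.mk' (fun μ ↦ AddMonoidHom.mk' (fun ν ↦ cartanForm (μ : Dual ℂ H) (ν : Dual ℂ H))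
    fun ν ν' ↦ by
      rw [cartanForm_comm, AddSubgroup.coe_add, cartanForm_add_left, cartanForm_comm,
        cartanForm_comm (ν' : Dual ℂ H)]) fun μ μ' ↦ by
    ext ν
    rfl

theorem weightCartan_apply (μ ν : weightLattice (rootSystem H)) :
    weightCartan H μ ν = cartanForm (μ : Dual ℂ H) (ν : Dual ℂ H) := rfl

theorem weightCartan_comm (μ ν : weightLattice (rootSystem H)) :
    weightCartan H μ ν = weightCartan H ν μ :=
  cartanForm_comm _ _

theorem two_mul_weightCartan (α : H.root) (μ : weightLattice (rootSystem H)) :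
    2 * weightCartan H μ (rootWeight (rootSystem H) α) =
      weightCartan H (rootWeight (rootSystem H) α) (rootWeight (rootSystem H) α) *
        weightPairing α μ := by
  have h0 := root_apply_cartanEquivDual_symm_ne_zero (H.isNonZero_coe_root α)
  have h1 : (μ : Dual ℂ H) (coroot α.1) = weightPairing α μ := weightPairing_spec α μ
  rw [coroot, map_nsmul, map_smul, smul_eq_mul, nsmul_eq_mul] at h1
  rw [← h1]
  change 2 * (μ : Dual ℂ H) ((cartanEquivDual H).symm α.1.toLinear) =
    α.1 ((cartanEquivDual H).symm α.1.toLinear) * _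
  field_simp
  push_cast
  ring

theorem weightCartan_eq_sum (μ ν : weightLattice (rootSystem H)) :
    weightCartan H μ ν = ∑ β : H.root, weightCartan H (rootWeight (rootSystem H) β) μ *
      weightCartan H (rootWeight (rootSystem H) β) ν := by
  have h := LinearMap.congr_fun₂ (restrict_killingForm_eq_sum (K := ℂ) (L := L) (H := H))
    ((cartanEquivDual H).symm μ) ((cartanEquivDual H).symm ν)
  rw [← Finset.sum_coe_sort (H.root)] at h
  refine (killingForm_cartanEquivDual_symm_symm (μ : Dual ℂ H) (ν : Dual ℂ H)).symm.trans
    (h.trans ?_)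
  simp only [LinearMap.sum_apply, LinearMap.smulRight_apply, LinearMap.smul_apply, smul_eq_mul]
  rfl

/-- With c = (α, α), the expansion of the Killing form over the roots gives 4c = c² ∑ ⟨β, α̌⟩², so c
is 4 divided by a positive integer. -/
theorem exists_pos_weightCartan (α : H.root) : ∃ r : ℝ, 0 < r ∧
    weightCartan H (rootWeight (rootSystem H) α) (rootWeight (rootSystem H) α) = r := by
  set c := weightCartan H (rootWeight (rootSystem H) α) (rootWeight (rootSystem H) α) with hc
  set S : ℤ := ∑ β : H.root, weightPairing α (rootWeight (rootSystem H) β) ^ 2 with hS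
  have hS0 : 0 < S := by
    refine Finset.sum_pos' (fun β _ ↦ sq_nonneg _) ⟨α, Finset.mem_univ α, ?_⟩
    rw [weightPairing_rootWeight_self]; norm_num
  have h0 : c ≠ 0 := root_apply_cartanEquivDual_symm_ne_zero (H.isNonZero_coe_root α)
  have h1 : 4 * c = c * c * S := by
    conv_lhs => rw [hc, weightCartan_eq_sum, Finset.mul_sum]
    rw [hS]
    push_cast
    rw [Finset.mul_sum]
    refine Finset.sum_congr rfl fun β _ ↦ ?_
    have := two_mul_weightCartan α (rootWeight (rootSystem H) β)
    rw [← hc] at this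
    linear_combination (2 * weightCartan H (rootWeight (rootSystem H) β)
      (rootWeight (rootSystem H) α) + c * weightPairing α (rootWeight (rootSystem H) β)) * this
  have h2 : c * S = 4 := mul_left_cancel₀ h0 (by linear_combination -h1)
  have hSC : (S : ℂ) ≠ 0 := by exact_mod_cast hS0.ne'
  refine ⟨4 / S, by positivity, ?_⟩
  push_cast
  field_simp
  exact h2

theorem weightCartan_weylWeight (w : (rootSystem H).weylGroup)
    (μ : weightLattice (rootSystem H)) :
    weightCartan H (weylWeight _ w μ) (weylWeight _ w μ) = weightCartan H μ μ := by
  obtain ⟨w, hw⟩ := w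
  induction hw using RootPairing.weylGroup.induction generalizing μ with
  | mem α =>
    have h := weylWeight_ofIdx (P := rootSystem H) α μ
    rw [RootPairing.weylGroup.ofIdx] at h
    rw [h]
    have h1 := two_mul_weightCartan α μ
    simp only [map_sub, map_zsmul, AddMonoidHom.sub_apply, AddMonoidHom.smul_apply, zsmul_eq_mul,
      weightCartan_comm (rootWeight (rootSystem H) α) μ]
    linear_combination -(weightPairing α μ : ℂ) * h1
  | one => exact congrArg₂ (fun x y ↦ weightCartan H x y) (weylWeight_one μ) (weylWeight_one μ)
  | mul g₁ g₂ hg₁ hg₂ h₁ h₂ =>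
    rw [← Submonoid.mk_mul_mk _ _ _ hg₁ hg₂]
    have := weylWeight_mul (P := rootSystem H) ⟨g₁, hg₁⟩ ⟨g₂, hg₂⟩ μ
    exact (congrArg₂ (fun x y ↦ weightCartan H x y) this this).trans ((h₁ _).trans (h₂ _))

/-- The norm of a strictly dominant weight is smaller than that of any higher weight. -/
theorem eq_zero_of_weightCartan_eq {b : (rootSystem H).Base}
    {μ δ : weightLattice (rootSystem H)} (hμ : ∀ j ∈ b.support, 0 < weightPairing j μ)
    (hδ : δ ∈ simpleCone b)
    (h : weightCartan H (μ + δ) (μ + δ) = weightCartan H μ μ) : δ = 0 := by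
  obtain ⟨n, rfl⟩ := exists_coeff_of_mem_simpleCone b hδ
  choose c hc hc' using exists_pos_weightCartan (H := H)
  have hval (x : weightLattice (rootSystem H)) :
      2 * weightCartan H x (∑ j, n j • rootWeight (rootSystem H) j) =
        ((∑ j, n j * (c j * weightPairing (j : H.root) x) : ℝ) : ℂ) := by
    rw [map_sum, Finset.mul_sum]
    push_cast
    refine Finset.sum_congr rfl fun j _ ↦ ?_
    rw [map_nsmul, nsmul_eq_mul, mul_left_comm, two_mul_weightCartan, hc']
  set δ := ∑ j, n j • rootWeight (rootSystem H) (j : H.root) with hδ'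
  -- The form is complex valued. Over the roots, (δ, δ) is a sum of real squares, and 2(μ, δ) is a
  -- nonnegative real, so both must vanish.
  have h1 : 4 * weightCartan H δ δ = ((∑ β : H.root, (∑ j, n j *
      (c j * weightPairing (j : H.root) (rootWeight (rootSystem H) β))) ^ 2 : ℝ) : ℂ) := by
    rw [weightCartan_eq_sum, Finset.mul_sum, Complex.ofReal_sum]
    refine Finset.sum_congr rfl fun β _ ↦ ?_
    rw [Complex.ofReal_pow, ← hval]
    ring
  have h2 := hval μ
  have h3 : 4 * (2 * weightCartan H μ δ) + 4 * weightCartan H δ δ = 0 := by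
    simp only [map_add, AddMonoidHom.add_apply] at h
    rw [weightCartan_comm δ μ] at h
    linear_combination 4 * h
  rw [h1, h2] at h3
  have h4 : 4 * (∑ j, n j * (c j * weightPairing (j : H.root) μ)) + (∑ β : H.root, (∑ j, n j *
      (c j * weightPairing (j : H.root) (rootWeight (rootSystem H) β))) ^ 2 : ℝ) = 0 := by
    exact_mod_cast h3
  have hpos (j : b.support) : 0 < c j * weightPairing (j : H.root) μ :=
    mul_pos (hc _) (by exact_mod_cast hμ j j.2)
  have h5 : ∑ j : b.support, n j * (c j * weightPairing (j : H.root) μ) ≤ 0 := by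
    have : (0 : ℝ) ≤ ∑ β : H.root, (∑ j, n j *
      (c j * weightPairing (j : H.root) (rootWeight (rootSystem H) β))) ^ 2 :=
      Finset.sum_nonneg fun _ _ ↦ sq_nonneg _
    linarith
  have h6 := (Finset.sum_eq_zero_iff_of_nonneg fun j _ ↦
    mul_nonneg (Nat.cast_nonneg (n j)) (hpos j).le).1
    (le_antisymm h5 (Finset.sum_nonneg fun j _ ↦
      mul_nonneg (Nat.cast_nonneg (n j)) (hpos j).le))
  refine Finset.sum_eq_zero fun j hj ↦ ?_
  have := (mul_eq_zero.1 (h6 j hj)).resolve_right (hpos j).ne'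
  rw [Nat.cast_eq_zero.1 this, zero_smul]

end CartanForm

/-! ### Formal traces and the Weyl character formula -/

section Character

open AddMonoidAlgebra

variable {L : Type*} [LieRing L] [LieAlgebra ℂ L] [FiniteDimensional ℂ L] [IsKilling ℂ L]
variable {H : LieSubalgebra ℂ L} [H.IsCartanSubalgebra]
variable {W : Type*} [AddCommGroup W] [Module ℂ W] [LieRingModule L W] [LieModule ℂ L W]
variable {κ : Type*} [Fintype κ] (B : Basis κ ℂ W) (ν : κ → weightLattice (rootSystem H))

/-- The formal trace of an operator: its diagonal coefficients, weighted by the weights. -/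
def formalTrace : End ℂ W →ₗ[ℂ] AddMonoidAlgebra ℂ (weightLattice (rootSystem H)) where
  toFun A := ∑ i, single (ν i) (B.repr (A (B i)) i)
  map_add' A C := by simp [single_add, Finset.sum_add_distrib]
  map_smul' c A := by simp [Finset.smul_sum, smul_single]

theorem formalTrace_apply (A : End ℂ W) :
    formalTrace B ν A = ∑ i, single (ν i) (B.repr (A (B i)) i) := rfl

/-- The formal character of a family of weights. -/
def character : AddMonoidAlgebra ℂ (weightLattice (rootSystem H)) := ∑ i, single (ν i) 1

theorem coeff_character (μ : weightLattice (rootSystem H)) :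
    (character ν).coeff μ = weightMult ν μ := by
  classical
  rw [character, coeff_sum, Finsupp.finsetSum_apply, weightMult, Fintype.card_subtype]
  simp [Finsupp.single_apply]

/-- The usual double sum, except that exchanging the factors moves the diagonal entry from weight ν
j to ν j + α. -/
theorem formalTrace_mul_comm {A C : End ℂ W} {α : weightLattice (rootSystem H)}
    (hA : ∀ i j, B.repr (A (B j)) i ≠ 0 → ν i = ν j + α) :
    formalTrace B ν (A * C) = single α 1 * formalTrace B ν (C * A) := by
  classical
  have hmul (A C : End ℂ W) (i : κ) : B.repr ((A * C) (B i)) i =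
      ∑ j, B.repr (A (B j)) i * B.repr (C (B i)) j := by
    have := congrFun (congrFun (LinearMap.toMatrix_mul B A C) i) i
    rw [LinearMap.toMatrix_apply, Matrix.mul_apply] at this
    simpa [LinearMap.toMatrix_apply] using this
  have hsum (x : weightLattice (rootSystem H)) (f : κ → ℂ) :
      (single x (∑ j, f j) : AddMonoidAlgebra ℂ (weightLattice (rootSystem H))) =
        ∑ j, single x (f j) := map_sum (singleAddHom x) f _
  rw [formalTrace_apply, formalTrace_apply, Finset.mul_sum]
  simp only [hmul, hsum, Finset.mul_sum, single_mul_single, one_mul]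
  rw [Finset.sum_comm]
  refine Finset.sum_congr rfl fun j _ ↦ Finset.sum_congr rfl fun i _ ↦ ?_
  by_cases h : B.repr (A (B j)) i = 0
  · simp [h]
  · rw [hA i j h, add_comm, mul_comm]

variable {B ν}

theorem formalTrace_of_forall {A : End ℂ W} {φ : weightLattice (rootSystem H) → ℂ}
    (hA : ∀ i, A (B i) = φ (ν i) • B i) :
    formalTrace B ν A = diagonal φ (character ν) := by
  rw [formalTrace_apply, character, map_sum]
  refine Finset.sum_congr rfl fun i _ ↦ ?_
  rw [hA, diagonal_single]
  simp

theorem repr_lie_ne_zero (hB : ∀ i, IsWeightVector H (ν i : Dual ℂ H) (B i)) {α : H.root} {x : L}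
    (hx : x ∈ rootSpace H α.1.toLinear) (i j : κ)
    (h : B.repr (toEnd ℂ L W x (B j)) i ≠ 0) : ν i = ν j + rootWeight (rootSystem H) α := by
  by_contra hne
  exact h (coeff_eq_zero_of_isWeightVector B hB
    (μ := ν j + rootWeight (rootSystem H) α) ((hB j).lie hx) hne)

theorem formalTrace_rootVector (hB : ∀ i, IsWeightVector H (ν i : Dual ℂ H) (B i)) (α : H.root) :
    formalTrace B ν (toEnd ℂ L W (dualRootVector α) * toEnd ℂ L W (rootVector α)) =
      single (-rootWeight (rootSystem H) α) 1 *
        formalTrace B ν (toEnd ℂ L W (rootVector α) * toEnd ℂ L W (dualRootVector α)) := by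
  rw [formalTrace_mul_comm B ν (repr_lie_ne_zero hB (rootVector_mem α)), ← mul_assoc,
    single_mul_single, neg_add_cancel, mul_one, ← one_def, one_mul]

/-- The left side is the formal trace of the commutator of the two root vectors, which lies in the
Cartan subalgebra and acts on weight μ by (α, μ). This determines the traces T i needed by
`diagonal_denominator_mul`. -/
theorem one_sub_mul_formalTrace (hB : ∀ i, IsWeightVector H (ν i : Dual ℂ H) (B i)) (α : H.root) :
    (1 - single (-rootWeight (rootSystem H) α) 1) *
        formalTrace B ν (toEnd ℂ L W (rootVector α) * toEnd ℂ L W (dualRootVector α)) =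
      diagonal (weightCartan H (rootWeight (rootSystem H) α)) (character ν) := by
  rw [sub_mul, one_mul, ← formalTrace_rootVector hB, ← map_sub]
  refine formalTrace_of_forall fun i ↦ ?_
  have h1 : (toEnd ℂ L W (rootVector α) * toEnd ℂ L W (dualRootVector α) -
      toEnd ℂ L W (dualRootVector α) * toEnd ℂ L W (rootVector α)) (B i) =
      ⁅⁅rootVector α, dualRootVector α⁆, B i⁆ := by
    rw [lie_lie]; rfl
  rw [h1, lie_rootVector, hB i, weightCartan_comm]
  rfl

theorem formalTrace_casimir (hB : ∀ i, IsWeightVector H (ν i : Dual ℂ H) (B i))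
    (b : (rootSystem H).Base) :
    formalTrace B ν (casimir W b) = diagonal (fun μ ↦ weightCartan H μ μ) (character ν) +
      ∑ α ∈ positiveRoots b, (1 + single (-rootWeight (rootSystem H) α) 1) *
        formalTrace B ν (toEnd ℂ L W (rootVector α) * toEnd ℂ L W (dualRootVector α)) := by
  rw [casimir, map_add]
  congr 1
  · refine formalTrace_of_forall fun i ↦ ?_
    have := (hB i).sum_cartan
    rw [LinearMap.sum_apply]
    exact this
  · rw [map_sum]
    refine Finset.sum_congr rfl fun α _ ↦ ?_
    rw [map_add, formalTrace_rootVector hB, add_mul, one_mul]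

theorem mapDomainRingHom_character (hB : ∀ i, IsWeightVector H (ν i : Dual ℂ H) (B i))
    (α : H.root) :
    mapDomainRingHom ℂ (weylWeight (rootSystem H) (RootPairing.weylGroup.ofIdx _ α))
      (character ν) = character ν := by
  ext μ
  set s := RootPairing.weylGroup.ofIdx (rootSystem H) α
  have hinj : Function.Injective (weylWeight (rootSystem H) s) := fun x y hxy ↦ by
    rw [← weylWeight_inv_apply s x, hxy, weylWeight_inv_apply]
  rw [mapDomainRingHom_apply, coeff_mapDomain, ← weylWeight_apply_inv s μ,
    Finsupp.mapDomain_apply hinj, coeff_character, coeff_character, weylWeight_ofIdx,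
    weightMult_reflection B hB]

/-- Every exponent of the denominator is conjugate to ρ, and the norm is constant on Weyl orbits. -/
theorem diagonal_weylDenominator (b : (rootSystem H).Base) :
    diagonal (fun μ ↦ weightCartan H μ μ) (weylDenominator b) =
      weightCartan H (weylVector b) (weylVector b) • weylDenominator b := by
  ext μ
  rw [coeff_diagonal, coeff_smul_apply, smul_eq_mul]
  by_cases h : (weylDenominator b).coeff μ = 0
  · simp [h]
  · obtain ⟨w, hw, hw'⟩ := isAlternating_weylDenominator.exists_weylWeight h
    rw [← eq_weylVector_of_coeff_ne_zero hw hw', weightCartan_weylWeight]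

theorem isMonicBelow_character {b : (rootSystem H).Base} {Λ : weightLattice (rootSystem H)}
    (D : WeightBasis W b Λ κ) : IsMonicBelow b Λ (character D.weight) := by
  classical
  refine ⟨?_, fun μ hμ ↦ ?_⟩
  · obtain ⟨i, hi, hi'⟩ := D.existsUnique
    rw [coeff_character, weightMult, Fintype.card_eq_one_iff.2 ⟨⟨i, hi⟩, fun j ↦
      Subtype.ext (hi' j j.2)⟩, Nat.cast_one]
  · rw [coeff_character, weightMult, Nat.cast_ne_zero, ← Nat.pos_iff_ne_zero,
      Fintype.card_pos_iff] at hμ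
    obtain ⟨i, rfl⟩ := hμ
    exact D.sub_mem i

/-- The Weyl character formula. -/
theorem weyl_character_formula [LieModule.IsIrreducible ℂ L W]
    [Fintype (rootSystem H).weylGroup] {b : (rootSystem H).Base}
    {Λ : weightLattice (rootSystem H)} (D : WeightBasis W b Λ κ)
    (hstab : ∀ w : (rootSystem H).weylGroup,
      weylWeight _ w (weylVector b + Λ) = weylVector b + Λ → w = 1) :
    weylDenominator b * character D.weight =
      ∑ w : (rootSystem H).weylGroup, single (weylWeight _ w (weylVector b + Λ)) (weylSign w) := by
  have hB := D.isWeightVector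
  have halt : IsAlternating b (weylDenominator b * character D.weight) :=
    isAlternating_of_mapDomainRingHom fun j hj ↦ by
      rw [map_mul, mapDomainRingHom_weylDenominator hj, mapDomainRingHom_character hB, neg_mul]
  have hmonic := (isMonicBelow_weylDenominator (b := b)).mul (isMonicBelow_character D)
  refine halt.eq_sum hmonic.1 (fun μ hμ hdom ↦ ?_) hstab
  have hcas : diagonal (fun μ ↦ weightCartan H μ μ) (character D.weight) +
      ∑ α ∈ positiveRoots b, (1 + single (-rootWeight (rootSystem H) α) 1) *
        formalTrace D.basis D.weight
          (toEnd ℂ L W (rootVector α) * toEnd ℂ L W (dualRootVector α)) =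
      (weightCartan H Λ Λ + 2 * weightCartan H Λ (weylVector b)) • character D.weight := by
    have h2 : ∑ α ∈ positiveRoots b, cartanForm (Λ : Dual ℂ H) α.1.toLinear =
        2 * weightCartan H Λ (weylVector b) := by
      have := congrArg (weightCartan H Λ) (two_nsmul_weylVector b)
      rw [map_nsmul, map_sum, nsmul_eq_mul] at this
      exact this.symm
    rw [← formalTrace_casimir hB, formalTrace_apply, character, Finset.smul_sum]
    refine Finset.sum_congr rfl fun i _ ↦ ?_
    rw [D.casimir_apply, h2, smul_single]
    simp [weightCartan_apply]
  have hL := diagonal_denominator_mul weightCartan_comm (two_nsmul_weylVector b)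
    (fun α _ ↦ one_sub_mul_formalTrace hB α) hcas (rfl : weylDenominator b = _)
    (diagonal_weylDenominator b)
  have h3 := congrArg (fun x ↦ x.coeff μ) hL
  rw [coeff_diagonal, coeff_smul_apply, smul_eq_mul] at h3
  -- A weight that occurs has the norm of ρ + Λ. Being strictly dominant and below ρ + Λ, it can
  -- only be ρ + Λ.
  have h4 := mul_right_cancel₀ hμ h3
  have h5 := eq_zero_of_weightCartan_eq hdom (hmonic.2 μ hμ) (by
    rw [add_sub_cancel, h4]
    simp only [map_add, AddMonoidHom.add_apply, weightCartan_comm (weylVector b) Λ]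
    ring)
  exact (sub_eq_zero.1 h5).symm

end Character

/-! ### Signs and alternating sums -/

section Sign

variable {ι M N : Type*} [AddCommGroup M] [Module ℂ M] [AddCommGroup N] [Module ℂ N]
variable {P : RootPairing ι ℂ M N} [P.IsCrystallographic] [P.IsRootSystem] [Fintype ι]

/-- Needed for the reflection in the folded highest root, which is not given as the reflection in a
root. Extending f linearly makes w a transvection of determinant 1 - f v = -1. -/
theorem weylSign_of_reflection (b : P.Base) {w : P.weylGroup} {f : weightLattice P →+ ℤ}
    {v : weightLattice P} (hw : ∀ x, weylWeight P w x = x - f x • v) (hv : f v = 2) :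
    weylSign w = -1 := by
  classical
  have : Module.Finite ℂ M := Module.Finite.of_basis b.toWeightBasis
  let F : Dual ℂ M := ∑ j : b.support,
    (f ((weightCoords b).symm (Pi.single j 1)) : ℂ) • P.coroot' (j : ι)
  have hF (x : weightLattice P) : F x = f x := by
    have hx : x = ∑ j : b.support,
        weightPairing (j : ι) x • (weightCoords b).symm (Pi.single j 1) := by
      refine weight_ext b fun i hi ↦ ?_
      rw [map_sum, Finset.sum_eq_single ⟨i, hi⟩]
      · rw [map_zsmul, weightPairing_weightCoords_symm b _ ⟨i, hi⟩]
        simp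
      · intro j _ hj
        rw [map_zsmul, weightPairing_weightCoords_symm b _ ⟨i, hi⟩,
          Pi.single_eq_of_ne (Ne.symm hj), smul_zero]
      · simp
    conv_rhs => rw [hx, map_sum]
    simp only [F, LinearMap.sum_apply, LinearMap.smul_apply, map_zsmul, smul_eq_mul]
    push_cast
    refine Finset.sum_congr rfl fun j _ ↦ ?_
    rw [← weightPairing_spec, mul_comm]
    rfl
  have h : (RootPairing.Equiv.weightHom P w : M →ₗ[ℂ] M) =
      LinearMap.transvection (-F) (v : M) := by
    apply LinearMap.ext_on_range (v := P.root) RootPairing.IsRootSystem.span_root_eq_top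
    intro i
    have h1 := congrArg Subtype.val (hw (rootWeight P i))
    rw [LinearMap.transvection.apply]
    refine h1.trans ?_
    have h2 := hF (rootWeight P i)
    change P.root i - f (rootWeight P i) • (v : M) = P.root i + (-F (P.root i)) • (v : M)
    rw [show F (P.root i) = _ from h2, neg_smul, Int.cast_smul_eq_zsmul, sub_eq_add_neg]
  rw [weylSign, h, LinearMap.transvection.det, LinearMap.neg_apply, hF, hv]
  norm_num

theorem weylSign_eq_or [P.IsReduced] (b : P.Base) (w : P.weylGroup) :
    weylSign w = 1 ∨ weylSign w = -1 :=
  mul_self_eq_one_iff.1 (weylSign_sq b w)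

/-- The alternating sum of `t` over the Weyl group orbit of `x`. -/
def alternatingSum [Fintype P.weylGroup] (t : Torus P) (x : weightLattice P) : ℂ :=
  ∑ w : P.weylGroup, weylSign w * t (weylWeight P w x)

theorem alternatingSum_weylWeight [P.IsReduced] (b : P.Base) [Fintype P.weylGroup] (t : Torus P)
    (v : P.weylGroup) (x : weightLattice P) :
    alternatingSum t (weylWeight P v x) = weylSign v * alternatingSum t x := by
  rw [alternatingSum, alternatingSum, Finset.mul_sum, ← Equiv.sum_comp (Equiv.mulRight v⁻¹)]
  refine Finset.sum_congr rfl fun w _ ↦ ?_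
  rw [Equiv.coe_mulRight, ← weylWeight_mul, inv_mul_cancel_right, weylSign_mul, ← mul_assoc,
    mul_comm (weylSign v)]
  congr 2
  have h1 : weylSign v⁻¹ * weylSign v = 1 := by rw [← weylSign_mul, inv_mul_cancel, weylSign_one]
  have h2 := weylSign_sq b v
  exact mul_right_cancel₀ (right_ne_zero_of_mul_eq_one h2) (h1.trans h2.symm)

theorem isRegular_eq {t : Torus P} (ht : IsRegular t) {v w : P.weylGroup}
    (h : ∀ x, t (weylWeight P v x) = t (weylWeight P w x)) : v = w := by
  have := ht (v * w⁻¹) (by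
    ext x
    change t (weylWeight P (v * w⁻¹)⁻¹ x) = t x
    rw [mul_inv_rev, inv_inv, weylWeight_mul, ← h, weylWeight_apply_inv])
  rwa [mul_inv_eq_one] at this

end Sign

/-! ### Orthogonality of characters and reduction to the alcove -/

section Orthogonality

variable {ι M N : Type*} [AddCommGroup M] [Module ℂ M] [AddCommGroup N] [Module ℂ N]
variable {P : RootPairing ι ℂ M N} [P.IsRootSystem] {b : P.Base}
variable {ι' M' N' : Type*} [AddCommGroup M'] [Module ℂ M'] [AddCommGroup N'] [Module ℂ N']
variable {P' : RootPairing ι' ℂ M' N'} [P'.IsRootSystem] {b' : P'.Base}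
variable [P.IsCrystallographic] [P'.IsCrystallographic] [Fintype ι] [Fintype ι']
variable {σ : Equiv.Perm b.support} (e : Orbits σ ≃ b'.support)
variable {θ : ι} {g : weightLattice P'} {k : ℤ}

variable (k) in
/-- The lattice of multiples by `k` of elements of the folded lattice. -/
def levelLattice : AddSubgroup (weightLattice P') :=
  (foldedLattice e).map (zsmulAddGroupHom k)

theorem levelLattice_le_comap [P'.IsReduced] (hlen : ∀ i j, rootNorm P i = rootNorm P j)
    (he : IsOrbitBase b b' σ e) (w : P'.weylGroup) :
    levelLattice e k ≤ (levelLattice e k).comap (weylWeight P' w) := by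
  rintro _ ⟨m, hm, rfl⟩
  exact ⟨weylWeight P' w m, weylWeight_mem_foldedLattice e hlen he w hm, by simp⟩

theorem finite_quotient_levelLattice [P'.IsReduced] (hσ : IsDiagramAutomorphism b σ)
    (hlen : ∀ i j, rootNorm P i = rootNorm P j) (he : IsOrbitBase b b' σ e)
    (hθ : IsHighestRoot b θ) [Nonempty b.support] (hg : liftWeight e g = rootWeight P θ)
    {ρ : weightLattice P'} (hρ : ρ ∈ alcove e θ k) :
    Finite (weightLattice P' ⧸ levelLattice e k) := by
  have := finite_weylGroup (P := P')
  have hfin := finite_closed_alcove e (k := k) hlen hθ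
  have := hfin.to_subtype
  refine Finite.of_surjective (fun p : P'.weylGroup × {x : weightLattice P' |
    ∀ c, 0 ≤ wall e θ k c x} ↦ (weylWeight P' p.1 p.2.1 : weightLattice P' ⧸ levelLattice e k)) ?_
  intro q
  obtain ⟨x, rfl⟩ := QuotientAddGroup.mk_surjective q
  obtain ⟨w, m, hm, h⟩ := exists_affine_mem_closed_alcove e hσ hlen he hθ hg hρ x
  refine ⟨(w⁻¹, ⟨_, h⟩), ?_⟩
  rw [eq_comm, QuotientAddGroup.eq]
  refine ⟨weylWeight P' w⁻¹ m, weylWeight_mem_foldedLattice e hlen he w⁻¹ hm, ?_⟩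
  simp

/-- A torus point coming from a character of the finite quotient. -/
def torusOfQuotient (ψ : AddChar (weightLattice P' ⧸ levelLattice e k) ℂ) : Torus P' :=
  ψ.compAddMonoidHom (QuotientAddGroup.mk' (levelLattice e k))

theorem torusOfQuotient_apply (ψ : AddChar (weightLattice P' ⧸ levelLattice e k) ℂ)
    (x : weightLattice P') : torusOfQuotient e ψ x = ψ (x : weightLattice P' ⧸ levelLattice e k) :=
  rfl

/-- A weight on a wall is fixed by its reflection, so the linear part, of sign -1, fixes it modulo
the level lattice. -/
theorem alternatingSum_eq_zero [P'.IsReduced] [Fintype P'.weylGroup]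
    (hσ : IsDiagramAutomorphism b σ)
    (hlen : ∀ i j, rootNorm P i = rootNorm P j) (he : IsOrbitBase b b' σ e)
    (hθ : IsHighestRoot b θ) [Nonempty b.support] (hg : liftWeight e g = rootWeight P θ)
    (ψ : AddChar (weightLattice P' ⧸ levelLattice e k) ℂ) {z : weightLattice P'}
    (c : Option b'.support) (hz : wall e θ k c z = 0) :
    alternatingSum (torusOfQuotient e ψ) z = 0 := by
  obtain ⟨w, hw⟩ := exists_weyl_wall e hσ hlen he hθ hg c
  obtain ⟨m, hm, h⟩ := exists_const_smul_wallVector (k := k) e hg c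
  have hwz : weylWeight P' w z = z + -(k • m) := by
    rw [hw, ← h, neg_neg, show wallLinear e θ c z = -wallConst k c by
      rw [wall] at hz; linarith]
    module
  have h1 := alternatingSum_weylWeight b' (torusOfQuotient e ψ) w z
  rw [weylSign_of_reflection b' hw (wallLinear_wallVector e hg c), hwz] at h1
  have h2 : alternatingSum (torusOfQuotient e ψ) (z + -(k • m)) =
      alternatingSum (torusOfQuotient e ψ) z := by
    refine Finset.sum_congr rfl fun v _ ↦ ?_
    rw [torusOfQuotient_apply, torusOfQuotient_apply, map_add]
    congr 2
    rw [eq_comm, QuotientAddGroup.eq]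
    refine ⟨-weylWeight P' v m, neg_mem (weylWeight_mem_foldedLattice e hlen he v hm), ?_⟩
    simp
  rw [h2] at h1
  linear_combination (1 / 2) * h1

open ComplexConjugate in
-- Regularity makes the Weyl transforms of ψ pairwise distinct characters, so only the diagonal
-- terms of the double sum over the Weyl group survive.
theorem sum_normSq_quotient [P'.IsReduced] [Fintype P'.weylGroup]
    (hlen : ∀ i j, rootNorm P i = rootNorm P j) (he : IsOrbitBase b b' σ e)
    [Fintype (weightLattice P' ⧸ levelLattice e k)]
    {ψ : AddChar (weightLattice P' ⧸ levelLattice e k) ℂ}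
    (hψ : IsRegular (torusOfQuotient e ψ)) {F : weightLattice P' ⧸ levelLattice e k → ℂ}
    (hF : ∀ x : weightLattice P', F x = alternatingSum (torusOfQuotient e ψ) x) :
    ∑ q, F q * conj (F q) =
      Fintype.card P'.weylGroup * Fintype.card (weightLattice P' ⧸ levelLattice e k) := by
  classical
  let ω (w : P'.weylGroup) : weightLattice P' ⧸ levelLattice e k →+
      weightLattice P' ⧸ levelLattice e k :=
    QuotientAddGroup.map _ _ (weylWeight P' w) (levelLattice_le_comap e hlen he w)
  have hF' (q : weightLattice P' ⧸ levelLattice e k) : F q = ∑ w, weylSign w * ψ (ω w q) := by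
    obtain ⟨x, rfl⟩ := QuotientAddGroup.mk_surjective q
    rw [hF]
    rfl
  have hconj (w : P'.weylGroup) : conj (weylSign w) = weylSign w := by
    rcases weylSign_eq_or b' w with h | h <;> simp [h]
  have h1 (q : weightLattice P' ⧸ levelLattice e k) : F q * conj (F q) =
      ∑ w, ∑ v, weylSign w * weylSign v * ψ.compAddMonoidHom (ω w - ω v) q := by
    rw [hF', map_sum, Finset.sum_mul_sum]
    refine Finset.sum_congr rfl fun w _ ↦ Finset.sum_congr rfl fun v _ ↦ ?_
    rw [map_mul, hconj, ← AddChar.map_neg_eq_conj, AddChar.compAddMonoidHom_apply,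
      AddMonoidHom.sub_apply, sub_eq_add_neg, AddChar.map_add_eq_mul]
    ring
  have h2 (w v : P'.weylGroup) : ψ.compAddMonoidHom (ω w - ω v) = 0 ↔ w = v := by
    refine ⟨fun h ↦ isRegular_eq hψ fun x ↦ ?_, ?_⟩
    · have := DFunLike.congr_fun h (x : weightLattice P' ⧸ levelLattice e k)
      rw [AddChar.compAddMonoidHom_apply, AddMonoidHom.sub_apply, AddChar.map_sub_eq_div,
        AddChar.zero_apply] at this
      exact eq_of_div_eq_one this
    · rintro rfl
      ext q
      simp
  simp only [h1]
  rw [Finset.sum_comm]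
  have h3 (w : P'.weylGroup) : ∑ q, ∑ v, weylSign w * weylSign v *
      ψ.compAddMonoidHom (ω w - ω v) q =
      Fintype.card (weightLattice P' ⧸ levelLattice e k) := by
    rw [Finset.sum_comm]
    simp only [← Finset.mul_sum, AddChar.sum_eq_ite, h2]
    simp [weylSign_sq b']
  rw [Finset.sum_congr rfl fun w _ ↦ h3 w]
  simp

open ComplexConjugate in
/-- The sum over the alcove of the squared absolute values of alternating sums. -/
theorem sum_normSq_alcove [P'.IsReduced] [Fintype P'.weylGroup]
    (hσ : IsDiagramAutomorphism b σ)
    (hlen : ∀ i j, rootNorm P i = rootNorm P j) (he : IsOrbitBase b b' σ e)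
    (hθ : IsHighestRoot b θ) [Nonempty b.support] (hg : liftWeight e g = rootWeight P θ)
    {ρ : weightLattice P'} (hρ : ρ ∈ alcove e θ k) [Fintype (alcove e θ k)]
    {ψ : AddChar (weightLattice P' ⧸ levelLattice e k) ℂ}
    (hψ : IsRegular (torusOfQuotient e ψ)) :
    ∑ y : alcove e θ k, alternatingSum (torusOfQuotient e ψ) y.1 *
      conj (alternatingSum (torusOfQuotient e ψ) y.1) =
      Nat.card (weightLattice P' ⧸ levelLattice e k) := by
  have := finite_quotient_levelLattice e hσ hlen he hθ hg hρ
  have := Fintype.ofFinite (weightLattice P' ⧸ levelLattice e k)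
  have hinv (x y : weightLattice P') (h : (x : weightLattice P' ⧸ levelLattice e k) = y) :
      alternatingSum (torusOfQuotient e ψ) x = alternatingSum (torusOfQuotient e ψ) y := by
    refine Finset.sum_congr rfl fun w _ ↦ ?_
    rw [torusOfQuotient_apply, torusOfQuotient_apply]
    congr 2
    exact congrArg (QuotientAddGroup.map _ _ (weylWeight P' w)
      (levelLattice_le_comap e hlen he w)) h
  let F (q : weightLattice P' ⧸ levelLattice e k) : ℂ :=
    alternatingSum (torusOfQuotient e ψ) (Quotient.out q)
  have hF (x : weightLattice P') : F x = alternatingSum (torusOfQuotient e ψ) x :=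
    hinv _ _ (Quotient.out_eq _)
  have h1 := sum_normSq_quotient e hlen he hψ hF
  have hsign (w : P'.weylGroup) (x : weightLattice P') :
      alternatingSum (torusOfQuotient e ψ) (weylWeight P' w x) *
        conj (alternatingSum (torusOfQuotient e ψ) (weylWeight P' w x)) =
      alternatingSum (torusOfQuotient e ψ) x * conj (alternatingSum (torusOfQuotient e ψ) x) := by
    rw [alternatingSum_weylWeight b']
    rcases weylSign_eq_or b' w with h | h <;> simp [h]
  -- Freeness embeds the product of Weyl group and open alcove into the quotient. The remaining
  -- classes are conjugate to points on walls, where the alternating sum is 0.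
  have h2 : ∑ p : P'.weylGroup × alcove e θ k, alternatingSum (torusOfQuotient e ψ) p.2.1 *
      conj (alternatingSum (torusOfQuotient e ψ) p.2.1) = ∑ q, F q * conj (F q) := by
    refine Fintype.sum_of_injective (fun p : P'.weylGroup × alcove e θ k ↦
      (weylWeight P' p.1 p.2.1 : weightLattice P' ⧸ levelLattice e k)) ?_ _ _ ?_ ?_
    · rintro ⟨w, y, hy⟩ ⟨v, z, hz⟩ h
      replace h := QuotientAddGroup.eq.1 h
      obtain ⟨m, hm, h⟩ := h
      replace h : k • m = -weylWeight P' w y + weylWeight P' v z := h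
      have h4 : weylWeight P' (v⁻¹ * w) y + k • weylWeight P' v⁻¹ m = z := by
        rw [← map_zsmul, h, weylWeight_mul, ← map_add]
        simp
      obtain ⟨h5, h6⟩ := eq_of_mem_alcove e hσ hlen he hθ hg hy
        (weylWeight_mem_foldedLattice e hlen he v⁻¹ hm) (w := v⁻¹ * w) (by rw [h4]; exact hz)
      rw [h5, h6, weylWeight_one, add_zero] at h4
      rw [inv_mul_eq_one] at h5
      subst h4 h5
      rfl
    · intro q hq
      obtain ⟨x, rfl⟩ := QuotientAddGroup.mk_surjective q
      obtain ⟨w, m, hm, h⟩ := exists_affine_mem_closed_alcove e hσ hlen he hθ hg hρ x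
      set z := weylWeight P' w x + k • m with hz
      have hxz : (x : weightLattice P' ⧸ levelLattice e k) = weylWeight P' w⁻¹ z := by
        rw [QuotientAddGroup.eq]
        refine ⟨weylWeight P' w⁻¹ m, weylWeight_mem_foldedLattice e hlen he w⁻¹ hm, ?_⟩
        simp [hz]
      suffices h0 : alternatingSum (torusOfQuotient e ψ) z = 0 by
        rw [hxz, hF, hsign, h0, zero_mul]
      by_contra hne
      refine hq ⟨(w⁻¹, ⟨z, fun j hj ↦ ?_, ?_⟩), hxz.symm⟩
      · have := lt_of_le_of_ne (h (some ⟨j, hj⟩)) fun h' ↦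
          hne (alternatingSum_eq_zero e hσ hlen he hθ hg ψ _ h'.symm)
        rwa [wall_some] at this
      · have := lt_of_le_of_ne (h none) fun h' ↦
          hne (alternatingSum_eq_zero e hσ hlen he hθ hg ψ _ h'.symm)
        rw [wall_none] at this
        linarith
    · intro p
      rw [hF, hsign]
  rw [Fintype.sum_prod_type] at h2
  simp only [Finset.sum_const, Finset.card_univ, nsmul_eq_mul] at h2
  rw [h1] at h2
  rw [Nat.card_eq_fintype_card]
  exact mul_left_cancel₀ (Nat.cast_ne_zero.2 Fintype.card_ne_zero) h2

end Orthogonality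

/-! ### Evaluation of the denominator and the discriminant -/

section Evaluation

open AddMonoidAlgebra ComplexConjugate

variable {ι M N : Type*} [AddCommGroup M] [Module ℂ M] [AddCommGroup N] [Module ℂ N]
variable {P : RootPairing ι ℂ M N} [P.IsCrystallographic] [P.IsRootSystem] [Fintype ι]

/-- If e^α(t) = 1 then the reflection in α stabilizes t. -/
theorem IsRegular.apply_rootWeight_ne_one {t : Torus P} (ht : IsRegular t) (i : ι) :
    t (rootWeight P i) ≠ 1 := by
  intro h
  have h1 : RootPairing.weylGroup.ofIdx P i = 1 := by
    refine isRegular_eq ht fun x ↦ ?_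
    rw [weylWeight_ofIdx, weylWeight_one, sub_eq_add_neg, AddChar.map_add_eq_mul, ← neg_zsmul,
      AddChar.map_zsmul_eq_zpow, h, one_zpow, mul_one]
  have h2 := weylWeight_ofIdx i (rootWeight P i)
  rw [h1, weylWeight_one, weightPairing_rootWeight_self, eq_comm, sub_eq_self] at h2
  have h3 := congrArg (weightPairing i) h2
  rw [map_zsmul, weightPairing_rootWeight_self, map_zero] at h3
  norm_num at h3

theorem IsRegular.discriminant_ne_zero {t : Torus P} (ht : IsRegular t) :
    discriminant P t ≠ 0 :=
  Finset.prod_ne_zero_iff.2 fun i _ ↦ sub_ne_zero.2 (ht.apply_rootWeight_ne_one i)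

/-- Evaluation of formal characters at a point of the torus. -/
def evalTorus (t : Torus P) : AddMonoidAlgebra ℂ (weightLattice P) →ₐ[ℂ] ℂ :=
  AddMonoidAlgebra.lift ℂ ℂ (weightLattice P) t.toMonoidHom

theorem evalTorus_single (t : Torus P) (μ : weightLattice P) (c : ℂ) :
    evalTorus t (single μ c) = c * t μ := by
  rw [evalTorus, AddMonoidAlgebra.lift_single]
  rfl

theorem discriminant_eq_prod_positiveRoots (b : P.Base) (t : Torus P) :
    discriminant P t =
      ∏ i ∈ positiveRoots b, (t (rootWeight P i) - 1) * (t (-rootWeight P i) - 1) := by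
  classical
  have hinv (i : ι) : P.reflectionPerm (P.reflectionPerm i i) (P.reflectionPerm i i) = i := by
    apply rootWeight_injective (P := P)
    rw [rootWeight_reflectionPerm_self, rootWeight_reflectionPerm_self, neg_neg]
  rw [discriminant, Finset.prod_mul_distrib,
    ← Finset.prod_filter_mul_prod_filter_not Finset.univ fun i ↦ b.IsPos i]
  have hpos : (Finset.univ.filter fun i ↦ b.IsPos i) = positiveRoots b := by
    ext i; simp [mem_positiveRoots]
  rw [hpos]
  congr 1
  symm
  refine Finset.prod_bij' (fun i _ ↦ P.reflectionPerm i i) (fun i _ ↦ P.reflectionPerm i i)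
    (fun i hi ↦ ?_) (fun i hi ↦ ?_) (fun i _ ↦ hinv i) (fun i _ ↦ hinv i) fun i _ ↦ ?_
  · rw [mem_positiveRoots] at hi
    simp only [Finset.mem_filter, Finset.mem_univ, true_and]
    intro h
    have h1 := rootWeight_mem_simpleCone b h
    rw [rootWeight_reflectionPerm_self] at h1
    exact rootWeight_ne_zero i (simpleCone_antisymm b (rootWeight_mem_simpleCone b hi) h1)
  · simp only [Finset.mem_filter, Finset.mem_univ, true_and] at hi
    exact (mem_positiveRoots b).2 ((isPos_or_isPos_reflectionPerm_self b i).resolve_left hi)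
  · rw [rootWeight_reflectionPerm_self]

/-- At a unitary point of the torus, the Weyl denominator is a square root of the discriminant. -/
theorem evalTorus_weylDenominator_mul_conj (b : P.Base) {t : Torus P}
    (ht : ∀ x, conj (t x) = t (-x)) :
    evalTorus t (weylDenominator b) * conj (evalTorus t (weylDenominator b)) =
      discriminant P t := by
  have h1 : evalTorus t (weylDenominator b) =
      t (weylVector b) * ∏ i ∈ positiveRoots b, (1 - t (-rootWeight P i)) := by
    rw [weylDenominator, map_mul, map_prod, evalTorus_single, one_mul]
    congr 1
    refine Finset.prod_congr rfl fun i _ ↦ ?_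
    rw [map_sub, map_one, evalTorus_single, one_mul]
  have h2 : t (weylVector b) * t (-weylVector b) = 1 := by
    rw [← AddChar.map_add_eq_mul, add_neg_cancel, AddChar.map_zero_eq_one]
  rw [h1, discriminant_eq_prod_positiveRoots b, map_mul, map_prod, ht, mul_mul_mul_comm, h2,
    one_mul, ← Finset.prod_mul_distrib]
  refine Finset.prod_congr rfl fun i _ ↦ ?_
  rw [map_sub, map_one, ht, neg_neg]
  ring

/-- For the highest root this says ⟨ρ, θ̌⟩ = ȟ - 1, the source of the shift by ȟ. -/
theorem weightPairing_weylVector_eq_height (b : P.Base) (i : ι) :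
    weightPairing i (weylVector b) = b.flip.height i := by
  obtain ⟨f, -, -, hf⟩ := b.flip.exists_root_eq_sum_int i
  rw [RootPairing.Base.height_eq_sum hf, weightPairing_eq_iff]
  replace hf : P.coroot i = ∑ j ∈ b.support, f j • P.coroot j := hf
  rw [hf, map_sum]
  push_cast
  refine Finset.sum_congr rfl fun j hj ↦ ?_
  rw [map_zsmul, weightPairing_spec, weightPairing_weylVector b hj]
  simp

end Evaluation

/-! ### Traces of torus elements -/

section Trace

open AddMonoidAlgebra ComplexConjugate

variable {L : Type*} [LieRing L] [LieAlgebra ℂ L] [FiniteDimensional ℂ L] [IsKilling ℂ L]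
variable {H : LieSubalgebra ℂ L} [H.IsCartanSubalgebra]
variable {W : Type*} [AddCommGroup W] [Module ℂ W] [LieRingModule L W] [LieModule ℂ L W]
variable [FiniteDimensional ℂ W] {b : (rootSystem H).Base} {Λ : weightLattice (rootSystem H)}

theorem WeightBasis.trace_torusOperator {κ : Type*} [Fintype κ] (D : WeightBasis W b Λ κ)
    (t : Torus (rootSystem H)) :
    LinearMap.trace ℂ W (torusOperator W t) = evalTorus t (character D.weight) := by
  classical
  rw [LinearMap.trace_eq_matrix_trace ℂ D.basis, Matrix.trace, character, map_sum]
  refine Finset.sum_congr rfl fun i _ ↦ ?_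
  rw [Matrix.diag_apply, LinearMap.toMatrix_apply,
    torusOperator_apply W t (D.weight i) (D.basis i) (D.isWeightVector i), evalTorus_single]
  simp

/-- The Weyl character formula, evaluated at a point of the torus. -/
theorem evalTorus_weylDenominator_mul_trace [LieModule.IsIrreducible ℂ L W]
    [Fintype (rootSystem H).weylGroup] (hW : HasHighestWeight W b (Λ : Dual ℂ H))
    (hstab : ∀ w : (rootSystem H).weylGroup,
      weylWeight _ w (weylVector b + Λ) = weylVector b + Λ → w = 1)
    (t : Torus (rootSystem H)) :
    evalTorus t (weylDenominator b) * LinearMap.trace ℂ W (torusOperator W t) =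
      alternatingSum t (weylVector b + Λ) := by
  obtain ⟨n, ⟨D⟩⟩ := hW.exists_weightBasis
  rw [D.trace_torusOperator, ← map_mul, weyl_character_formula D hstab, map_sum, alternatingSum]
  simp only [evalTorus_single]

theorem discriminant_mul_normSq_trace [LieModule.IsIrreducible ℂ L W]
    [Fintype (rootSystem H).weylGroup] (hW : HasHighestWeight W b (Λ : Dual ℂ H))
    (hstab : ∀ w : (rootSystem H).weylGroup,
      weylWeight _ w (weylVector b + Λ) = weylVector b + Λ → w = 1)
    {t : Torus (rootSystem H)} (ht : ∀ x, conj (t x) = t (-x)) :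
    discriminant (rootSystem H) t *
        ((‖LinearMap.trace ℂ W (torusOperator W t)‖ ^ 2 : ℝ) : ℂ) =
      alternatingSum t (weylVector b + Λ) * conj (alternatingSum t (weylVector b + Λ)) := by
  rw [← evalTorus_weylDenominator_mul_trace hW hstab t, ← evalTorus_weylDenominator_mul_conj b ht,
    map_mul, mul_mul_mul_comm, Complex.mul_conj' (LinearMap.trace ℂ W _)]
  push_cast
  rfl

end Trace

/-! ### Level weights, the finite torus and the alcove -/

section Level

open ComplexConjugate

variable {ι M N : Type*} [AddCommGroup M] [Module ℂ M] [AddCommGroup N] [Module ℂ N]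
variable {P : RootPairing ι ℂ M N} [P.IsRootSystem] {b : P.Base}
variable {ι' M' N' : Type*} [AddCommGroup M'] [Module ℂ M'] [AddCommGroup N'] [Module ℂ N']
variable {P' : RootPairing ι' ℂ M' N'} [P'.IsRootSystem] {b' : P'.Base}
variable [P.IsCrystallographic] [P'.IsCrystallographic] [Fintype ι] [Fintype ι']
variable {σ : Equiv.Perm b.support} (e : Orbits σ ≃ b'.support)
variable {θ : ι} {g : weightLattice P'} {ℓ : ℕ}

theorem mem_levelTorus_iff {t : Torus P'} : t ∈ levelTorus b b' σ e θ ℓ ↔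
    ∀ x ∈ levelLattice e (ℓ + dualCoxeterNumber b θ), t x = 1 := by
  constructor
  · rintro ht _ ⟨m, hm, rfl⟩
    have := ht ⟨liftWeight e m, liftWeight_mem e m⟩ hm
    rwa [orbitMap_liftWeight] at this
  · intro ht β hβ
    refine ht _ ⟨_, ?_, rfl⟩
    rwa [SetLike.mem_coe, mem_foldedLattice, liftWeight_orbitMap]

/-- The group of torus points of level `ℓ` is dual to the quotient of the weight lattice. -/
def levelTorusEquiv : levelTorus b b' σ e θ ℓ ≃
    AddChar (weightLattice P' ⧸ levelLattice e (ℓ + dualCoxeterNumber b θ)) ℂ where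
  toFun t := AddChar.toAddMonoidHomEquiv.symm <| QuotientAddGroup.lift _
    (AddChar.toAddMonoidHomEquiv t.1) fun x hx ↦ (mem_levelTorus_iff e).1 t.2 x hx
  invFun ψ := ⟨torusOfQuotient e ψ, (mem_levelTorus_iff e).2 fun x hx ↦ by
    rw [torusOfQuotient_apply, (QuotientAddGroup.eq_zero_iff x).2 hx, AddChar.map_zero_eq_one]⟩
  left_inv t := by
    ext x
    rfl
  right_inv ψ := by
    ext q
    obtain ⟨x, rfl⟩ := QuotientAddGroup.mk_surjective q
    rfl

theorem torusOfQuotient_levelTorusEquiv (t : levelTorus b b' σ e θ ℓ) :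
    torusOfQuotient e (levelTorusEquiv e t) = t.1 :=
  congrArg Subtype.val ((levelTorusEquiv e).symm_apply_apply t)

/-- Adding ρ turns ≥ 0 into > 0 at the simple walls and, as ⟨ρ, θ̌⟩ = ȟ - 1, turns ≤ ℓ into < ℓ + ȟ
at the affine wall. -/
theorem weylVector_add_orbitMap_mem_alcove_iff (μ : invariantWeights b σ) :
    weylVector b' + orbitMap b b' σ e μ ∈ alcove e θ (ℓ + dualCoxeterNumber b θ) ↔
      μ ∈ levelWeights b σ θ ℓ := by
  refine and_congr ⟨fun h i ↦ ?_, fun h j hj ↦ ?_⟩ ?_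
  · have := h _ (e (toOrbit σ i)).2
    rw [map_add, weightPairing_weylVector b' (e (toOrbit σ i)).2, weightPairing_orbitMap] at this
    omega
  · obtain ⟨i, hi⟩ := exists_toOrbit e ⟨j, hj⟩
    have h1 := weightPairing_orbitMap e μ i
    rw [hi] at h1
    rw [map_add, weightPairing_weylVector b' hj, h1]
    have := h i
    omega
  · rw [map_add, map_add, liftWeight_weylVector, liftWeight_orbitMap,
      weightPairing_weylVector_eq_height, dualCoxeterNumber]
    omega

theorem weylVector_mem_alcove : weylVector b' ∈ alcove e θ (ℓ + dualCoxeterNumber b θ) := by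
  have := (weylVector_add_orbitMap_mem_alcove_iff e (θ := θ) (ℓ := ℓ) 0).2
    ⟨fun i ↦ by simp, by simp⟩
  rwa [map_zero, add_zero] at this

/-- Translation by the Weyl vector identifies the weights of level `ℓ` with the alcove. -/
def levelWeightsEquiv :
    levelWeights b σ θ ℓ ≃ alcove e θ (ℓ + dualCoxeterNumber b θ) where
  toFun μ := ⟨weylVector b' + orbitMap b b' σ e μ.1,
    (weylVector_add_orbitMap_mem_alcove_iff e μ.1).2 μ.2⟩
  invFun x := ⟨⟨liftWeight e (x.1 - weylVector b'), liftWeight_mem e _⟩,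
    (weylVector_add_orbitMap_mem_alcove_iff e _).1 (by
      rw [orbitMap_liftWeight, add_sub_cancel]; exact x.2)⟩
  left_inv μ := by
    apply Subtype.ext
    apply Subtype.ext
    change liftWeight e _ = _
    rw [add_sub_cancel_left, liftWeight_orbitMap]
  right_inv x := by
    apply Subtype.ext
    change weylVector b' + orbitMap b b' σ e ⟨_, _⟩ = _
    rw [orbitMap_liftWeight, add_sub_cancel]

theorem finite_alcove (hlen : ∀ i j, rootNorm P i = rootNorm P j) (hθ : IsHighestRoot b θ)
    [Nonempty b.support] (k : ℤ) : (alcove e θ k).Finite := by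
  refine (finite_closed_alcove e hlen hθ (k := k)).subset fun x hx c ↦ ?_
  cases c with
  | none => rw [wall_none]; linarith [hx.2]
  | some j => rw [wall_some]; exact (hx.1 j j.2).le

end Level

end OrbitVerlinde

end

/-- Let `𝔤` be a simple complex Lie algebra with highest root `θ` and a nontrivial diagram
automorphism `σ`, let `𝔤'` be its orbit Lie algebra, let `ℓ` be a positive integer, and let `W μ` be
the irreducible representation of `𝔤'` attached to the weight `μ`. Then
`∑ |tr(t | W μ)|² = |T_{σ,ℓ}| / Δ_σ(t)` for every regular `t` in `T_{σ,ℓ}`. -/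
theorem mainTheorem11
    {𝔤 : Type*} [LieRing 𝔤] [LieAlgebra ℂ 𝔤] [FiniteDimensional ℂ 𝔤]
    [LieAlgebra.IsSimple ℂ 𝔤]
    (𝔥 : LieSubalgebra ℂ 𝔤) [𝔥.IsCartanSubalgebra] (b : (rootSystem 𝔥).Base)
    (σ : Equiv.Perm b.support) (hσ : OrbitVerlinde.IsDiagramAutomorphism b σ) (hσ₁ : σ ≠ 1)
    (θ : 𝔥.root) (hθ : OrbitVerlinde.IsHighestRoot b θ)
    {𝔤' : Type*} [LieRing 𝔤'] [LieAlgebra ℂ 𝔤'] [FiniteDimensional ℂ 𝔤']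
    [LieAlgebra.IsSimple ℂ 𝔤']
    (𝔥' : LieSubalgebra ℂ 𝔤') [𝔥'.IsCartanSubalgebra] (b' : (rootSystem 𝔥').Base)
    (e : OrbitVerlinde.Orbits σ ≃ b'.support) (he : OrbitVerlinde.IsOrbitBase b b' σ e)
    (ℓ : ℕ) (hℓ : 0 < ℓ)
    (W : OrbitVerlinde.levelWeights b σ θ ℓ → Type*)
    [∀ μ, AddCommGroup (W μ)] [∀ μ, Module ℂ (W μ)] [∀ μ, LieRingModule 𝔤' (W μ)]
    [∀ μ, LieModule ℂ 𝔤' (W μ)] [∀ μ, FiniteDimensional ℂ (W μ)]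
    [∀ μ, LieModule.IsIrreducible ℂ 𝔤' (W μ)]
    (hW : ∀ μ, OrbitVerlinde.HasHighestWeight (W μ) b'
      (OrbitVerlinde.orbitMap b b' σ e μ.1 : Dual ℂ 𝔥'))
    (t : OrbitVerlinde.Torus (rootSystem 𝔥'))
    (ht : t ∈ OrbitVerlinde.levelTorus b b' σ e θ ℓ) (htreg : OrbitVerlinde.IsRegular t) :
    (OrbitVerlinde.levelWeights b σ θ ℓ).Finite ∧
    Finite (OrbitVerlinde.levelTorus b b' σ e θ ℓ) ∧
    OrbitVerlinde.discriminant (rootSystem 𝔥') t ≠ 0 ∧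
    ((∑ᶠ μ, ‖LinearMap.trace ℂ (W μ) (OrbitVerlinde.torusOperator (W μ) t)‖ ^ 2 : ℝ) : ℂ) =
      (Nat.card (OrbitVerlinde.levelTorus b b' σ e θ ℓ) : ℂ) /
        OrbitVerlinde.discriminant (rootSystem 𝔥') t := by
  open OrbitVerlinde ComplexConjugate in
  have : Nonempty b.support := by
    by_contra h
    rw [not_nonempty_iff] at h
    exact hσ₁ (Subsingleton.elim _ _)
  have hlen := rootNorm_eq_of_isDiagramAutomorphism σ hσ hσ₁
  have hg := liftWeight_orbitMap e ⟨_, hθ.mem_invariantWeights hσ⟩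
  have hρ := weylVector_mem_alcove e (θ := θ) (ℓ := ℓ)
  set k : ℤ := ℓ + dualCoxeterNumber b θ with hk
  have := (finite_alcove e hlen hθ k).to_subtype
  have := Fintype.ofFinite (alcove e θ k)
  have := finite_weylGroup (P := rootSystem 𝔥')
  have := Fintype.ofFinite (rootSystem 𝔥').weylGroup
  have := finite_quotient_levelLattice e hσ hlen he hθ hg hρ
  have := Fintype.ofFinite (weightLattice (rootSystem 𝔥') ⧸ levelLattice e k)
  have : Finite (levelWeights b σ θ ℓ) := Finite.of_equiv _ (levelWeightsEquiv e).symm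
  have := Fintype.ofFinite (levelWeights b σ θ ℓ)
  have htor : Finite (levelTorus b b' σ e θ ℓ) := Finite.of_equiv _ (levelTorusEquiv e).symm
  -- A finite abelian group has as many complex characters as elements.
  have hcard : Nat.card (levelTorus b b' σ e θ ℓ) =
      Nat.card (weightLattice (rootSystem 𝔥') ⧸ levelLattice e k) := by
    rw [Nat.card_congr (levelTorusEquiv e), Nat.card_eq_fintype_card, Nat.card_eq_fintype_card,
      ← AddChar.card_eq (α := weightLattice (rootSystem 𝔥') ⧸ levelLattice e k)]
  refine ⟨Set.toFinite _, htor, htreg.discriminant_ne_zero, ?_⟩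
  rw [eq_div_iff htreg.discriminant_ne_zero, finsum_eq_sum_of_fintype, hcard]
  have hψ : torusOfQuotient e (levelTorusEquiv e ⟨t, ht⟩) = t :=
    torusOfQuotient_levelTorusEquiv e ⟨t, ht⟩
  -- The point t is a character of a finite group, so its values are roots of unity.
  have hconj (x : weightLattice (rootSystem 𝔥')) : conj (t x) = t (-x) := by
    rw [← hψ, torusOfQuotient_apply, torusOfQuotient_apply, ← AddChar.map_neg_eq_conj]
    rfl
  rw [← sum_normSq_alcove e hσ hlen he hθ hg hρ (ψ := levelTorusEquiv e ⟨t, ht⟩)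
    (by rwa [hψ]), hψ, ← (levelWeightsEquiv e).sum_comp, mul_comm]
  push_cast
  rw [Finset.mul_sum]
  refine Finset.sum_congr rfl fun μ _ ↦ ?_
  have hμ := (weylVector_add_orbitMap_mem_alcove_iff e μ.1).2 μ.2
  -- The trivial stabilizer of ρ + ι(λ) required by the character formula is the case of translation
  -- 0 in the freeness of the affine group.
  have := discriminant_mul_normSq_trace (hW μ) (fun w hw ↦
    (eq_of_mem_alcove e hσ hlen he hθ hg hμ (zero_mem _) (by
      rw [hw, smul_zero, add_zero]; exact hμ)).1) hconj
  push_cast at this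
  exact this
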